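/- An addition chain of length $r$ for a positive integer $n$ is a sequence of integers $1=a_0<a_1<\dots<a_r=n$ in which every $a_k$ with $k\ge 1$ is a sum $a_i+a_j$ of two (possibly equal) preceding terms. Let $\ell(n)$ be the least length of an addition chain for $n$. The Scholz conjecture is said to hold for $n$ if $\ell(2^n-1)\le \ell(n)+n-1$. Theorem. For integers $m\ge 1$ and $k\ge 3$ let $$ n_{m,k}=(5\cdot 2^{m+2}+3)\cdot 2^{m+k+3}+(3\cdot 2^{m+1}+1), $$ the integer with binary expansion $101\,\underbrace{0\cdots0}_{m}\,11\,\underbrace{0\cdots0}_{k}\,11\,\underbrace{0\cdots0}_{m}\,1$. Then for all such $m,k$ we have $\ell(2n_{m,k})=\ell(n_{m,k})$, and the Scholz conjecture holds for both $n_{m,k}$ and $2n_{m,k}$. In particular, there are infinitely many positive integers $n$ with $\ell(2n)=\ell(n)$ such that the Scholz conjecture holds for both $n$ and $2n$. -/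

import Mathlib

/-- `a 0, a 1, …, a r` is an addition chain of length `r` for `n`: it increases strictly from `1`
to `n`, and each later term is the sum of two (possibly equal) preceding terms.
The values of `a` beyond the index `r` play no role. -/
def IsAdditionChain (n r : ℕ) (a : ℕ → ℕ) : Prop :=
  a 0 = 1 ∧ a r = n ∧ (∀ k < r, a k < a (k + 1)) ∧
    ∀ k, 1 ≤ k → k ≤ r → ∃ i < k, ∃ j < k, a k = a i + a j

/-- `ℓ(n)`, the least length of an addition chain for the positive integer `n`. -/
noncomputable def chainLength (n : ℕ) : ℕ :=
  sInf {r : ℕ | ∃ a : ℕ → ℕ, IsAdditionChain n r a}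

/-- Every positive integer has an addition chain, so that the infimum in `chainLength` is
attained. -/
theorem exists_isAdditionChain (n : ℕ) (hn : 0 < n) :
    ∃ r : ℕ, ∃ a : ℕ → ℕ, IsAdditionChain n r a := by
  refine ⟨n - 1, fun i => i + 1, rfl, by simp only; omega, fun k _ => by simp only; omega, ?_⟩
  intro k h1 _
  exact ⟨k - 1, by omega, 0, by omega, by simp only; omega⟩

/-- The Scholz conjecture for the positive integer `n`: `ℓ(2ⁿ - 1) ≤ ℓ(n) + n - 1`. -/
def ScholzHolds (n : ℕ) : Prop :=
  chainLength (2 ^ n - 1) ≤ chainLength n + n - 1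

/-- The integer with binary expansion `101 0…0 11 0…0 11 0…0 1`, where the three blocks of zeros
have lengths `m`, `k`, `m`. -/
def thurberNumber (m k : ℕ) : ℕ :=
  (5 * 2 ^ (m + 2) + 3) * 2 ^ (m + k + 3) + (3 * 2 ^ (m + 1) + 1)

/-! Call the exponent `L` with `2 ^ L ≤ x < 2 ^ (L + 1)` the level of `x`. A step of a chain is
small if it does not raise the level of the last term, so the length of a chain is its final level
plus its number of small steps. Let `n` be a Thurber number. It has level `2 * m + k + 7` and seven
binary ones. Explicit star chains of length `2 * m + k + 11` reach `n` and `2 * n`. What remains is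
that `n` cannot be reached with three small steps, nor `2 * n`, which lies one level higher, with
two. Both star chains are then optimal, and Brauer's construction (`StarChain.mersenne`) turns
optimal star chains into the Scholz inequality.

For `2 * n` it suffices that a chain with two small steps has only terms with at most four ones
(`Ch.nu_le_four`). This is not the trivial consequence of subadditivity, since steps that are not
small may also add distinct terms. It rests on the classification of chains with one small step
(`OneSmallShape`): their terms have at most two ones, and the gaps between these ones are almost
constant (`Ch.gap_compat`). It also uses the loss of ones through carries (`nu_add_carry'`) and the
fact that above the last small step each level contains exactly one term (`BigExt.unique`).

For `n`, cut a chain with three small steps at the last of them. Since `n` is odd and lies between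
`5/4` and `11/8` of a power of two, `BigExt.structure` leaves few ways to build it, and
`Target.cases` condenses them to three representations of `n` by terms of a chain with two small
steps: a sum with a summand at the level of `n`, `3 * X + 2 * q`, and `3 * (x + y)`. Each is refuted
by digit counts, by the gap condition, and by a finite automaton that reads the equation `α * y + β
* u = N` digit by digit while tracking the carry and the remaining ones of `y` and `u`. The
automaton treats all `m` and `k` at once because blocks of zeros only need a set of states closed
under reading a zero. -/

/-! ### Addition chains as lists, star chains and Brauer's bound -/

/-- `AddChain r l`: the list `l` is an addition chain of length `r`, written in decreasing order. -/
inductive AddChain : ℕ → List ℕ → Prop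
  | one : AddChain 0 [1]
  | step {r h a b : ℕ} {l : List ℕ} : AddChain r (h :: l) → a ∈ h :: l → b ∈ h :: l → h < a + b →
      AddChain (r + 1) ((a + b) :: h :: l)

/-- A star chain: every term is the sum of the preceding one and some earlier term. -/
inductive StarChain : ℕ → List ℕ → Prop
  | one : StarChain 0 [1]
  | step {r h b : ℕ} {l : List ℕ} : StarChain r (h :: l) → b ∈ h :: l →
      StarChain (r + 1) ((h + b) :: h :: l)

theorem AddChain.exists_fun {r : ℕ} {l : List ℕ} (hl : AddChain r l) :
    ∃ a : ℕ → ℕ, IsAdditionChain (l.headD 0) r a ∧ ∀ x ∈ l, ∃ i ≤ r, a i = x := by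
  induction hl with
  | one => exact ⟨fun _ => 1, ⟨rfl, rfl, by omega, by omega⟩, by simp⟩
  | @step r h x y l _ hx hy hlt ih =>
    obtain ⟨a, ⟨h0, hr, hinc, hsum⟩, hmem⟩ := ih
    obtain ⟨i, hi, hix⟩ := hmem x hx
    obtain ⟨j, hj, hjy⟩ := hmem y hy
    simp only [List.headD_cons] at hr ⊢
    refine ⟨fun k => if k ≤ r then a k else x + y, ⟨by simp [h0], by simp, ?_, ?_⟩, ?_⟩
    · intro k hk
      rcases Nat.lt_succ_iff_lt_or_eq.1 hk with hk | rfl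
      · simp only [hk.le, if_true, Nat.succ_le_of_lt hk]
        exact hinc k hk
      · simp only [le_refl, if_true, show ¬ (k + 1 ≤ k) by omega, if_false]
        omega
    · intro k h1 hk
      rcases Nat.le_succ_iff.1 hk with hk | rfl
      · obtain ⟨i', hi', j', hj', e⟩ := hsum k h1 hk
        refine ⟨i', hi', j', hj', ?_⟩
        simp only [hk, if_true, show i' ≤ r by omega, show j' ≤ r by omega]
        exact e
      · refine ⟨i, by omega, j, by omega, ?_⟩
        simp only [hi, hj, if_true, Nat.succ_eq_add_one, show ¬ (r + 1 ≤ r) by omega, if_false]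
        omega
    · intro z hz
      rcases List.mem_cons.1 hz with rfl | hz
      · exact ⟨r + 1, le_rfl, by simp⟩
      · obtain ⟨i', hi', e⟩ := hmem z hz
        exact ⟨i', by omega, by simp [hi', e]⟩

theorem chainLength_le_of_addChain {r n : ℕ} {l : List ℕ} (hl : AddChain r (n :: l)) :
    chainLength n ≤ r := by
  obtain ⟨a, ha, _⟩ := hl.exists_fun
  exact Nat.sInf_le ⟨a, ha⟩

theorem exists_addChain {n : ℕ} (hn : 0 < n) : ∃ l, AddChain (chainLength n) (n :: l) := by
  obtain ⟨a, h0, hr, hinc, hsum⟩ : ∃ a, IsAdditionChain n (chainLength n) a :=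
    Nat.sInf_mem (s := {r : ℕ | ∃ a : ℕ → ℕ, IsAdditionChain n r a}) (exists_isAdditionChain n hn)
  suffices h : ∀ k ≤ chainLength n, ∃ l, AddChain k (a k :: l) ∧ ∀ i ≤ k, a i ∈ a k :: l by
    obtain ⟨l, hl, -⟩ := h _ le_rfl
    rw [hr] at hl
    exact ⟨l, hl⟩
  intro k
  induction k with
  | zero => exact fun _ => ⟨[], by rw [h0]; exact .one, by simp⟩
  | succ k ih =>
    intro hk
    obtain ⟨l, hl, hmem⟩ := ih (by omega)
    obtain ⟨i, hi, j, hj, e⟩ := hsum (k + 1) (by omega) hk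
    have hlt := hinc k (by omega)
    refine ⟨a k :: l, ?_, ?_⟩
    · rw [e]
      exact hl.step (hmem i (by omega)) (hmem j (by omega)) (by omega)
    · intro i' hi'
      rcases Nat.le_succ_iff.1 hi' with hi' | rfl
      · exact List.mem_cons_of_mem _ (hmem i' hi')
      · exact List.mem_cons_self

theorem StarChain.pos {r : ℕ} {l : List ℕ} (hl : StarChain r l) : ∀ x ∈ l, 0 < x := by
  induction hl with
  | one => simp
  | step _ hb ih =>
    intro x hx
    rcases List.mem_cons.1 hx with rfl | hx
    · have := ih _ hb
      omega
    · exact ih x hx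

theorem StarChain.addChain {r : ℕ} {l : List ℕ} (hl : StarChain r l) : AddChain r l := by
  induction hl with
  | one => exact .one
  | step h hb ih =>
    have := h.pos _ hb
    exact ih.step List.mem_cons_self hb (by omega)

theorem StarChain.double {r h : ℕ} {l : List ℕ} (hl : StarChain r (h :: l)) (j : ℕ) :
    ∃ l', StarChain (r + j) (h * 2 ^ j :: l') ∧ ∀ x ∈ h :: l, x ∈ h * 2 ^ j :: l' := by
  induction j with
  | zero => exact ⟨l, by simpa using hl, by simp⟩
  | succ j ih =>
    obtain ⟨l', h1, h2⟩ := ih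
    have h3 := h1.step List.mem_cons_self
    rw [← mul_two, mul_assoc, ← pow_succ, add_assoc] at h3
    exact ⟨_, h3, fun x hx => List.mem_cons_of_mem _ (h2 x hx)⟩

theorem AddChain.double {r h : ℕ} {l : List ℕ} (hl : AddChain r (h :: l)) (hh : 0 < h) (j : ℕ) :
    ∃ l', AddChain (r + j) (h * 2 ^ j :: l') ∧ ∀ x ∈ h :: l, x ∈ h * 2 ^ j :: l' := by
  induction j with
  | zero => exact ⟨l, by simpa using hl, by simp⟩
  | succ j ih =>
    obtain ⟨l', h1, h2⟩ := ih
    have := Nat.mul_pos hh (Nat.two_pow_pos j)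
    have h3 := h1.step List.mem_cons_self List.mem_cons_self (by omega)
    rw [← mul_two, mul_assoc, ← pow_succ, add_assoc] at h3
    exact ⟨_, h3, fun x hx => List.mem_cons_of_mem _ (h2 x hx)⟩

/-- Brauer's theorem: a star chain for `n` yields a chain for `2 ^ n - 1`. -/
theorem StarChain.mersenne {r : ℕ} {l : List ℕ} (hl : StarChain r l) :
    ∃ l', AddChain (l.headD 0 - 1 + r) ((2 ^ l.headD 0 - 1) :: l') ∧
      ∀ x ∈ l, 2 ^ x - 1 ∈ (2 ^ l.headD 0 - 1) :: l' := by
  induction hl with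
  | one => exact ⟨[], .one, by simp⟩
  | @step r h b l hl hb ih =>
    obtain ⟨l', h1, h2⟩ := ih
    simp only [List.headD_cons] at h1 h2 ⊢
    have hh := hl.pos h List.mem_cons_self
    have hbp := hl.pos b hb
    have e1 : 2 ≤ 2 ^ h := by simpa using Nat.pow_le_pow_right (n := 2) (by omega) hh
    have e2 : 2 ≤ 2 ^ b := by simpa using Nat.pow_le_pow_right (n := 2) (by omega) hbp
    -- From `2 ^ h - 1`, `b` doublings and the addition of `2 ^ b - 1`, which the membership clause
    -- of the induction keeps available, lead to `2 ^ (h + b) - 1`. The cost `b + 1` is exactly the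
    -- growth of `h - 1 + r`.
    obtain ⟨l'', h3, h4⟩ := h1.double (by omega) b
    have e3 : (2 ^ h - 1) * 2 ^ b + (2 ^ b - 1) = 2 ^ (h + b) - 1 := by
      have := Nat.mul_le_mul e1 (le_refl (2 ^ b))
      rw [pow_add, Nat.sub_mul]
      omega
    have h5 := h3.step List.mem_cons_self (h4 _ (h2 b hb)) (by omega)
    rw [e3, show h - 1 + r + b + 1 = h + b - 1 + (r + 1) by omega] at h5
    refine ⟨_, h5, ?_⟩
    · intro x hx
      rcases List.mem_cons.1 hx with rfl | hx
      · exact List.mem_cons_self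
      · exact List.mem_cons_of_mem _ (h4 _ (h2 x hx))

/-- Brauer's chain has length `n - 1 + r`, so an optimal star chain is all that the Scholz
inequality needs. -/
theorem scholzHolds_of_starChain {n r : ℕ} {l : List ℕ} (hl : StarChain r (n :: l))
    (hr : r ≤ chainLength n) : ScholzHolds n := by
  have hn := hl.pos n List.mem_cons_self
  obtain ⟨l', h, -⟩ := hl.mersenne
  have := chainLength_le_of_addChain h
  simp only [List.headD_cons] at this
  unfold ScholzHolds
  omega

/-! ### Explicit star chains for the Thurber numbers and their doubles -/

/-- The chain `1, 2, 3, 5` is continued by reading the remaining digits: shift and add `3` for each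
block `11`, shift and add `1` for the last digit. -/
theorem thurberNumber_starChain (m k : ℕ) :
    ∃ l, StarChain (2 * m + k + 11) (thurberNumber m k :: l) := by
  have h5 : StarChain 3 [5, 3, 2, 1] := by
    have h2 : StarChain 1 [1 + 1, 1] := StarChain.one.step (by simp)
    have h3 : StarChain 2 [2 + 1, 2, 1] := h2.step (by simp)
    exact h3.step (b := 2) (by simp)
  obtain ⟨l1, h1, m1⟩ := h5.double (m + 2)
  have h2 := h1.step (b := 3) (m1 3 (by simp))
  obtain ⟨l3, h3, m3⟩ := h2.double (k + 2)
  have h4 := h3.step (b := 3) (m3 3 (List.mem_cons_of_mem _ (m1 3 (by simp))))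
  obtain ⟨l5, h5', m5⟩ := h4.double (m + 1)
  have h6 := h5'.step (b := 1)
    (m5 1 (List.mem_cons_of_mem _ (m3 1 (List.mem_cons_of_mem _ (m1 1 (by simp))))))
  rw [show 3 + (m + 2) + 1 + (k + 2) + 1 + (m + 1) + 1 = 2 * m + k + 11 by ring,
    show ((5 * 2 ^ (m + 2) + 3) * 2 ^ (k + 2) + 3) * 2 ^ (m + 1) + 1 = thurberNumber m k by
      unfold thurberNumber; ring] at h6
  exact ⟨_, h6⟩

/-- With `H = 2 ^ (m + 2)`, the doubled number is `(5 * H + 3) * 2 ^ (m + k + 4) + (3 * H + 2)`. The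
terms `H + 1, 2 * H + 1, 3 * H + 2, 5 * H + 3` arise by Fibonacci-like additions, so both halves lie
in one short chain. This is how doubling comes for free. -/
theorem two_mul_thurberNumber_starChain (m k : ℕ) :
    ∃ l, StarChain (2 * m + k + 11) (2 * thurberNumber m k :: l) := by
  obtain ⟨l1, h1, m1⟩ := StarChain.one.double (m + 2)
  simp only [one_mul] at h1 m1
  have h2 := h1.step (b := 1) (m1 1 (by simp))
  have h3 := h2.step (b := 2 ^ (m + 2)) (by simp)
  have h4 := h3.step (b := 2 ^ (m + 2) + 1) (by simp)
  have h5 := h4.step (b := 2 ^ (m + 2) + 1 + 2 ^ (m + 2)) (by simp)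
  obtain ⟨l6, h6, m6⟩ := h5.double (m + k + 4)
  have h7 := h6.step (m6 (2 ^ (m + 2) + 1 + 2 ^ (m + 2) + (2 ^ (m + 2) + 1)) (by simp))
  rw [show 0 + (m + 2) + 1 + 1 + 1 + 1 + (m + k + 4) + 1 = 2 * m + k + 11 by ring,
    show (2 ^ (m + 2) + 1 + 2 ^ (m + 2) + (2 ^ (m + 2) + 1) + (2 ^ (m + 2) + 1 + 2 ^ (m + 2))) *
      2 ^ (m + k + 4) + (2 ^ (m + 2) + 1 + 2 ^ (m + 2) + (2 ^ (m + 2) + 1)) =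
      2 * thurberNumber m k by unfold thurberNumber; ring] at h7
  exact ⟨_, h7⟩

theorem thurberNumber_injective_right (m : ℕ) : Function.Injective (thurberNumber m) := by
  intro k k' h
  unfold thurberNumber at h
  have h1 : 2 ^ (m + k + 3) = 2 ^ (m + k' + 3) := by
    have h2 := Nat.add_right_cancel h
    exact Nat.eq_of_mul_eq_mul_left (by positivity) h2
  have := Nat.pow_right_injective (le_refl 2) h1
  omega

theorem infinite_of_thurberNumber {p : ℕ → Prop}
    (h : ∀ k, 3 ≤ k → p (thurberNumber 1 k)) : {n : ℕ | p n}.Infinite := by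
  refine Set.infinite_of_injective_forall_mem (f := fun k => thurberNumber 1 (k + 3)) ?_
    fun k => h _ (by omega)
  intro k k' e
  have := thurberNumber_injective_right 1 e
  omega

/-! ### Binary digit sums and the loss of ones through carries -/

/-- The number of ones in the binary expansion of `n`. -/
def nu (n : ℕ) : ℕ := (Nat.digits 2 n).sum

@[simp] theorem nu_zero : nu 0 = 0 := by simp [nu]

@[simp] theorem nu_one : nu 1 = 1 := by simp [nu]

@[simp] theorem nu_two_mul (n : ℕ) : nu (2 * n) = nu n := by
  rcases Nat.eq_zero_or_pos n with rfl | hn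
  · simp
  · unfold nu
    rw [Nat.digits_def' (by omega) (by omega)]
    simp

@[simp] theorem nu_two_mul_add_one (n : ℕ) : nu (2 * n + 1) = nu n + 1 := by
  unfold nu
  rw [Nat.digits_def' (by omega) (by omega)]
  have h1 : (2 * n + 1) % 2 = 1 := by omega
  have h2 : (2 * n + 1) / 2 = n := by omega
  rw [h1, h2, List.sum_cons, add_comm]

theorem nu_add_le (a b : ℕ) : nu (a + b) ≤ nu a + nu b := by
  -- The second inequality is the sum with an incoming carry, which the induction meets when both
  -- last digits are one.
  suffices h : ∀ n a b, a + b ≤ n → nu (a + b) ≤ nu a + nu b ∧ nu (a + b + 1) ≤ nu a + nu b + 1 from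
    (h _ a b le_rfl).1
  intro n
  induction n with
  | zero =>
    intro a b h
    obtain ⟨rfl, rfl⟩ : a = 0 ∧ b = 0 := by omega
    simp
  | succ n ih =>
    intro a b h
    by_cases h0 : a + b = 0
    · obtain ⟨rfl, rfl⟩ : a = 0 ∧ b = 0 := by omega
      simp
    rcases Nat.even_or_odd' a with ⟨a', rfl | rfl⟩ <;> rcases Nat.even_or_odd' b with ⟨b', rfl | rfl⟩
    · have := ih a' b' (by omega)
      rw [show 2 * a' + 2 * b' = 2 * (a' + b') by ring]
      simp only [nu_two_mul, nu_two_mul_add_one]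
      omega
    · have := ih a' b' (by omega)
      rw [show 2 * a' + (2 * b' + 1) = 2 * (a' + b') + 1 by ring,
        show 2 * (a' + b') + 1 + 1 = 2 * (a' + b' + 1) by ring]
      simp only [nu_two_mul, nu_two_mul_add_one]
      omega
    · have := ih a' b' (by omega)
      rw [show 2 * a' + 1 + 2 * b' = 2 * (a' + b') + 1 by ring,
        show 2 * (a' + b') + 1 + 1 = 2 * (a' + b' + 1) by ring]
      simp only [nu_two_mul, nu_two_mul_add_one]
      omega
    · have := ih a' b' (by omega)
      rw [show 2 * a' + 1 + (2 * b' + 1) = 2 * (a' + b' + 1) by ring]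
      simp only [nu_two_mul, nu_two_mul_add_one]
      omega

theorem nu_two_pow_mul (k n : ℕ) : nu (2 ^ k * n) = nu n := by
  induction k with
  | zero => simp
  | succ k ih => rw [pow_succ, show 2 ^ k * 2 * n = 2 * (2 ^ k * n) by ring, nu_two_mul, ih]

@[simp] theorem nu_two_pow (k : ℕ) : nu (2 ^ k) = 1 := by
  simpa using nu_two_pow_mul k 1

theorem nu_mul_le (a b : ℕ) : nu (a * b) ≤ nu a * nu b := by
  induction a using Nat.strong_induction_on with
  | _ a ih =>
    rcases Nat.even_or_odd' a with ⟨a', rfl | rfl⟩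
    · rcases Nat.eq_zero_or_pos a' with rfl | h
      · simp
      · rw [mul_assoc, nu_two_mul, nu_two_mul]
        exact ih a' (by omega)
    · have h1 := ih a' (by omega)
      rw [show (2 * a' + 1) * b = 2 * (a' * b) + b by ring, nu_two_mul_add_one]
      refine (nu_add_le _ _).trans ?_
      rw [nu_two_mul]
      nlinarith

theorem nu_two_pow_mul_add {k r : ℕ} (a : ℕ) (hr : r < 2 ^ k) :
    nu (2 ^ k * a + r) = nu a + nu r := by
  induction k generalizing r with
  | zero =>
    obtain rfl : r = 0 := by simpa using hr
    simp
  | succ k ih =>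
    rw [pow_succ] at hr
    rcases Nat.even_or_odd' r with ⟨r', rfl | rfl⟩
    · rw [pow_succ, show 2 ^ k * 2 * a + 2 * r' = 2 * (2 ^ k * a + r') by ring, nu_two_mul,
        nu_two_mul, ih (by omega)]
    · rw [pow_succ, show 2 ^ k * 2 * a + (2 * r' + 1) = 2 * (2 ^ k * a + r') + 1 by ring,
        nu_two_mul_add_one, nu_two_mul_add_one, ih (by omega), add_assoc]

theorem nu_two_pow_add {k r : ℕ} (hr : r < 2 ^ k) : nu (2 ^ k + r) = nu r + 1 := by
  have := nu_two_pow_mul_add 1 hr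
  simp only [mul_one, nu_one] at this
  omega

theorem nu_pos {n : ℕ} (h : 0 < n) : 0 < nu n := by
  induction n using Nat.strong_induction_on with
  | _ n ih =>
    rcases Nat.even_or_odd' n with ⟨a, rfl | rfl⟩
    · rw [nu_two_mul]; exact ih a (by omega) (by omega)
    · rw [nu_two_mul_add_one]; omega

theorem exists_two_pow_add {n : ℕ} (h : 0 < n) :
    ∃ k r, n = 2 ^ k + r ∧ r < 2 ^ k ∧ nu n = nu r + 1 := by
  refine ⟨Nat.log 2 n, n - 2 ^ Nat.log 2 n, ?_, ?_, ?_⟩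
  · have := Nat.pow_log_le_self 2 h.ne'
    omega
  · have := Nat.lt_pow_succ_log_self (b := 2) (by omega) n
    rw [pow_succ] at this
    have := Nat.two_pow_pos (Nat.log 2 n)
    omega
  · have h1 := Nat.pow_log_le_self 2 h.ne'
    have h2 := Nat.lt_pow_succ_log_self (b := 2) (by omega) n
    rw [pow_succ] at h2
    rw [← nu_two_pow_add (k := Nat.log 2 n) (r := n - 2 ^ Nat.log 2 n) (by omega)]
    congr 1
    omega

theorem exists_two_pow_of_nu_le_one {n : ℕ} (h : 0 < n) (hn : nu n ≤ 1) : ∃ i, n = 2 ^ i := by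
  obtain ⟨k, r, rfl, hr, e⟩ := exists_two_pow_add h
  refine ⟨k, ?_⟩
  by_contra hne
  have := nu_pos (n := r) (by omega)
  omega

/-- Adding `u` to `z` with a carry through the positions `j, …, j + d` loses that many ones. -/
theorem nu_add_carry {z u : ℕ} (j d : ℕ) (hz : z < 2 ^ (j + d + 1)) (hu : u < 2 ^ (j + 1))
    (h : 2 ^ (j + d + 1) ≤ z + u) : nu (z + u) + d + 1 ≤ nu z + nu u := by
  induction d generalizing z with
  | zero =>
    simp only [add_zero] at hz h ⊢
    induction j generalizing z u with
    | zero =>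
      obtain ⟨rfl, rfl⟩ : z = 1 ∧ u = 1 := by simp at hz hu h; omega
      simpa using (nu_two_mul 1).le
    | succ j ih =>
      rw [pow_succ] at hz hu h
      rcases Nat.even_or_odd' z with ⟨a', rfl | rfl⟩ <;>
        rcases Nat.even_or_odd' u with ⟨b', rfl | rfl⟩
      · have := ih (z := a') (u := b') (by omega) (by omega) (by omega)
        rw [show 2 * a' + 2 * b' = 2 * (a' + b') by ring]
        simp only [nu_two_mul]
        omega
      · have := ih (z := a') (u := b') (by omega) (by omega) (by omega)
        rw [show 2 * a' + (2 * b' + 1) = 2 * (a' + b') + 1 by ring]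
        simp only [nu_two_mul, nu_two_mul_add_one]
        omega
      · have := ih (z := a') (u := b') (by omega) (by omega) (by omega)
        rw [show 2 * a' + 1 + 2 * b' = 2 * (a' + b') + 1 by ring]
        simp only [nu_two_mul, nu_two_mul_add_one]
        omega
      · have h1 := nu_add_le a' b'
        have h2 := nu_add_le (a' + b') 1
        rw [show 2 * a' + 1 + (2 * b' + 1) = 2 * (a' + b' + 1) by ring]
        simp only [nu_two_mul, nu_two_mul_add_one, nu_one] at *
        omega
  | succ d ih =>
    have e : 2 ^ (j + (d + 1) + 1) = 2 * 2 ^ (j + d + 1) := by ring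
    have e' : 2 ^ (j + d + 1) = 2 ^ d * 2 ^ (j + 1) := by ring
    have e'' : 2 ^ (j + 1) ≤ 2 ^ (j + d + 1) := Nat.pow_le_pow_right (by omega) (by omega)
    rw [e] at hz h
    -- As `u` is too short to reach the top position, `z` must have a one there. Without it the sum
    -- still overflows one position lower, and the carry destroys this one as well.
    obtain ⟨z', rfl⟩ : ∃ z', z = 2 ^ (j + d + 1) + z' := ⟨z - 2 ^ (j + d + 1), by omega⟩
    have h1 := ih (z := z') (by omega) (by omega)
    obtain ⟨r, hr⟩ : ∃ r, z' + u = 2 ^ (j + d + 1) + r := ⟨z' + u - 2 ^ (j + d + 1), by omega⟩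
    have h2 : nu (z' + u) = nu r + 1 := by rw [hr, nu_two_pow_add (by omega)]
    have h3 : nu (2 ^ (j + d + 1) + z') = nu z' + 1 := nu_two_pow_add (by omega)
    have h4 : nu (2 ^ (j + d + 1) + z' + u) = nu r + 1 := by
      rw [show 2 ^ (j + d + 1) + z' + u = 2 ^ (j + (d + 1) + 1) + r by rw [e]; omega,
        nu_two_pow_add (by rw [e]; omega)]
    omega

/-- The form of `nu_add_carry` in which the exponents are compared by hypotheses. -/
theorem nu_add_carry' {z u : ℕ} (j d L : ℕ) (hL : L = j + d) (hz : z < 2 ^ (L + 1))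
    (hu : u < 2 ^ (j + 1)) (h : 2 ^ (L + 1) ≤ z + u) : nu (z + u) + d + 1 ≤ nu z + nu u := by
  subst hL
  exact nu_add_carry j d hz hu h

/-! ### Levels, small steps and extensions without small steps -/

/-- `Ch s L l`: the list `l` consists of the terms of an addition chain whose last term lies in
`[2 ^ L, 2 ^ (L + 1))` and which has at most `s` small steps (steps that stay below the next power
of two). -/
inductive Ch : ℕ → ℕ → List ℕ → Prop
  | one : Ch 0 0 [1]
  | big {s L a b : ℕ} {l : List ℕ} : Ch s L l → a ∈ l → b ∈ l → 2 ^ (L + 1) ≤ a + b →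
      Ch s (L + 1) ((a + b) :: l)
  | small {s L a b : ℕ} {l : List ℕ} : Ch s L l → a ∈ l → b ∈ l → 2 ^ L ≤ a + b →
      a + b < 2 ^ (L + 1) → Ch (s + 1) L ((a + b) :: l)
  | waste {s L : ℕ} {l : List ℕ} : Ch s L l → Ch (s + 1) L l

/-- `BigExt base t L l`: the list `l` arises from `base`, with largest term in `[2 ^ t, 2 ^ (t + 1))`,
by steps that are not small. -/
inductive BigExt (base : List ℕ) (t : ℕ) : ℕ → List ℕ → Prop
  | nil : BigExt base t t base
  | big {L a b : ℕ} {l : List ℕ} : BigExt base t L l → a ∈ l → b ∈ l → 2 ^ (L + 1) ≤ a + b →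
      BigExt base t (L + 1) ((a + b) :: l)

theorem Ch.lt {s L z : ℕ} {l : List ℕ} (h : Ch s L l) (hz : z ∈ l) : z < 2 ^ (L + 1) := by
  induction h generalizing z with
  | one => simp at hz; omega
  | @big s L a b l _ ha hb _ ih =>
    have e : 2 ^ (L + 1 + 1) = 2 * 2 ^ (L + 1) := by ring
    rcases List.mem_cons.1 hz with rfl | hz
    · have := ih ha
      have := ih hb
      omega
    · have := ih hz
      omega
  | small _ _ _ _ hlt ih =>
    rcases List.mem_cons.1 hz with rfl | hz
    · exact hlt
    · exact ih hz
  | waste _ ih => exact ih hz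

theorem Ch.pos {s L z : ℕ} {l : List ℕ} (h : Ch s L l) (hz : z ∈ l) : 0 < z := by
  induction h generalizing z with
  | one => simp at hz; omega
  | @big s L a b l _ ha hb _ ih =>
    rcases List.mem_cons.1 hz with rfl | hz
    · have := ih ha
      omega
    · exact ih hz
  | small _ ha _ _ _ ih =>
    rcases List.mem_cons.1 hz with rfl | hz
    · have := ih ha
      omega
    · exact ih hz
  | waste _ ih => exact ih hz

/-- Levels never decrease along a chain, so the terms up to level `j` form a chain by themselves.
Small steps made above level `j` survive only as `waste`, which is what that constructor is for. -/
theorem Ch.trunc {s L : ℕ} {l : List ℕ} (h : Ch s L l) {j : ℕ} (hj : j ≤ L) :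
    ∃ l', Ch s j l' ∧ ∀ z, z ∈ l' ↔ z ∈ l ∧ z < 2 ^ (j + 1) := by
  induction h with
  | one =>
    obtain rfl : j = 0 := by omega
    refine ⟨[1], .one, fun z => ?_⟩
    simp only [List.mem_singleton]
    omega
  | @big s L a b l h ha hb hab ih =>
    rcases Nat.le_succ_iff.1 hj with hj' | rfl
    · obtain ⟨l', h1, h2⟩ := ih hj'
      refine ⟨l', h1, fun z => ?_⟩
      have := Nat.pow_le_pow_right (n := 2) (by omega) (show j + 1 ≤ L + 1 by omega)
      rw [h2, List.mem_cons]
      constructor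
      · exact fun hz => ⟨Or.inr hz.1, hz.2⟩
      · rintro ⟨rfl | hz, hlt⟩
        · omega
        · exact ⟨hz, hlt⟩
    · exact ⟨_, h.big ha hb hab, fun z => ⟨fun hz => ⟨hz, (h.big ha hb hab).lt hz⟩, fun hz => hz.1⟩⟩
  | @small s L a b l h ha hb hab hlt ih =>
    rcases Nat.lt_or_eq_of_le hj with hj' | rfl
    · obtain ⟨l', h1, h2⟩ := ih hj
      refine ⟨l', h1.waste, fun z => ?_⟩
      have := Nat.pow_le_pow_right (n := 2) (by omega) (show j + 1 ≤ L by omega)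
      rw [h2, List.mem_cons]
      constructor
      · exact fun hz => ⟨Or.inr hz.1, hz.2⟩
      · rintro ⟨rfl | hz, hlt⟩
        · omega
        · exact ⟨hz, hlt⟩
    · exact ⟨_, h.small ha hb hab hlt,
        fun z => ⟨fun hz => ⟨hz, (h.small ha hb hab hlt).lt hz⟩, fun hz => hz.1⟩⟩
  | waste _ ih =>
    obtain ⟨l', h1, h2⟩ := ih hj
    exact ⟨l', h1.waste, h2⟩

theorem Ch.mono {s s' L : ℕ} {l : List ℕ} (h : Ch s L l) (hs : s ≤ s') : Ch s' L l := by
  induction hs with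
  | refl => exact h
  | step _ ih => exact ih.waste

/-- The chain is cut at its last small step `p + q`; what follows is a `BigExt`. If the last unit of
`s` was wasted instead, it can be dropped. -/
theorem Ch.decomp {s L : ℕ} {l : List ℕ} (h : Ch s L l) (hs : 0 < s) : Ch (s - 1) L l ∨
    ∃ t l0 p q, Ch (s - 1) t l0 ∧ p ∈ l0 ∧ q ∈ l0 ∧ 2 ^ t ≤ p + q ∧ p + q < 2 ^ (t + 1) ∧
      BigExt ((p + q) :: l0) t L l := by
  induction h with
  | one => omega
  | big h ha hb hab ih =>
    rcases ih hs with h1 | ⟨t, l0, p, q, h1, hp, hq, h2, h3, h4⟩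
    · exact Or.inl (h1.big ha hb hab)
    · exact Or.inr ⟨t, l0, p, q, h1, hp, hq, h2, h3, h4.big ha hb hab⟩
  | small h ha hb hab hlt ih =>
    exact Or.inr ⟨_, _, _, _, h, ha, hb, hab, hlt, .nil⟩
  | waste h ih => exact Or.inl h

theorem BigExt.le {base l : List ℕ} {t L : ℕ} (h : BigExt base t L l) : t ≤ L := by
  induction h with
  | nil => exact le_rfl
  | big => omega

theorem BigExt.base_mem {base l : List ℕ} {t L z : ℕ} (h : BigExt base t L l) (hz : z ∈ base) :
    z ∈ l := by
  induction h with
  | nil => exact hz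
  | big _ _ _ _ ih => exact List.mem_cons_of_mem _ ih

theorem BigExt.lt {base l : List ℕ} {t L z : ℕ} (h : BigExt base t L l)
    (hb : ∀ y ∈ base, y < 2 ^ (t + 1)) (hz : z ∈ l) : z < 2 ^ (L + 1) := by
  induction h generalizing z with
  | nil => exact hb z hz
  | @big L a b l _ ha hb _ ih =>
    have e : 2 ^ (L + 1 + 1) = 2 * 2 ^ (L + 1) := by ring
    rcases List.mem_cons.1 hz with rfl | hz
    · have := ih ha
      have := ih hb
      omega
    · have := ih hz
      omega

theorem BigExt.ch {base l : List ℕ} {t L s : ℕ} (h : BigExt base t L l) (hb : Ch s t base) :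
    Ch s L l := by
  induction h with
  | nil => exact hb
  | big _ ha hb hab ih => exact ih.big ha hb hab

theorem BigExt.mem_base {base l : List ℕ} {t L z : ℕ} (h : BigExt base t L l) (hz : z ∈ l)
    (hlt : z < 2 ^ (t + 1)) : z ∈ base := by
  induction h with
  | nil => exact hz
  | @big L a b l h _ _ hab ih =>
    rcases List.mem_cons.1 hz with rfl | hz
    · have := Nat.pow_le_pow_right (n := 2) (by omega) (show t + 1 ≤ L + 1 by have := h.le; omega)
      omega
    · exact ih hz

theorem BigExt.trunc {base l : List ℕ} {t L j : ℕ} (h : BigExt base t L l)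
    (hb : ∀ y ∈ base, y < 2 ^ (t + 1)) (htj : t ≤ j) (hj : j ≤ L) :
    ∃ l', BigExt base t j l' ∧ ∀ z, z ∈ l' ↔ z ∈ l ∧ z < 2 ^ (j + 1) := by
  induction h with
  | nil =>
    obtain rfl : t = j := by omega
    exact ⟨base, .nil, fun z => ⟨fun hz => ⟨hz, hb z hz⟩, fun hz => hz.1⟩⟩
  | @big L a b l h ha hb' hab ih =>
    rcases Nat.le_succ_iff.1 hj with hj' | rfl
    · obtain ⟨l', h1, h2⟩ := ih hj'
      refine ⟨l', h1, fun z => ?_⟩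
      have := Nat.pow_le_pow_right (n := 2) (by omega) (show j + 1 ≤ L + 1 by omega)
      rw [h2, List.mem_cons]
      constructor
      · exact fun hz => ⟨Or.inr hz.1, hz.2⟩
      · rintro ⟨rfl | hz, hlt⟩
        · omega
        · exact ⟨hz, hlt⟩
    · exact ⟨_, h.big ha hb' hab,
        fun z => ⟨fun hz => ⟨hz, (h.big ha hb' hab).lt hb hz⟩, fun hz => hz.1⟩⟩

/-- Above the level of its base, an extension has exactly one term in each level. -/
theorem BigExt.unique {base l : List ℕ} {t L j y z : ℕ} (h : BigExt base t L l)
    (hb : ∀ y ∈ base, y < 2 ^ (t + 1)) (htj : t < j) (hy : y ∈ l) (hz : z ∈ l)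
    (hy1 : 2 ^ j ≤ y) (hy2 : y < 2 ^ (j + 1)) (hz1 : 2 ^ j ≤ z) (hz2 : z < 2 ^ (j + 1)) :
    y = z := by
  induction h with
  | nil =>
    have := hb y hy
    have := Nat.pow_le_pow_right (n := 2) (by omega) (show t + 1 ≤ j by omega)
    omega
  | @big L a b l h ha hb' hab ih =>
    have key : ∀ {u}, u ∈ l → 2 ^ j ≤ u → j ≤ L := by
      intro u hu hju
      by_contra hcon
      have := h.lt hb hu
      have := Nat.pow_le_pow_right (n := 2) (by omega) (show L + 1 ≤ j by omega)
      omega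
    have key' : j ≤ L → 2 ^ (j + 1) ≤ a + b := fun hjL =>
      (Nat.pow_le_pow_right (n := 2) (by omega) (show j + 1 ≤ L + 1 by omega)).trans hab
    rcases List.mem_cons.1 hy with rfl | hy <;> rcases List.mem_cons.1 hz with rfl | hz
    · rfl
    · have := key' (key hz hz1)
      omega
    · have := key' (key hy hy1)
      omega
    · exact ih hy hz

/-- A term above the level of the base is a sum of two terms of lower level, the larger of which
has the preceding level. -/
theorem BigExt.split {base l : List ℕ} {t L j z : ℕ} (h : BigExt base t L l)
    (hb : ∀ y ∈ base, y < 2 ^ (t + 1)) (htj : t ≤ j) (hz : z ∈ l)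
    (hz1 : 2 ^ (j + 1) ≤ z) (hz2 : z < 2 ^ (j + 2)) :
    ∃ v ∈ l, ∃ u ∈ l, z = v + u ∧ u ≤ v ∧ v < 2 ^ (j + 1) ∧ 2 ^ j ≤ v := by
  induction h with
  | nil =>
    have := hb z hz
    have := Nat.pow_le_pow_right (n := 2) (by omega) (show t + 1 ≤ j + 1 by omega)
    omega
  | @big L a b l h ha hb' hab ih =>
    rcases List.mem_cons.1 hz with rfl | hz
    · have h1 := h.lt hb ha
      have h2 := h.lt hb hb'
      obtain rfl : j = L := by
        have h3 := (h.big ha hb' hab).lt hb List.mem_cons_self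
        have h4 : 2 ^ (j + 1) < 2 ^ (L + 2) := lt_of_le_of_lt hz1 h3
        have h5 : 2 ^ (L + 1) < 2 ^ (j + 2) := lt_of_le_of_lt hab hz2
        have h6 := (Nat.pow_lt_pow_iff_right (a := 2) (by omega)).1 h4
        have h7 := (Nat.pow_lt_pow_iff_right (a := 2) (by omega)).1 h5
        omega
      have e : 2 ^ (j + 1) = 2 * 2 ^ j := by ring
      rcases le_total b a with hba | hba
      · exact ⟨a, List.mem_cons_of_mem _ ha, b, List.mem_cons_of_mem _ hb', rfl, hba, h1, by omega⟩
      · exact ⟨b, List.mem_cons_of_mem _ hb', a, List.mem_cons_of_mem _ ha, by omega, hba, h2,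
          by omega⟩
    · obtain ⟨v, hv, u, hu, h1⟩ := ih hz
      exact ⟨v, List.mem_cons_of_mem _ hv, u, List.mem_cons_of_mem _ hu, h1⟩

/-- A sum of two terms rises by at most one level, so every step either raises the level by one or
is small, and the length is the sum of the two counts. -/
theorem AddChain.exists_ch {r : ℕ} {l : List ℕ} (h : AddChain r l) :
    ∃ s L, Ch s L l ∧ r = L + s ∧ 2 ^ L ≤ l.headD 0 := by
  induction h with
  | one => exact ⟨0, 0, .one, rfl, by simp⟩
  | @step r h a b l _ ha hb hlt ih =>
    obtain ⟨s, L, h1, rfl, h2⟩ := ih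
    simp only [List.headD_cons] at h2 ⊢
    by_cases hab : 2 ^ (L + 1) ≤ a + b
    · exact ⟨s, L + 1, h1.big ha hb hab, by omega, hab⟩
    · exact ⟨s + 1, L, h1.small ha hb (by omega) (by omega), by omega, by omega⟩

/-- If no chain with at most `s` small steps reaches `n`, then `ℓ(n)` exceeds `⌊log₂ n⌋ + s`. -/
theorem lt_chainLength {n E s : ℕ} (h1 : 2 ^ E ≤ n) (h2 : n < 2 ^ (E + 1))
    (h : ∀ l, Ch s E l → n ∉ l) : E + s < chainLength n := by
  obtain ⟨l, hl⟩ := exists_addChain (lt_of_lt_of_le (Nat.two_pow_pos E) h1)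
  obtain ⟨s', L, hc, hr, hL⟩ := hl.exists_ch
  have hlt := hc.lt List.mem_cons_self
  simp only [List.headD_cons] at hL
  obtain rfl : L = E := by
    have h6 := (Nat.pow_lt_pow_iff_right (a := 2) (by omega)).1 (lt_of_le_of_lt hL h2)
    have h7 := (Nat.pow_lt_pow_iff_right (a := 2) (by omega)).1 (lt_of_le_of_lt h1 hlt)
    omega
  by_contra hcon
  exact h _ (hc.mono (show s' ≤ s by omega)) List.mem_cons_self

/-! ### Chains with at most one small step -/

theorem two_mul_two_pow_le {i j : ℕ} (h : i < j) : 2 * 2 ^ i ≤ 2 ^ j := by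
  rw [← pow_succ']
  exact Nat.pow_le_pow_right (by omega) h

theorem four_mul_two_pow_le {i j : ℕ} (h : i + 1 < j) : 4 * 2 ^ i ≤ 2 ^ j := by
  rw [show 4 * 2 ^ i = 2 ^ (i + 2) by ring]
  exact Nat.pow_le_pow_right (by omega) h

theorem two_pow_le {i j : ℕ} (h : i ≤ j) : 2 ^ i ≤ 2 ^ j :=
  Nat.pow_le_pow_right (by omega) h

/-- If all terms are at most `2 ^ L`, a sum that reaches `2 ^ (L + 1)` can only be `2 ^ L + 2 ^ L`.
-/
theorem Ch.eq_two_pow {L z : ℕ} {l : List ℕ} (h : Ch 0 L l) (hz : z ∈ l) : ∃ i ≤ L, z = 2 ^ i := by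
  generalize hs : 0 = s at h
  induction h generalizing z with
  | one => exact ⟨0, le_rfl, by simpa using hz⟩
  | @big s L a b l _ ha hb hab ih =>
    rcases List.mem_cons.1 hz with rfl | hz
    · obtain ⟨i, hi, rfl⟩ := ih ha hs
      obtain ⟨j, hj, rfl⟩ := ih hb hs
      have e : 2 ^ (L + 1) = 2 * 2 ^ L := by ring
      have h1 := two_pow_le hi
      have h2 := two_pow_le hj
      exact ⟨L + 1, le_rfl, by omega⟩
    · obtain ⟨i, hi, e⟩ := ih hz hs
      exact ⟨i, by omega, e⟩
  | small => omega
  | waste => omega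

/-- The possible shapes of the terms of a chain whose only small step produces
`2 ^ b * (2 ^ δ + 1)`, as long as the level `L` exceeds `b + δ`. -/
def OneSmallShape (b δ L : ℕ) (l : List ℕ) : Prop :=
  (∀ z ∈ l, (∃ i ≤ L, z = 2 ^ i) ∨ z = 2 ^ b * (2 ^ δ + 1)) ∨
  (∀ z ∈ l, (∃ i ≤ b + δ, z = 2 ^ i) ∨ ∃ j, b + j + δ ≤ L ∧ z = 2 ^ (b + j) * (2 ^ δ + 1)) ∨
  (∀ z ∈ l, (∃ i ≤ b + δ, z = 2 ^ i) ∨ z = 2 ^ b * (2 ^ δ + 1) ∨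
    ∃ j, b + j + δ + 1 ≤ L ∧ z = 2 ^ (b + j) * (2 ^ (δ + 1) + 1)) ∨
  (δ = 1 ∧ ∃ d, b + 3 ≤ L ∧ d + 2 ≤ L ∧ ∀ z ∈ l, (∃ i ≤ b + 1, z = 2 ^ i) ∨
    (∃ j ≤ d, z = 2 ^ j * (2 ^ 1 + 1)) ∨ ∃ j, d ≤ j + 1 ∧ j + 3 ≤ L ∧ z = 2 ^ j * (2 ^ 3 + 1)) ∨
  (δ = 1 ∧ b + 3 ≤ L ∧ ∀ z ∈ l, (∃ i ≤ L, z = 2 ^ i) ∨ z = 2 ^ b * (2 ^ 1 + 1) ∨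
    z = 2 ^ b * (2 ^ 2 + 1)) ∨
  (δ = 1 ∧ b + 3 ≤ L ∧ ∀ z ∈ l, (∃ i ≤ L, z = 2 ^ i) ∨ z = 2 ^ b * (2 ^ 1 + 1) ∨
    z = 2 ^ (b + 1) * (2 ^ 1 + 1))

theorem forall_mem_cons_of {p q : ℕ → Prop} {x : ℕ} {l : List ℕ} (hx : q x) (h : ∀ z ∈ l, p z)
    (hpq : ∀ z, p z → q z) : ∀ z ∈ x :: l, q z := by
  intro z hz
  rcases List.mem_cons.1 hz with rfl | hz
  · exact hx
  · exact hpq z (h z hz)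

/-- With `c = 2 ^ b * (2 ^ δ + 1)` just produced, the next level is reached by doubling the top
power of two, by doubling `c`, or by adding `c` to that power, which widens the gap to `δ + 1`. A
lower power can be added to `c` only if the result is again a power of two. -/
theorem oneSmallShape_first {b δ : ℕ} {l : List ℕ} (hδ : 0 < δ)
    (hl : ∀ z ∈ l, (∃ i ≤ b + δ, z = 2 ^ i) ∨ z = 2 ^ b * (2 ^ δ + 1)) {x y : ℕ} (hx : x ∈ l)
    (hy : y ∈ l) (hxy : 2 ^ (b + δ + 1) ≤ x + y) : OneSmallShape b δ (b + δ + 1) ((x + y) :: l) := by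
  have e : 2 ^ (b + δ + 1) = 2 * 2 ^ (b + δ) := by ring
  have e1 : 2 ^ b * (2 ^ δ + 1) = 2 ^ (b + δ) + 2 ^ b := by ring
  have hb := two_mul_two_pow_le (show b < b + δ by omega)
  have key : ∀ i ≤ b + δ, ∀ z, z = 2 ^ i + 2 ^ b * (2 ^ δ + 1) → 2 ^ (b + δ + 1) ≤ z →
      OneSmallShape b δ (b + δ + 1) (z :: l) := by
    intro i hi z hz hz'
    rcases Nat.lt_or_eq_of_le hi with hi | rfl
    · have h1 := two_mul_two_pow_le hi
      refine Or.inl (forall_mem_cons_of (Or.inl ⟨b + δ + 1, le_rfl, by omega⟩) hl ?_)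
      rintro z (⟨i, hi, rfl⟩ | rfl)
      · exact Or.inl ⟨i, by omega, rfl⟩
      · exact Or.inr rfl
    · refine Or.inr (Or.inr (Or.inl (forall_mem_cons_of (Or.inr (Or.inr ⟨0, by omega, ?_⟩)) hl ?_)))
      · rw [hz]; ring
      · rintro z (h | rfl)
        · exact Or.inl h
        · exact Or.inr (Or.inl rfl)
  rcases hl x hx with ⟨i, hi, hxi⟩ | hxc <;> rcases hl y hy with ⟨i', hi', hyi⟩ | hyc
  · have h1 := two_pow_le hi
    have h2 := two_pow_le hi'
    refine Or.inl (forall_mem_cons_of (Or.inl ⟨b + δ + 1, le_rfl, by omega⟩) hl ?_)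
    rintro z (⟨i, hi, rfl⟩ | rfl)
    · exact Or.inl ⟨i, by omega, rfl⟩
    · exact Or.inr rfl
  · exact key i hi _ (by rw [hxi, hyc]) hxy
  · exact key i' hi' _ (by rw [hyi, hxc, add_comm]) hxy
  · refine Or.inr (Or.inl (forall_mem_cons_of (Or.inr ⟨1, by omega, ?_⟩) hl ?_))
    · rw [hxc, hyc]; ring
    · rintro z (h | rfl)
      · exact Or.inl h
      · exact Or.inr ⟨0, by omega, by simp⟩

/-- A sum that gains a level needs two terms near the top, so generically the top term is doubled
and the shape persists. The exceptions all require `δ = 1`; up to a power of two they are `6 + 2 =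
8` and `5 + 3 = 8`, which return to powers of two, and `6 + 3 = 9`, which leads from the multiples
of `3` to those of `9`. -/
theorem oneSmallShape_step {b δ L : ℕ} {l : List ℕ} (hδ : 0 < δ) (hL : b + δ < L)
    (hl : OneSmallShape b δ L l) {x y : ℕ} (hx : x ∈ l) (hy : y ∈ l)
    (hxy : 2 ^ (L + 1) ≤ x + y) : OneSmallShape b δ (L + 1) ((x + y) :: l) := by
  wlog hyx : y ≤ x generalizing x y
  · rw [add_comm x y] at hxy ⊢
    exact this hy hx hxy (by omega)
  have e : 2 ^ (L + 1) = 2 * 2 ^ L := by ring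
  have hb := two_mul_two_pow_le (show b < b + δ by omega)
  have hbL := two_mul_two_pow_le hL
  have hbp := Nat.two_pow_pos b
  have e1 : 2 ^ b * (2 ^ δ + 1) = 2 ^ (b + δ) + 2 ^ b := by ring
  rcases hl with h | h | h | ⟨rfl, d, hbd, hd, h⟩ | ⟨rfl, hbd, h⟩ | ⟨rfl, hbd, h⟩
  · have hle : ∀ z ∈ l, z ≤ 2 ^ L ∧ (z = 2 ^ L ∨ z < 2 ^ L) := by
      intro z hz
      rcases h z hz with ⟨i, hi, rfl⟩ | rfl
      · have := two_pow_le hi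
        omega
      · omega
    have h1 := hle x hx
    have h2 := hle y hy
    refine Or.inl (forall_mem_cons_of (Or.inl ⟨L + 1, le_rfl, by omega⟩) h ?_)
    rintro z (⟨i, hi, rfl⟩ | rfl)
    · exact Or.inl ⟨i, by omega, rfl⟩
    · exact Or.inr rfl
  · -- multiples of `c`
    obtain ⟨f, rfl⟩ : ∃ f, L = b + δ + 1 + f := ⟨L - (b + δ + 1), by omega⟩
    rcases h x hx with ⟨i, hi, rfl⟩ | ⟨j, hj, rfl⟩
    · have := two_pow_le hi
      omega
    have e2 : 2 ^ (b + j) * (2 ^ δ + 1) = 2 ^ (b + δ + j) + 2 ^ (b + j) := by ring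
    have hbj := Nat.two_pow_pos (b + j)
    have h3 := two_mul_two_pow_le (show b + j < b + δ + j by omega)
    have hj' : j = f + 1 := by
      by_contra hne
      have := two_mul_two_pow_le (show b + δ + j < b + δ + 1 + f by omega)
      omega
    subst hj'
    rw [show b + δ + (f + 1) = b + δ + 1 + f by ring] at e2 h3
    rcases h y hy with ⟨i, hi, rfl⟩ | ⟨j', hj', rfl⟩
    · have h4 := two_pow_le hi
      have h5 := two_pow_le (show b + δ + 1 ≤ b + δ + 1 + f by omega)
      have e3 : 2 ^ (b + δ + 1) = 2 * 2 ^ (b + δ) := by ring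
      have e4 : 2 ^ (b + δ + 1 + f) = 2 ^ f * (2 * 2 ^ (b + δ)) := by ring
      have e5 : 2 ^ (b + (f + 1)) = 2 ^ f * (2 * 2 ^ b) := by ring
      obtain rfl : f = 0 := by
        by_contra hf
        have h6 := two_mul_two_pow_le (show 0 < f by omega)
        have h7 := Nat.mul_le_mul_left (2 ^ f) hb
        have h8 := Nat.mul_le_mul_right (2 ^ (b + δ)) h6
        rw [e2, e, e4, e5] at hxy
        nlinarith
      obtain rfl : δ = 1 := by
        by_contra hne
        have := four_mul_two_pow_le (show b + 1 < b + δ by omega)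
        omega
      obtain rfl : i = b + 1 := by
        by_contra hne
        have := two_mul_two_pow_le (show i < b + 1 by omega)
        omega
      refine Or.inr (Or.inr (Or.inr (Or.inr (Or.inr ⟨rfl, by omega, forall_mem_cons_of
        (Or.inl ⟨b + 3, by omega, by ring⟩) h ?_⟩))))
      rintro z (⟨i, hi, rfl⟩ | ⟨j, hj, rfl⟩)
      · exact Or.inl ⟨i, by omega, rfl⟩
      · obtain rfl | rfl : j = 0 ∨ j = 1 := by omega
        · exact Or.inr (Or.inl rfl)
        · exact Or.inr (Or.inr rfl)
    · have e3 : 2 ^ (b + j') * (2 ^ δ + 1) = 2 ^ (b + δ + j') + 2 ^ (b + j') := by ring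
      have h4 := two_mul_two_pow_le (show b + j' < b + δ + j' by omega)
      rcases (by omega : j' = f + 1 ∨ j' = f ∨ j' < f) with rfl | rfl | hlt
      · refine Or.inr (Or.inl (forall_mem_cons_of (Or.inr ⟨f + 2, by omega, by ring⟩) h ?_))
        rintro z (h | ⟨j, hj, rfl⟩)
        · exact Or.inl h
        · exact Or.inr ⟨j, by omega, rfl⟩
      · obtain rfl : δ = 1 := by
          by_contra hne
          have := four_mul_two_pow_le (show b + j' + 1 < b + δ + j' by omega)
          have e6 : 2 ^ (b + δ + 1 + j') = 2 * 2 ^ (b + δ + j') := by ring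
          have e7 : 2 ^ (b + (j' + 1)) = 2 * 2 ^ (b + j') := by ring
          omega
        refine Or.inr (Or.inr (Or.inr (Or.inl ⟨rfl, b + j' + 1, by omega, by omega,
          forall_mem_cons_of (Or.inr (Or.inr ⟨b + j', by omega, by omega, by ring⟩)) h ?_⟩)))
        rintro z (h | ⟨j, hj, rfl⟩)
        · exact Or.inl h
        · exact Or.inr (Or.inl ⟨b + j, by omega, rfl⟩)
      · have h5 := four_mul_two_pow_le (show b + δ + j' + 1 < b + δ + 1 + f by omega)
        have h6 := four_mul_two_pow_le (show b + j' + 1 < b + (f + 1) by omega)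
        omega
  · -- multiples of `d`
    obtain ⟨f, rfl⟩ : ∃ f, L = b + δ + 1 + f := ⟨L - (b + δ + 1), by omega⟩
    have h5 := two_pow_le (show b + δ + 1 ≤ b + δ + 1 + f by omega)
    have e0 : 2 ^ (b + δ + 1) = 2 * 2 ^ (b + δ) := by ring
    rcases h x hx with ⟨i, hi, rfl⟩ | rfl | ⟨j, hj, rfl⟩
    · have := two_pow_le hi
      omega
    · omega
    have e2 : 2 ^ (b + j) * (2 ^ (δ + 1) + 1) = 2 ^ (b + δ + 1 + j) + 2 ^ (b + j) := by ring
    have hbj := Nat.two_pow_pos (b + j)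
    have h3 := four_mul_two_pow_le (show b + j + 1 < b + δ + 1 + j by omega)
    have hj' : j = f := by
      by_contra hne
      have := two_mul_two_pow_le (show b + δ + 1 + j < b + δ + 1 + f by omega)
      omega
    subst hj'
    rcases h y hy with ⟨i, hi, rfl⟩ | rfl | ⟨j', hj', rfl⟩
    · have := two_pow_le hi
      omega
    · have e4 : 2 ^ (b + δ + 1 + j) = 2 ^ j * (2 * 2 ^ (b + δ)) := by ring
      have e5 : 2 ^ (b + j) = 2 ^ j * 2 ^ b := by ring
      obtain rfl : j = 0 := by
        by_contra hf
        have h6 := two_mul_two_pow_le (show 0 < j by omega)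
        have h7 := Nat.mul_le_mul_left (2 ^ j) hb
        have h8 := Nat.mul_le_mul_right (2 ^ (b + δ)) h6
        rw [e2, e, e4, e5, e1] at hxy
        nlinarith
      obtain rfl : δ = 1 := by
        by_contra hne
        have := four_mul_two_pow_le (show b + 1 < b + δ by omega)
        omega
      refine Or.inr (Or.inr (Or.inr (Or.inr (Or.inl ⟨rfl, by omega, forall_mem_cons_of
        (Or.inl ⟨b + 3, by omega, by ring⟩) h ?_⟩))))
      rintro z (⟨i, hi, rfl⟩ | rfl | ⟨j, hj, rfl⟩)
      · exact Or.inl ⟨i, by omega, rfl⟩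
      · exact Or.inr (Or.inl rfl)
      · obtain rfl : j = 0 := by omega
        exact Or.inr (Or.inr rfl)
    · have e3 : 2 ^ (b + j') * (2 ^ (δ + 1) + 1) = 2 ^ (b + δ + 1 + j') + 2 ^ (b + j') := by ring
      have h4 := four_mul_two_pow_le (show b + j' + 1 < b + δ + 1 + j' by omega)
      obtain rfl : j' = j := by
        by_contra hne
        have := two_mul_two_pow_le (show b + δ + 1 + j' < b + δ + 1 + j by omega)
        omega
      refine Or.inr (Or.inr (Or.inl (forall_mem_cons_of
        (Or.inr (Or.inr ⟨j' + 1, by omega, by ring⟩)) h ?_)))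
      rintro z (h | rfl | ⟨j, hj, rfl⟩)
      · exact Or.inl h
      · exact Or.inr (Or.inl rfl)
      · exact Or.inr (Or.inr ⟨j, by omega, rfl⟩)
  · -- the numbers `3 * 2 ^ j` and `9 * 2 ^ j`
    obtain ⟨f, rfl⟩ : ∃ f, L = f + 3 := ⟨L - 3, by omega⟩
    have eL : 2 ^ (f + 3) = 8 * 2 ^ f := by ring
    have hle : ∀ z ∈ l, (∃ j, d ≤ j + 1 ∧ j = f ∧ z = 2 ^ j * (2 ^ 3 + 1)) ∨ z ≤ 6 * 2 ^ f := by
      intro z hz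
      rcases h z hz with ⟨i, hi, rfl⟩ | ⟨j, hj, rfl⟩ | ⟨j, hj, hj', rfl⟩
      · have := two_mul_two_pow_le (show i < f + 2 by omega)
        rw [show 2 ^ (f + 2) = 4 * 2 ^ f by ring] at this
        right; omega
      · have := two_pow_le (show j ≤ f + 1 by omega)
        rw [show 2 ^ (f + 1) = 2 * 2 ^ f by ring] at this
        right; omega
      · rcases (by omega : j = f ∨ j < f) with rfl | hlt
        · exact Or.inl ⟨j, hj, rfl, rfl⟩
        · have := two_mul_two_pow_le hlt
          right; omega
    have hf := Nat.two_pow_pos f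
    rcases hle x hx with ⟨j, hj, rfl, rfl⟩ | h1
    · rcases hle y hy with ⟨j', hj', rfl, rfl⟩ | h2
      · refine Or.inr (Or.inr (Or.inr (Or.inl ⟨rfl, d, by omega, by omega, forall_mem_cons_of
          (Or.inr (Or.inr ⟨j' + 1, by omega, by omega, by ring⟩)) h ?_⟩)))
        rintro z (h | h | ⟨j, hj, hj', rfl⟩)
        · exact Or.inl h
        · exact Or.inr (Or.inl h)
        · exact Or.inr (Or.inr ⟨j, by omega, by omega, rfl⟩)
      · omega
    · omega
  · have h8 := two_pow_le hbd
    rw [show 2 ^ (b + 3) = 8 * 2 ^ b by ring] at h8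
    have hp := Nat.two_pow_pos b
    have hle : ∀ z ∈ l, z ≤ 2 ^ L ∧ (z = 2 ^ L ∨ z < 2 ^ L) := by
      intro z hz
      rcases h z hz with ⟨i, hi, rfl⟩ | rfl | rfl
      · have := two_pow_le hi
        omega
      · omega
      · omega
    have h1 := hle x hx
    have h2 := hle y hy
    refine Or.inr (Or.inr (Or.inr (Or.inr (Or.inl ⟨rfl, by omega, forall_mem_cons_of
        (Or.inl ⟨L + 1, le_rfl, by omega⟩) h ?_⟩))))
    rintro z (⟨i, hi, rfl⟩ | h)
    · exact Or.inl ⟨i, by omega, rfl⟩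
    · exact Or.inr h
  · have h8 := two_pow_le hbd
    rw [show 2 ^ (b + 3) = 8 * 2 ^ b by ring] at h8
    have hp := Nat.two_pow_pos b
    have hle : ∀ z ∈ l, z ≤ 2 ^ L ∧ (z = 2 ^ L ∨ z < 2 ^ L) := by
      intro z hz
      rcases h z hz with ⟨i, hi, rfl⟩ | rfl | rfl
      · have := two_pow_le hi
        omega
      · omega
      · rw [show 2 ^ (b + 1) = 2 * 2 ^ b by ring]
        omega
    have h1 := hle x hx
    have h2 := hle y hy
    refine Or.inr (Or.inr (Or.inr (Or.inr (Or.inr ⟨rfl, by omega, forall_mem_cons_of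
        (Or.inl ⟨L + 1, le_rfl, by omega⟩) h ?_⟩))))
    rintro z (⟨i, hi, rfl⟩ | h)
    · exact Or.inl ⟨i, by omega, rfl⟩
    · exact Or.inr h

theorem nu_two_pow_mul_two_pow_add_one {j g : ℕ} (hg : 0 < g) : nu (2 ^ j * (2 ^ g + 1)) = 2 := by
  rw [nu_two_pow_mul, nu_two_pow_add (Nat.one_lt_two_pow hg.ne')]
  simp

theorem two_pow_ne_two_pow_mul {i j g : ℕ} (hg : 0 < g) : 2 ^ i ≠ 2 ^ j * (2 ^ g + 1) := by
  intro h
  have := congrArg nu h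
  rw [nu_two_pow_mul_two_pow_add_one hg, nu_two_pow] at this
  omega

theorem two_pow_mul_inj {j g j' g' : ℕ} (hg : 0 < g) (hg' : 0 < g')
    (h : 2 ^ j * (2 ^ g + 1) = 2 ^ j' * (2 ^ g' + 1)) : j = j' ∧ g = g' := by
  wlog hj : j ≤ j' generalizing j g j' g'
  · have := this hg' hg h.symm (by omega)
    omega
  obtain ⟨d, rfl⟩ := Nat.exists_eq_add_of_le hj
  rw [pow_add, mul_assoc] at h
  have h1 := Nat.eq_of_mul_eq_mul_left (Nat.two_pow_pos j) h
  obtain ⟨g, rfl⟩ := Nat.exists_eq_add_of_lt hg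
  obtain ⟨g', rfl⟩ := Nat.exists_eq_add_of_lt hg'
  rcases Nat.eq_zero_or_pos d with rfl | hd
  · refine ⟨by simp, ?_⟩
    simp only [pow_zero, one_mul] at h1
    exact Nat.pow_right_injective le_rfl (Nat.add_right_cancel h1)
  · obtain ⟨d, rfl⟩ := Nat.exists_eq_add_of_lt hd
    exfalso
    have h2 : 2 ^ (0 + g + 1) = 2 * 2 ^ g := by ring
    have h3 : 2 ^ (0 + d + 1) * (2 ^ (0 + g' + 1) + 1) = 2 * (2 ^ d * (2 ^ (0 + g' + 1) + 1)) := by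
      ring
    omega

/-- The terms of a chain with at most one small step. -/
theorem Ch.one_cases {L : ℕ} {l : List ℕ} (h : Ch 1 L l) : (∀ z ∈ l, ∃ i ≤ L, z = 2 ^ i) ∨
    ∃ b δ, 0 < δ ∧ ∃ l0 : List ℕ, BigExt l0 (b + δ) L l ∧
      (∀ z ∈ l0, (∃ i ≤ b + δ, z = 2 ^ i) ∨ z = 2 ^ b * (2 ^ δ + 1)) := by
  have key : ∀ {t L : ℕ} {l0 l : List ℕ}, BigExt l0 t L l → (∀ z ∈ l0, ∃ i ≤ t, z = 2 ^ i) →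
      ∀ z ∈ l, ∃ i ≤ L, z = 2 ^ i := by
    intro t L l0 l h h0
    induction h with
    | nil => exact h0
    | @big L a b l _ ha hb hab ih =>
      refine forall_mem_cons_of ?_ ih fun z ⟨i, hi, e⟩ => ⟨i, by omega, e⟩
      obtain ⟨i, hi, rfl⟩ := ih a ha
      obtain ⟨j, hj, rfl⟩ := ih b hb
      have e : 2 ^ (L + 1) = 2 * 2 ^ L := by ring
      have h1 := two_pow_le hi
      have h2 := two_pow_le hj
      exact ⟨L + 1, le_rfl, by omega⟩
  rcases h.decomp (by omega) with h | ⟨t, l0, p, q, h, hp, hq, hpq, hpq', hE⟩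
  · exact Or.inl fun z hz => h.eq_two_pow hz
  · obtain ⟨i, hi, rfl⟩ := Ch.eq_two_pow h hp
    obtain ⟨j, hj, rfl⟩ := Ch.eq_two_pow h hq
    have e : 2 ^ (t + 1) = 2 * 2 ^ t := by ring
    have main : ∀ b < t, 2 ^ i + 2 ^ j = 2 ^ t + 2 ^ b → ∃ b δ, 0 < δ ∧ ∃ l0 : List ℕ,
        BigExt l0 (b + δ) L l ∧
        (∀ z ∈ l0, (∃ i ≤ b + δ, z = 2 ^ i) ∨ z = 2 ^ b * (2 ^ δ + 1)) := by
      intro b hb hbe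
      obtain ⟨δ, rfl⟩ := Nat.exists_eq_add_of_lt hb
      refine ⟨b, δ + 1, by omega, _, hE, forall_mem_cons_of (Or.inr ?_)
        (fun z hz => h.eq_two_pow hz) fun z hz => Or.inl hz⟩
      rw [hbe]
      ring
    by_cases hit : i = t
    · subst hit
      refine Or.inr (main j ?_ rfl)
      by_contra hcon
      obtain rfl : j = i := by omega
      omega
    by_cases hjt : j = t
    · subst hjt
      exact Or.inr (main i (by omega) (add_comm _ _))
    -- If neither summand is `2 ^ t`, the sum is at most `2 ^ t`, hence equal to it, and the small
    -- step produced nothing new.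
    · have h1 := two_mul_two_pow_le (show i < t by omega)
      have h2 := two_mul_two_pow_le (show j < t by omega)
      exact Or.inl (key hE (forall_mem_cons_of ⟨t, le_rfl, by omega⟩
        (fun z hz => h.eq_two_pow hz) fun z hz => hz))

theorem BigExt.oneSmallShape {b δ L : ℕ} {l0 l : List ℕ} (h : BigExt l0 (b + δ) L l) (hδ : 0 < δ)
    (h0 : ∀ z ∈ l0, (∃ i ≤ b + δ, z = 2 ^ i) ∨ z = 2 ^ b * (2 ^ δ + 1)) :
    (L = b + δ ∧ l = l0) ∨ (b + δ < L ∧ OneSmallShape b δ L l) := by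
  induction h with
  | nil => exact Or.inl ⟨rfl, rfl⟩
  | big h ha hb hab ih =>
    rcases ih with ⟨rfl, rfl⟩ | ⟨h1, h2⟩
    · exact Or.inr ⟨by omega, oneSmallShape_first hδ h0 ha hb hab⟩
    · exact Or.inr ⟨by omega, oneSmallShape_step hδ h1 h2 ha hb hab⟩

theorem Ch.shape {L z : ℕ} {l : List ℕ} (h : Ch 1 L l) (hz : z ∈ l) :
    (∃ i, z = 2 ^ i) ∨ ∃ j g, 0 < g ∧ z = 2 ^ j * (2 ^ g + 1) := by
  rcases h.one_cases with h | ⟨b, δ, hδ, l0, h, h0⟩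
  · obtain ⟨i, _, e⟩ := h z hz
    exact Or.inl ⟨i, e⟩
  · rcases h.oneSmallShape hδ h0 with ⟨rfl, rfl⟩ | ⟨-, h | h | h | ⟨-, d, -, -, h⟩ | ⟨-, -, h⟩ | ⟨-, -, h⟩⟩
    · rcases h0 z hz with ⟨i, _, e⟩ | e
      · exact Or.inl ⟨i, e⟩
      · exact Or.inr ⟨b, δ, hδ, e⟩
    · rcases h z hz with ⟨i, _, e⟩ | e
      · exact Or.inl ⟨i, e⟩
      · exact Or.inr ⟨b, δ, hδ, e⟩
    · rcases h z hz with ⟨i, _, e⟩ | ⟨j, _, e⟩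
      · exact Or.inl ⟨i, e⟩
      · exact Or.inr ⟨b + j, δ, hδ, e⟩
    · rcases h z hz with ⟨i, _, e⟩ | e | ⟨j, _, e⟩
      · exact Or.inl ⟨i, e⟩
      · exact Or.inr ⟨b, δ, hδ, e⟩
      · exact Or.inr ⟨b + j, δ + 1, by omega, e⟩
    · rcases h z hz with ⟨i, _, e⟩ | ⟨j, _, e⟩ | ⟨j, _, _, e⟩
      · exact Or.inl ⟨i, e⟩
      · exact Or.inr ⟨j, 1, by omega, e⟩
      · exact Or.inr ⟨j, 3, by omega, e⟩
    · rcases h z hz with ⟨i, _, e⟩ | e | e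
      · exact Or.inl ⟨i, e⟩
      · exact Or.inr ⟨b, 1, by omega, e⟩
      · exact Or.inr ⟨b, 2, by omega, e⟩
    · rcases h z hz with ⟨i, _, e⟩ | e | e
      · exact Or.inl ⟨i, e⟩
      · exact Or.inr ⟨b, 1, by omega, e⟩
      · exact Or.inr ⟨b + 1, 1, by omega, e⟩

/-- In a chain with at most one small step, the gaps between the two binary digits of the terms
that are not powers of two are almost constant. -/
theorem Ch.gap_compat {L j g j' g' : ℕ} {l : List ℕ} (h : Ch 1 L l) (hg : 0 < g) (hg' : 0 < g')
    (hz : 2 ^ j * (2 ^ g + 1) ∈ l) (hz' : 2 ^ j' * (2 ^ g' + 1) ∈ l) (hlt : j' + g' < j + g) :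
    g = g' ∨ g = g' + 1 ∨ (g = 3 ∧ g' = 1) := by
  rcases h.one_cases with h | ⟨b, δ, hδ, l0, h, h0⟩
  · obtain ⟨i, _, e⟩ := h _ hz
    exact absurd e.symm (two_pow_ne_two_pow_mul hg)
  have no : ∀ {i j g : ℕ}, 0 < g → 2 ^ j * (2 ^ g + 1) = 2 ^ i → False :=
    fun hg e => two_pow_ne_two_pow_mul hg e.symm
  rcases h.oneSmallShape hδ h0 with ⟨rfl, rfl⟩ | ⟨-, h | h | h | ⟨-, d, -, -, h⟩ | ⟨-, -, h⟩ | ⟨-, -, h⟩⟩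
  · rcases h0 _ hz with ⟨i, _, e⟩ | e
    · exact (no hg e).elim
    rcases h0 _ hz' with ⟨i, _, e'⟩ | e'
    · exact (no hg' e').elim
    have := two_pow_mul_inj hg hδ e
    have := two_pow_mul_inj hg' hδ e'
    omega
  · rcases h _ hz with ⟨i, _, e⟩ | e
    · exact (no hg e).elim
    rcases h _ hz' with ⟨i, _, e'⟩ | e'
    · exact (no hg' e').elim
    have := two_pow_mul_inj hg hδ e
    have := two_pow_mul_inj hg' hδ e'
    omega
  · rcases h _ hz with ⟨i, _, e⟩ | ⟨i, _, e⟩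
    · exact (no hg e).elim
    rcases h _ hz' with ⟨i', _, e'⟩ | ⟨i', _, e'⟩
    · exact (no hg' e').elim
    have := two_pow_mul_inj hg hδ e
    have := two_pow_mul_inj hg' hδ e'
    omega
  · have key : ∀ {j g}, 0 < g → 2 ^ j * (2 ^ g + 1) ∈ l → (j = b ∧ g = δ) ∨ (b ≤ j ∧ g = δ + 1) := by
      intro j g hg hz
      rcases h _ hz with ⟨i, _, e⟩ | e | ⟨i, _, e⟩
      · exact (no hg e).elim
      · exact Or.inl (two_pow_mul_inj hg hδ e)
      · have := two_pow_mul_inj hg (by omega) e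
        omega
    have := key hg hz
    have := key hg' hz'
    omega
  -- The exceptional pair of gaps `3` and `1` comes from the terms `9 * 2 ^ j` and `3 * 2 ^ j` of
  -- this shape.
  · have key : ∀ {j g}, 0 < g → 2 ^ j * (2 ^ g + 1) ∈ l → (j ≤ d ∧ g = 1) ∨ (d ≤ j + 1 ∧ g = 3) := by
      intro j g hg hz
      rcases h _ hz with ⟨i, _, e⟩ | ⟨i, _, e⟩ | ⟨i, _, _, e⟩
      · exact (no hg e).elim
      · have := two_pow_mul_inj hg (by omega) e
        omega
      · have := two_pow_mul_inj hg (by omega) e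
        omega
    have := key hg hz
    have := key hg' hz'
    omega
  · have key : ∀ {j g}, 0 < g → 2 ^ j * (2 ^ g + 1) ∈ l → j = b ∧ (g = 1 ∨ g = 2) := by
      intro j g hg hz
      rcases h _ hz with ⟨i, _, e⟩ | e | e
      · exact (no hg e).elim
      · have := two_pow_mul_inj hg (by omega) e
        omega
      · have := two_pow_mul_inj hg (by omega) e
        omega
    have := key hg hz
    have := key hg' hz'
    omega
  · have key : ∀ {j g}, 0 < g → 2 ^ j * (2 ^ g + 1) ∈ l → g = 1 := by
      intro j g hg hz
      rcases h _ hz with ⟨i, _, e⟩ | e | e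
      · exact (no hg e).elim
      · exact (two_pow_mul_inj hg (by omega) e).2
      · exact (two_pow_mul_inj hg (by omega) e).2
    have := key hg hz
    have := key hg' hz'
    omega

theorem Ch.nu_le_two {L z : ℕ} {l : List ℕ} (h : Ch 1 L l) (hz : z ∈ l) : nu z ≤ 2 := by
  rcases h.shape hz with ⟨i, rfl⟩ | ⟨j, g, hg, rfl⟩
  · simp
  · exact (nu_two_pow_mul_two_pow_add_one hg).le

/-- With at most two ones, a term is largest within its level when its digits start with `11`. This
bound `3/2`, against `15/8` for four ones, drives most size arguments below. -/
theorem Ch.two_mul_le {L z t : ℕ} {l : List ℕ} (h : Ch 1 L l) (hz : z ∈ l) (ht : z < 2 ^ (t + 1)) :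
    2 * z ≤ 3 * 2 ^ t := by
  have e : 2 ^ (t + 1) = 2 * 2 ^ t := by ring
  rcases h.shape hz with ⟨i, rfl⟩ | ⟨j, g, hg, rfl⟩
  · have := two_pow_le (Nat.lt_succ_iff.1 ((Nat.pow_lt_pow_iff_right (a := 2) (by omega)).1 ht))
    omega
  · have e1 : 2 ^ j * (2 ^ g + 1) = 2 ^ (j + g) + 2 ^ j := by ring
    have h1 := two_mul_two_pow_le (show j < j + g by omega)
    have h2 : 2 ^ (j + g) < 2 ^ (t + 1) := by omega
    have := two_pow_le (Nat.lt_succ_iff.1 ((Nat.pow_lt_pow_iff_right (a := 2) (by omega)).1 h2))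
    omega

/-- Two terms of the same level, in a chain with at most one small step. -/
theorem Ch.level_pair {L y z t : ℕ} {l : List ℕ} (h : Ch 1 L l) (hy : y ∈ l) (hz : z ∈ l)
    (hy1 : 2 ^ t ≤ y) (hyz : y < z) (hz2 : z < 2 ^ (t + 1)) :
    y = 2 ^ t ∧ ∃ b < t, z = 2 ^ t + 2 ^ b ∧ (∀ u ∈ l, u < 2 ^ t → ∃ i < t, u = 2 ^ i) ∧
      ∀ u ∈ l, 2 ^ t ≤ u → u < 2 ^ (t + 1) → u = y ∨ u = z := by
  have pw : ∀ {i}, 2 ^ t ≤ 2 ^ i → 2 ^ i < 2 ^ (t + 1) → i = t := by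
    intro i h1 h2
    have h3 := (Nat.pow_le_pow_iff_right (a := 2) (by omega)).1 h1
    have h4 := (Nat.pow_lt_pow_iff_right (a := 2) (by omega)).1 h2
    omega
  rcases h.one_cases with h | ⟨b, δ, hδ, l0, h, h0⟩
  · obtain ⟨i, _, rfl⟩ := h y hy
    obtain ⟨j, _, rfl⟩ := h z hz
    rw [pw hy1 (by omega), pw (i := j) (by omega) hz2] at hyz
    omega
  · have e1 : 2 ^ b * (2 ^ δ + 1) = 2 ^ (b + δ) + 2 ^ b := by ring
    have e2 : 2 ^ (b + δ + 1) = 2 * 2 ^ (b + δ) := by ring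
    have hb := two_mul_two_pow_le (show b < b + δ by omega)
    have hbp := Nat.two_pow_pos b
    have hb0 : ∀ y ∈ l0, y < 2 ^ (b + δ + 1) := by
      intro y hy
      rcases h0 y hy with ⟨i, hi, rfl⟩ | rfl
      · have := two_pow_le hi
        omega
      · omega
    -- Above the level `b + δ` of the small step each level has a single term, so two distinct terms
    -- of one level already lie in the base, and there the level must be `b + δ` itself.
    have hyl : y < 2 ^ (b + δ + 1) := by
      by_contra hcon
      have : b + δ + 1 < t + 1 := by
        exact (Nat.pow_lt_pow_iff_right (a := 2) (by omega)).1 (by omega)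
      have := h.unique hb0 (show b + δ < t by omega) hy hz hy1 (by omega) (by omega) hz2
      omega
    have hzl : z < 2 ^ (b + δ + 1) := by
      by_contra hcon
      have h3 : b + δ + 1 < t + 1 :=
        (Nat.pow_lt_pow_iff_right (a := 2) (by omega)).1 (by omega)
      have h4 : t < b + δ + 1 := (Nat.pow_lt_pow_iff_right (a := 2) (by omega)).1 (by omega)
      omega
    have hy' := h0 y (h.mem_base hy hyl)
    have hz' := h0 z (h.mem_base hz hzl)
    have ht : t = b + δ := by
      have h4 : t < b + δ + 1 := (Nat.pow_lt_pow_iff_right (a := 2) (by omega)).1 (by omega)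
      rcases hy' with ⟨i, _, rfl⟩ | rfl
      · rcases hz' with ⟨j, _, rfl⟩ | rfl
        · rw [pw hy1 (by omega), pw (i := j) (by omega) hz2] at hyz
          omega
        · have h5 : b + δ < t + 1 := (Nat.pow_lt_pow_iff_right (a := 2) (by omega)).1 (by omega)
          omega
      · have h5 : b + δ < t + 1 := (Nat.pow_lt_pow_iff_right (a := 2) (by omega)).1 (by omega)
        omega
    subst ht
    have hyy : y = 2 ^ (b + δ) := by
      rcases hy' with ⟨i, _, rfl⟩ | rfl
      · rw [pw hy1 (by omega)]
      · rcases hz' with ⟨j, _, rfl⟩ | rfl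
        · have := pw (i := j) (by omega) hz2
          subst this
          omega
        · omega
    have hzz : z = 2 ^ (b + δ) + 2 ^ b := by
      rcases hz' with ⟨j, _, rfl⟩ | rfl
      · rw [hyy, pw (i := j) (by omega) hz2] at hyz
        omega
      · exact e1
    refine ⟨hyy, b, by omega, hzz, ?_, ?_⟩
    · intro u hu hul
      rcases h0 u (h.mem_base hu (by omega)) with ⟨i, _, rfl⟩ | rfl
      · exact ⟨i, (Nat.pow_lt_pow_iff_right (a := 2) (by omega)).1 hul, rfl⟩
      · omega
    · intro u hu h1 h2
      rcases h0 u (h.mem_base hu h2) with ⟨i, _, rfl⟩ | rfl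
      · rw [pw h1 h2]
        exact Or.inl hyy.symm
      · exact Or.inr (by omega)

/-! ### Large terms above the last small step -/

/-- The structure of the terms with leading digits at least `101` above the last small step of a
chain: `z` has level `t + 1 + f`, and `base` holds the terms up to level `t`. -/
theorem BigExt.structure {base l : List ℕ} {t L f z : ℕ} (h : BigExt base t L l)
    (hb : ∀ y ∈ base, y < 2 ^ (t + 1)) (hz : z ∈ l) (hz1 : 5 * 2 ^ (t + 1 + f) ≤ 4 * z)
    (hz2 : z < 2 ^ (t + 2 + f)) :
    (∃ a ∈ base, ∃ b ∈ base, 2 ^ t ≤ a ∧ b ≤ a ∧ 2 ^ (t + 1) ≤ a + b ∧ z = 2 ^ f * (a + b) ∧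
      ∀ y ∈ l, 2 ^ (t + 1) ≤ y → y ≤ z → ∃ g ≤ f, y = 2 ^ g * (a + b)) ∨
    (∃ a ∈ base, ∃ b ∈ base, ∃ c ∈ base, 2 ^ t ≤ a ∧ 2 ^ t ≤ b ∧ 2 ^ t ≤ c ∧
      5 * 2 ^ t ≤ a + b + c ∧ ∃ e, f = e + 1 ∧ z = 2 ^ e * (a + b + c) ∧
      ∀ y ∈ l, 2 ^ (t + 1) ≤ y → y ≤ z → y = a + b ∨ ∃ g ≤ e, y = 2 ^ g * (a + b + c)) ∨
    (∃ a ∈ base, ∃ b ∈ base, 2 ^ t ≤ a ∧ b ≤ a ∧ 10 * 2 ^ t ≤ 3 * (a + b) ∧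
      ∃ e, f = e + 2 ∧ z = 2 ^ e * (3 * (a + b)) ∧
      ∀ y ∈ l, 2 ^ (t + 1) ≤ y → y ≤ z →
        (∃ g, y = 2 ^ g * (a + b)) ∨ ∃ g, y = 2 ^ g * (3 * (a + b))) := by
  induction f using Nat.strong_induction_on generalizing z with
  | _ f ih =>
  have hpos := Nat.two_pow_pos t
  have hposf := Nat.two_pow_pos (t + f)
  have eA : 2 ^ (t + 1 + f) = 2 * 2 ^ (t + f) := by ring
  have eB : 2 ^ (t + 2 + f) = 4 * 2 ^ (t + f) := by ring
  have eC : 2 ^ (t + f + 1) = 2 * 2 ^ (t + f) := by ring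
  have eD : 2 ^ (t + f + 2) = 4 * 2 ^ (t + f) := by ring
  obtain ⟨v, hv, u, hu, rfl, huv, hv2, hv1⟩ :=
    h.split hb (show t ≤ t + f by omega) hz (by omega) (by omega)
  have top : ∀ y ∈ l, 2 ^ (t + f + 1) ≤ y → y ≤ v + u → y = v + u := fun y hy h1 h2 =>
    h.unique hb (show t < t + f + 1 by omega) hy hz h1 (by rw [pow_succ]; omega) (by omega)
      (by rw [pow_succ]; omega)
  rcases Nat.eq_zero_or_pos f with rfl | hf
  · left
    simp only [add_zero] at *
    refine ⟨v, h.mem_base hv hv2, u, h.mem_base hu (by omega), hv1, huv, by omega, by simp, ?_⟩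
    intro y hy h1 h2
    exact ⟨0, le_rfl, by rw [top y hy h1 h2]; simp⟩
  obtain ⟨f, rfl⟩ := Nat.exists_eq_add_of_lt hf
  simp only [zero_add] at *
  have eE : 2 ^ (t + (f + 1)) = 2 * 2 ^ (t + f) := by ring
  have snd : ∀ y ∈ l, 2 ^ (t + f + 1) ≤ y → y < 2 ^ (t + f + 2) → y = v := fun y hy h1 h2 =>
    h.unique hb (show t < t + f + 1 by omega) hy hv h1 h2 hv1 hv2
  -- A doubling `z = u + u` inherits its form from `u`, with one more factor two.
  rcases Nat.eq_or_lt_of_le huv with rfl | hlt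
  · have e1 : 2 ^ (t + 1 + f) = 2 ^ (t + (f + 1)) := by ring
    have e2 : 2 ^ (t + 2 + f) = 2 ^ (t + (f + 1) + 1) := by ring
    have stp : ∀ y ∈ l, y ≤ u + u → y ≤ u ∨ y = u + u := by
      intro y hy h1
      by_cases h2 : 2 ^ (t + (f + 1) + 1) ≤ y
      · exact Or.inr (top y hy h2 h1)
      · left
        by_contra hcon
        have := snd y hy (by rw [show t + f + 1 = t + (f + 1) by ring]; omega)
          (by rw [show t + f + 2 = t + (f + 1) + 1 by ring]; omega)
        omega
    rcases ih f (by omega) hv (by omega) (by omega) with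
      ⟨a, ha, b, hb', h1, h2, h3, h4, h5⟩ | ⟨a, ha, b, hb', c, hc, h1, h2, h3, h4, e, rfl, h5, h6⟩ |
      ⟨a, ha, b, hb', h1, h2, h3, e, rfl, h5, h6⟩
    · refine Or.inl ⟨a, ha, b, hb', h1, h2, h3, by rw [h4]; ring, fun y hy hy1 hy2 => ?_⟩
      rcases stp y hy hy2 with hy2 | rfl
      · obtain ⟨g, hg, e⟩ := h5 y hy hy1 hy2
        exact ⟨g, by omega, e⟩
      · exact ⟨f + 1, le_rfl, by rw [h4]; ring⟩
    · refine Or.inr (Or.inl ⟨a, ha, b, hb', c, hc, h1, h2, h3, h4, e + 1, rfl, by rw [h5]; ring,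
        fun y hy hy1 hy2 => ?_⟩)
      rcases stp y hy hy2 with hy2 | rfl
      · rcases h6 y hy hy1 hy2 with e' | ⟨g, hg, e'⟩
        · exact Or.inl e'
        · exact Or.inr ⟨g, by omega, e'⟩
      · exact Or.inr ⟨e + 1, le_rfl, by rw [h5]; ring⟩
    · refine Or.inr (Or.inr ⟨a, ha, b, hb', h1, h2, h3, e + 1, rfl, by rw [h5]; ring,
        fun y hy hy1 hy2 => ?_⟩)
      rcases stp y hy hy2 with hy2 | rfl
      · exact h6 y hy hy1 hy2
      · exact Or.inr ⟨e + 1, by rw [h5]; ring⟩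
  have hu2 : u < 2 ^ (t + (f + 1)) := by
    by_contra hcon
    have := snd u hu (by rw [show t + f + 1 = t + (f + 1) by ring]; omega)
      (by rw [show t + f + 2 = t + (f + 1) + 1 by ring]; omega)
    omega
  -- Since `z` is at least `5/4` of its leading power while `v` stays below that power, `u` lies
  -- exactly one level below `v`. Splitting `v` once more gives three terms near one level: if that
  -- level is in the base, `z` is a sum of three base terms; above it, uniqueness forces `z = 3 *
  -- u`.
  have hu1 : 2 ^ (t + f) ≤ u := by omega
  obtain ⟨v', hv', u', hu', rfl, hle, hv'2, hv'1⟩ :=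
    h.split hb (show t ≤ t + f by omega) hv (by rw [show t + f + 1 = t + (f + 1) by ring]; omega)
      (by rw [show t + f + 2 = t + (f + 1) + 1 by ring]; omega)
  rw [show t + f + 1 = t + (f + 1) by ring] at hv'2
  have eF : 2 ^ (t + f + 1) = 2 * 2 ^ (t + f) := by ring
  rcases Nat.eq_zero_or_pos f with rfl | hf'
  · right; left
    simp only [add_zero, zero_add] at *
    refine ⟨v', h.mem_base hv' hv'2, u', h.mem_base hu' (by omega), u, h.mem_base hu hu2, hv'1,
      by omega, hu1, by omega, 0, rfl, by simp, fun y hy hy1 hy2 => ?_⟩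
    by_cases h2 : 2 ^ (t + 1 + 1) ≤ y
    · exact Or.inr ⟨0, le_rfl, by rw [top y hy h2 hy2]; simp⟩
    · exact Or.inl (snd y hy hy1 (by omega))
  obtain ⟨f, rfl⟩ := Nat.exists_eq_add_of_lt hf'
  simp only [zero_add] at *
  have thd : ∀ y ∈ l, 2 ^ (t + (f + 1)) ≤ y → y < 2 ^ (t + (f + 1) + 1) → y = u :=
    fun y hy h1 h2 => h.unique hb (show t < t + (f + 1) by omega) hy hu h1 h2 hu1 (by omega)
  have hvu : v' = u := thd v' hv' hv'1 (by omega)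
  subst hvu
  have huu : u' = v' := thd u' hu' (by omega) (by omega)
  subst huu
  have e0 : 2 ^ (t + (f + 1)) = 2 * 2 ^ (t + f) := by ring
  have e1 : 2 ^ (t + 1 + f) = 2 * 2 ^ (t + f) := by ring
  have e2 : 2 ^ (t + 2 + f) = 4 * 2 ^ (t + f) := by ring
  have stp : ∀ y ∈ l, y ≤ u' + u' + u' → y ≤ u' ∨ y = u' + u' ∨ y = u' + u' + u' := by
    intro y hy h1
    by_cases h2 : 2 ^ (t + (f + 1 + 1) + 1) ≤ y
    · exact Or.inr (Or.inr (top y hy h2 h1))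
    · by_cases h3 : 2 ^ (t + (f + 1) + 1) ≤ y
      · exact Or.inr (Or.inl (snd y hy h3 (by
          rw [show t + (f + 1) + 2 = t + (f + 1 + 1) + 1 by ring]; omega)))
      · left
        by_contra hcon
        have := thd y hy (by omega) (by omega)
        omega
  rcases ih f (by omega) hv' (by omega) (by omega) with
      ⟨a, ha, b, hb', h1, h2, h3, h4, h5⟩ | ⟨a, ha, b, hb', c, hc, h1, h2, h3, h4, e, rfl, h5, h6⟩ |
      ⟨a, ha, b, hb', h1, h2, h3, e, rfl, h5, h6⟩
  · have hfp := Nat.two_pow_pos f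
    have e3 : 2 ^ (t + f) = 2 ^ f * 2 ^ t := by ring
    have h7 : 10 * 2 ^ t ≤ 3 * (a + b) := by
      have : 2 ^ f * (10 * 2 ^ t) ≤ 2 ^ f * (3 * (a + b)) := by
        calc 2 ^ f * (10 * 2 ^ t) = 10 * 2 ^ (t + f) := by rw [e3]; ring
          _ ≤ 3 * u' := by omega
          _ = _ := by rw [h4]; ring
      exact Nat.le_of_mul_le_mul_left this hfp
    refine Or.inr (Or.inr ⟨a, ha, b, hb', h1, h2, h7, f, rfl, by rw [h4]; ring,
      fun y hy hy1 hy2 => ?_⟩)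
    rcases stp y hy hy2 with hy2 | rfl | rfl
    · obtain ⟨g, _, e⟩ := h5 y hy hy1 hy2
      exact Or.inl ⟨g, e⟩
    · exact Or.inl ⟨f + 1, by rw [h4]; ring⟩
    · exact Or.inr ⟨f, by rw [h4]; ring⟩
  -- Here `3 * u'` is at least `5/4` of its leading power, so `u'` is at least `5/3` of its own. The
  -- second and third forms stay below `3/2`, since `a + b + c < 6 * 2 ^ t` and `3 * (a + b) < 12 *
  -- 2 ^ t`.
  · exfalso
    have ha2 := hb a ha
    have hb2 := hb b hb'
    have hc2 := hb c hc
    have e3 : 2 ^ (t + (e + 1)) = 2 ^ e * (2 * 2 ^ t) := by ring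
    have e4 : 2 ^ (t + 1) = 2 * 2 ^ t := by ring
    have hlt : u' < 2 ^ e * (6 * 2 ^ t) := by
      rw [h5]
      exact Nat.mul_lt_mul_of_pos_left (by omega) (Nat.two_pow_pos e)
    have e5 : 2 ^ e * (6 * 2 ^ t) = 3 * 2 ^ (t + (e + 1)) := by ring
    omega
  · exfalso
    have ha2 := hb a ha
    have hb2 := hb b hb'
    have e3 : 2 ^ (t + (e + 2)) = 2 ^ e * (4 * 2 ^ t) := by ring
    have e4 : 2 ^ (t + 1) = 2 * 2 ^ t := by ring
    have hlt : u' < 2 ^ e * (12 * 2 ^ t) := by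
      rw [h5]
      exact Nat.mul_lt_mul_of_pos_left (by omega) (Nat.two_pow_pos e)
    have e5 : 2 ^ e * (12 * 2 ^ t) = 3 * 2 ^ (t + (e + 2)) := by ring
    omega

/-! ### Multiples of sums of two terms with compatible gaps -/

theorem nu_shift_le {x k c S : ℕ} (j : ℕ) (hx : x = 2 ^ j * S) (h : nu (c * S) ≤ k) :
    nu (c * x) ≤ k := by
  rw [hx, show c * (2 ^ j * S) = 2 ^ j * (c * S) by ring, nu_two_pow_mul]
  exact h

/-- `GapCompat g h`: the digit gaps `g` (of the larger term) and `h` can occur together in a chain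
with at most one small step. -/
def GapCompat (g h : ℕ) : Prop := g = h ∨ g = h + 1 ∨ (g = 3 ∧ h = 1)

/-- The sums of two terms with compatible gaps, up to a power of two. -/
theorem compat_sum_cases {i j g h : ℕ} (hc : GapCompat g h) (hlt : j + h < i + g) :
    (∃ e, 0 < e ∧ g = h ∧ i = j + e ∧
      2 ^ i * (2 ^ g + 1) + 2 ^ j * (2 ^ h + 1) = 2 ^ j * ((2 ^ e + 1) * (2 ^ g + 1)) ∧
      2 ^ (i + g) = 2 ^ j * (2 ^ e * 2 ^ g)) ∨
    (∃ e, g = h + 1 ∧ i = j + e ∧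
      2 ^ i * (2 ^ g + 1) + 2 ^ j * (2 ^ h + 1) = 2 ^ j * (2 * 2 ^ e * 2 ^ h + 2 ^ e + 2 ^ h + 1) ∧
      2 ^ (i + g) = 2 ^ j * (2 * 2 ^ e * 2 ^ h)) ∨
    (j = i + 1 ∧ 2 ^ i * (2 ^ g + 1) + 2 ^ j * (2 ^ h + 1) = 2 ^ i * 15 ∧ 2 ^ (i + g) = 2 ^ i * 8) ∨
    (∃ e, i = j + e ∧ 2 ^ i * (2 ^ g + 1) + 2 ^ j * (2 ^ h + 1) = 2 ^ j * (9 * 2 ^ e + 3) ∧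
      2 ^ (i + g) = 2 ^ j * (8 * 2 ^ e)) := by
  rcases hc with rfl | rfl | ⟨rfl, rfl⟩
  · obtain ⟨e, rfl⟩ := Nat.exists_eq_add_of_lt (show j < i by omega)
    exact Or.inl ⟨e + 1, by omega, rfl, rfl, by ring, by ring⟩
  · obtain ⟨e, rfl⟩ := Nat.exists_eq_add_of_le (show j ≤ i by omega)
    exact Or.inr (Or.inl ⟨e, rfl, rfl, by ring, by ring⟩)
  · rcases (by omega : j = i + 1 ∨ j ≤ i) with rfl | hji
    · exact Or.inr (Or.inr (Or.inl ⟨rfl, by ring, by ring⟩))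
    · obtain ⟨e, rfl⟩ := Nat.exists_eq_add_of_le hji
      exact Or.inr (Or.inr (Or.inr ⟨e, rfl, by ring, by ring⟩))

/-- Subadditivity alone would allow eight ones. The size condition `hm` forces the sum to be large
within its level, so the free exponents are at most `3` and finitely many numbers remain, except
when the factor `3` meets another factor `3`: the product `9` has only two ones. With gaps `h + 1`
and `h` and equal shifts, `9 * 2 ^ h + 6` has at most four. -/
theorem nu_three_mul_compat {i j g h : ℕ} (hg : 0 < g) (hh : 0 < h) (hc : GapCompat g h)
    (hlt : j + h < i + g)
    (hm : 4 * 2 ^ (i + g) ≤ 3 * (2 ^ i * (2 ^ g + 1) + 2 ^ j * (2 ^ h + 1))) :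
    nu (3 * (2 ^ i * (2 ^ g + 1) + 2 ^ j * (2 ^ h + 1))) ≤ 4 := by
  rcases compat_sum_cases hc hlt with ⟨e, he, -, -, h1, h2⟩ | ⟨e, -, -, h1, h2⟩ | ⟨-, h1, h2⟩ |
    ⟨e, -, h1, h2⟩
  · refine nu_shift_le j h1 ?_
    rw [h1, h2, mul_left_comm 4, mul_left_comm 3] at hm
    have hm := Nat.le_of_mul_le_mul_left hm (Nat.two_pow_pos j)
    have three : ∀ f, 0 < f → nu (3 * (3 * (2 ^ f + 1))) ≤ 4 := by
      intro f hf
      rw [← mul_assoc]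
      refine (nu_mul_le _ _).trans ?_
      rw [nu_two_pow_add (Nat.one_lt_two_pow hf.ne')]
      norm_num [nu]
    by_cases he1 : e = 1
    · subst he1
      exact three g hg
    by_cases hg1 : g = 1
    · subst hg1
      rw [mul_comm (2 ^ e + 1)]
      exact three e he
    have hE : 4 ≤ 2 ^ e := two_pow_le (i := 2) (by omega)
    have hG : 4 ≤ 2 ^ g := two_pow_le (i := 2) (by omega)
    have he2 : e ≤ 3 := by
      by_contra hcon
      have h' := two_pow_le (show 4 ≤ e by omega)
      norm_num at h'
      nlinarith
    have hg2 : g ≤ 3 := by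
      by_contra hcon
      have h' := two_pow_le (show 4 ≤ g by omega)
      norm_num at h'
      nlinarith
    interval_cases e <;> interval_cases g <;> first | (exfalso; omega) | norm_num [nu]
  · refine nu_shift_le j h1 ?_
    rw [h1, h2, mul_left_comm 4, mul_left_comm 3] at hm
    have hm := Nat.le_of_mul_le_mul_left hm (Nat.two_pow_pos j)
    have hH : 2 ≤ 2 ^ h := two_pow_le (i := 1) (by omega)
    rcases Nat.eq_zero_or_pos e with rfl | he
    · have : 3 * (2 * 2 ^ 0 * 2 ^ h + 2 ^ 0 + 2 ^ h + 1) = 9 * 2 ^ h + 6 := by ring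
      rw [this]
      refine (nu_add_le _ _).trans ?_
      rw [mul_comm, nu_two_pow_mul]
      norm_num [nu]
    have hE : 2 ≤ 2 ^ e := two_pow_le (i := 1) (by omega)
    have he2 : e ≤ 3 := by
      by_contra hcon
      have h' := two_pow_le (show 4 ≤ e by omega)
      norm_num at h'
      nlinarith
    have hh2 : h ≤ 3 := by
      by_contra hcon
      have h' := two_pow_le (show 4 ≤ h by omega)
      norm_num at h'
      nlinarith
    interval_cases e <;> interval_cases h <;> first | (exfalso; omega) | norm_num [nu]
  · refine nu_shift_le i h1 ?_
    norm_num [nu]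
  · refine nu_shift_le j h1 ?_
    rw [h1, h2, mul_left_comm 4, mul_left_comm 3] at hm
    have hm := Nat.le_of_mul_le_mul_left hm (Nat.two_pow_pos j)
    obtain rfl : e = 0 := by
      by_contra he
      have := two_pow_le (show 1 ≤ e by omega)
      omega
    norm_num [nu]

/-- As for the factor `3`, the condition `hm` bounds the free exponents, and the remaining numbers
are checked. -/
theorem nu_five_mul_compat {i j g h : ℕ} (hg : 0 < g) (hh : 0 < h) (hc : GapCompat g h)
    (hlt : j + h < i + g)
    (hm : 8 * 2 ^ (i + g) ≤ 5 * (2 ^ i * (2 ^ g + 1) + 2 ^ j * (2 ^ h + 1))) :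
    nu (5 * (2 ^ i * (2 ^ g + 1) + 2 ^ j * (2 ^ h + 1))) ≤ 4 := by
  rcases compat_sum_cases hc hlt with ⟨e, he, -, -, h1, h2⟩ | ⟨e, -, -, h1, h2⟩ | ⟨-, h1, h2⟩ |
    ⟨e, -, h1, h2⟩
  · refine nu_shift_le j h1 ?_
    rw [h1, h2, mul_left_comm 8, mul_left_comm 5] at hm
    have hm := Nat.le_of_mul_le_mul_left hm (Nat.two_pow_pos j)
    have hE : 2 ≤ 2 ^ e := two_pow_le (i := 1) (by omega)
    have hG : 2 ≤ 2 ^ g := two_pow_le (i := 1) (by omega)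
    have he2 : e ≤ 3 := by
      by_contra hcon
      have h' := two_pow_le (show 4 ≤ e by omega)
      norm_num at h'
      nlinarith
    have hg2 : g ≤ 3 := by
      by_contra hcon
      have h' := two_pow_le (show 4 ≤ g by omega)
      norm_num at h'
      nlinarith
    interval_cases e <;> interval_cases g <;> first | (exfalso; omega) | norm_num [nu]
  · refine nu_shift_le j h1 ?_
    rw [h1, h2, mul_left_comm 8, mul_left_comm 5] at hm
    have hm := Nat.le_of_mul_le_mul_left hm (Nat.two_pow_pos j)
    have hH : 2 ≤ 2 ^ h := two_pow_le (i := 1) (by omega)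
    have hE := Nat.two_pow_pos e
    have he2 : e ≤ 1 := by
      by_contra hcon
      have h' := two_pow_le (show 2 ≤ e by omega)
      norm_num at h'
      nlinarith
    have hh2 : h ≤ 3 := by
      by_contra hcon
      have h' := two_pow_le (show 4 ≤ h by omega)
      norm_num at h'
      nlinarith
    interval_cases e <;> interval_cases h <;> first | (exfalso; omega) | norm_num [nu]
  · refine nu_shift_le i h1 ?_
    norm_num [nu]
  · refine nu_shift_le j h1 ?_
    rw [h1, h2, mul_left_comm 8, mul_left_comm 5] at hm
    have hm := Nat.le_of_mul_le_mul_left hm (Nat.two_pow_pos j)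
    obtain rfl : e = 0 := by
      by_contra he
      have := two_pow_le (show 1 ≤ e by omega)
      omega
    norm_num [nu]

/-- A sum of at least `5/3` of its leading power starts with dense digits, which bounds the
exponents; the finite check leaves `111`, `1111` and `11011`, followed by zeros. -/
theorem compat_sum_eq_of_le {i j g h : ℕ} (hg : 0 < g) (hh : 0 < h) (hc : GapCompat g h)
    (hlt : j + h < i + g)
    (hm : 5 * 2 ^ (i + g) ≤ 3 * (2 ^ i * (2 ^ g + 1) + 2 ^ j * (2 ^ h + 1)))
    (hm2 : 2 ^ i * (2 ^ g + 1) + 2 ^ j * (2 ^ h + 1) < 2 * 2 ^ (i + g)) :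
    ∃ r, 2 ^ i * (2 ^ g + 1) + 2 ^ j * (2 ^ h + 1) = 7 * 2 ^ r ∨
      2 ^ i * (2 ^ g + 1) + 2 ^ j * (2 ^ h + 1) = 15 * 2 ^ r ∨
      2 ^ i * (2 ^ g + 1) + 2 ^ j * (2 ^ h + 1) = 27 * 2 ^ r := by
  rcases compat_sum_cases hc hlt with ⟨e, he, -, -, h1, h2⟩ | ⟨e, -, -, h1, h2⟩ | ⟨-, h1, h2⟩ |
    ⟨e, -, h1, h2⟩
  · rw [h1, h2, mul_left_comm 5, mul_left_comm 3] at hm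
    rw [h1, h2, mul_left_comm 2] at hm2
    rw [h1]
    have hm := Nat.le_of_mul_le_mul_left hm (Nat.two_pow_pos j)
    have hm2 := Nat.lt_of_mul_lt_mul_left hm2
    have hE : 2 ≤ 2 ^ e := two_pow_le (i := 1) (by omega)
    have hG : 2 ≤ 2 ^ g := two_pow_le (i := 1) (by omega)
    have he2 : e ≤ 3 := by
      by_contra hcon
      have h' := two_pow_le (show 4 ≤ e by omega)
      norm_num at h'
      nlinarith
    have hg2 : g ≤ 3 := by
      by_contra hcon
      have h' := two_pow_le (show 4 ≤ g by omega)
      norm_num at h'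
      nlinarith
    refine ⟨j, ?_⟩
    interval_cases e <;> interval_cases g <;> omega
  · rw [h1, h2, mul_left_comm 5, mul_left_comm 3] at hm
    rw [h1, h2, mul_left_comm 2] at hm2
    rw [h1]
    have hm := Nat.le_of_mul_le_mul_left hm (Nat.two_pow_pos j)
    have hm2 := Nat.lt_of_mul_lt_mul_left hm2
    have hH : 2 ≤ 2 ^ h := two_pow_le (i := 1) (by omega)
    have hE := Nat.two_pow_pos e
    have he2 : e ≤ 1 := by
      by_contra hcon
      have h' := two_pow_le (show 2 ≤ e by omega)
      norm_num at h'
      nlinarith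
    have hh2 : h ≤ 2 := by
      by_contra hcon
      have h' := two_pow_le (show 3 ≤ h by omega)
      norm_num at h'
      nlinarith
    refine ⟨j + 1, ?_⟩
    rw [pow_succ]
    interval_cases e <;> interval_cases h <;> omega
  · exact ⟨i, by omega⟩
  · exfalso
    rw [h1, h2, mul_left_comm 5, mul_left_comm 3] at hm
    have hm := Nat.le_of_mul_le_mul_left hm (Nat.two_pow_pos j)
    have hE := Nat.two_pow_pos e
    omega

theorem exists_level_of_pos {n : ℕ} (h : 0 < n) : ∃ i, 2 ^ i ≤ n ∧ n < 2 ^ (i + 1) := by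
  obtain ⟨k, r, rfl, hr, -⟩ := exists_two_pow_add h
  exact ⟨k, by omega, by rw [pow_succ]; omega⟩

theorem lt_of_two_pow_le_of_lt {i j x : ℕ} (h1 : 2 ^ i ≤ x) (h2 : x < 2 ^ j) : i < j :=
  (Nat.pow_lt_pow_iff_right (a := 2) (by omega)).1 (h1.trans_lt h2)

/-- The largest number below `2 ^ t` with `n` ones has them all at the top, and equals `(1 - 2 ^
(-n)) * 2 ^ t`. -/
theorem two_pow_mul_add_le_of_nu_le {n t x : ℕ} (hx : x < 2 ^ t) (hn : nu x ≤ n) :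
    2 ^ n * x + 2 ^ t ≤ 2 ^ n * 2 ^ t := by
  induction n generalizing t x with
  | zero =>
    rcases Nat.eq_zero_or_pos x with rfl | h
    · simp
    · have := nu_pos h
      omega
  | succ n ih =>
    rcases Nat.eq_zero_or_pos x with rfl | h
    · have := Nat.two_pow_pos (n + 1)
      nlinarith [Nat.two_pow_pos t]
    · obtain ⟨k, r, rfl, hr, e⟩ := exists_two_pow_add h
      have h1 := ih hr (by omega)
      have h2 := two_mul_two_pow_le ((Nat.pow_lt_pow_iff_right (a := 2) (by omega)).1
        (lt_of_le_of_lt (Nat.le_add_right _ r) hx))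
      have h3 := Nat.two_pow_pos n
      rw [pow_succ]
      nlinarith [Nat.mul_le_mul (show 1 ≤ 2 * 2 ^ n by omega) h2]

/-- The terms `p` (of level `t`) and `q` (lower) have two binary digits one each, at compatible
gaps. -/
def Compat (p q t : ℕ) : Prop :=
  ∃ i g j h, 0 < g ∧ 0 < h ∧ GapCompat g h ∧ j + h < i + g ∧ i + g = t ∧
    p = 2 ^ i * (2 ^ g + 1) ∧ q = 2 ^ j * (2 ^ h + 1)

theorem Compat.double {p q t : ℕ} (h : Compat p q t) : Compat (2 * p) q (t + 1) := by
  obtain ⟨i, g, j, h, hg, hh, hc, hlt, ht, rfl, rfl⟩ := h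
  exact ⟨i + 1, g, j, h, hg, hh, hc, by omega, by omega, by ring, rfl⟩

theorem Compat.nu_three {p q t : ℕ} (h : Compat p q t) (hm : 4 * 2 ^ t ≤ 3 * (p + q)) :
    nu (3 * (p + q)) ≤ 4 := by
  obtain ⟨i, g, j, h, hg, hh, hc, hlt, rfl, rfl, rfl⟩ := h
  exact nu_three_mul_compat hg hh hc hlt hm

theorem Compat.nu_five {p q t : ℕ} (h : Compat p q t) (hm : 8 * 2 ^ t ≤ 5 * (p + q)) :
    nu (5 * (p + q)) ≤ 4 := by
  obtain ⟨i, g, j, h, hg, hh, hc, hlt, rfl, rfl, rfl⟩ := h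
  exact nu_five_mul_compat hg hh hc hlt hm

theorem Compat.eq_of_le {p q t : ℕ} (h : Compat p q t) (hm : 5 * 2 ^ t ≤ 3 * (p + q))
    (hm2 : p + q < 2 * 2 ^ t) :
    ∃ r, p + q = 7 * 2 ^ r ∨ p + q = 15 * 2 ^ r ∨ p + q = 27 * 2 ^ r := by
  obtain ⟨i, g, j, h, hg, hh, hc, hlt, rfl, rfl, rfl⟩ := h
  exact compat_sum_eq_of_le hg hh hc hlt hm hm2

/-- This combination arises as `3 * (p + q) + 2 * p`. The condition `hm` forces the gap of `p` to be
at most two, and the gap condition then bounds everything else. -/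
theorem Compat.nu_five_add_three {p q t : ℕ} (h : Compat p q t)
    (hm : 8 * 2 ^ t ≤ 5 * p + 3 * q) : nu (5 * p + 3 * q) ≤ 4 := by
  obtain ⟨i, g, j, h, hg, hh, hc, hlt, rfl, rfl, rfl⟩ := h
  have e1 : 2 ^ i * (2 ^ g + 1) = 2 ^ (i + g) + 2 ^ i := by ring
  have e2 : 2 ^ j * (2 ^ h + 1) = 2 ^ (j + h) + 2 ^ j := by ring
  have h1 := two_mul_two_pow_le hlt
  have h2 := two_mul_two_pow_le (show j < j + h by omega)
  have hpos := Nat.two_pow_pos i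
  have hg2 : g ≤ 2 := by
    by_contra hcon
    have := two_pow_le (show i + 3 ≤ i + g by omega)
    rw [pow_add] at this
    omega
  have fin : ∀ {c d : ℕ} (e : ℕ), i = j + e →
      5 * (2 ^ i * c) + 3 * (2 ^ j * d) = 2 ^ j * (5 * (2 ^ e * c) + 3 * d) := by
    rintro c d e rfl
    ring
  obtain rfl | rfl : g = 1 ∨ g = 2 := by omega
  · obtain rfl : h = 1 := by
      rcases hc with h | h | h <;> omega
    obtain ⟨e, rfl⟩ := Nat.exists_eq_add_of_le (show j ≤ i by omega)
    rw [fin e rfl, nu_two_pow_mul]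
    simp only [pow_add, pow_one] at hm
    have he : e ≤ 3 := by
      by_contra hcon
      have h' := two_pow_le (show 4 ≤ e by omega)
      have := Nat.two_pow_pos j
      nlinarith
    interval_cases e <;> norm_num [nu]
  · have hji : j ≤ i := by
      rcases hc with h | h | h <;> omega
    obtain ⟨e, rfl⟩ := Nat.exists_eq_add_of_le hji
    rw [fin e rfl, nu_two_pow_mul]
    simp only [pow_add] at hm
    obtain rfl | rfl : h = 1 ∨ h = 2 := by
      rcases hc with h | h | h <;> omega
    all_goals
      have he : e ≤ 1 := by
        by_contra hcon
        have h' := two_pow_le (show 2 ≤ e by omega)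
        have := Nat.two_pow_pos j
        nlinarith
      interval_cases e <;> first | (norm_num [nu]; done) | (exfalso; omega)

theorem Ch.compat {L t p q : ℕ} {l : List ℕ} (h : Ch 1 L l) (hp : p ∈ l) (hq : q ∈ l)
    (hp1 : 2 ^ t ≤ p) (hp2 : p < 2 ^ (t + 1)) (hq2 : q < 2 ^ t) (hnu : 4 ≤ nu p + nu q) :
    Compat p q t := by
  have h1 := h.nu_le_two hp
  have h2 := h.nu_le_two hq
  rcases h.shape hp with ⟨i, rfl⟩ | ⟨i, g, hg, rfl⟩
  · simp [nu_two_pow] at hnu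
    omega
  rcases h.shape hq with ⟨j, rfl⟩ | ⟨j, h', hh, rfl⟩
  · simp [nu_two_pow] at hnu
    omega
  have e1 : 2 ^ i * (2 ^ g + 1) = 2 ^ (i + g) + 2 ^ i := by ring
  have e2 : 2 ^ j * (2 ^ h' + 1) = 2 ^ (j + h') + 2 ^ j := by ring
  have p1 := Nat.two_pow_pos i
  have p2 := Nat.two_pow_pos j
  have l1 : i + g < t + 1 := lt_of_two_pow_le_of_lt (by rw [e1]; omega) hp2
  have l2 : t < i + g + 1 := by
    refine lt_of_two_pow_le_of_lt hp1 ?_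
    have := two_mul_two_pow_le (show i < i + g by omega)
    rw [e1, pow_succ]
    omega
  have l3 : j + h' < t := lt_of_two_pow_le_of_lt (by rw [e2]; omega) hq2
  exact ⟨i, g, j, h', hg, hh, h.gap_compat hg hh hp hq (by omega), by omega, by omega, rfl, rfl⟩

theorem Ch.four_mul_le {L z t : ℕ} {l : List ℕ} (h : Ch 1 L l) (hz : z ∈ l) (ht : z < 2 ^ t) :
    4 * z ≤ 3 * 2 ^ t := by
  cases t with
  | zero => have := h.pos hz; simp at ht; omega
  | succ t =>
    have := h.two_mul_le hz ht
    rw [pow_succ]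
    omega

/-! ### Chains with two small steps have terms with at most four ones -/

/-- `l` arises from a chain `B` of top level `t` with at most one small step by one further small
step `p + q`, followed by steps that are not small. -/
structure TwoStep (t L p q : ℕ) (B l : List ℕ) : Prop where
  hB : Ch 1 t B
  hp : p ∈ B
  hq : q ∈ B
  low : 2 ^ t ≤ p + q
  high : p + q < 2 ^ (t + 1)
  ext : BigExt ((p + q) :: B) t L l

theorem Ch.two_cases {L : ℕ} {l : List ℕ} (h : Ch 2 L l) :
    Ch 1 L l ∨ ∃ t p q B, TwoStep t L p q B l := by
  rcases h.decomp (by omega) with h | ⟨t, B, p, q, h1, hp, hq, h2, h3, h4⟩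
  · exact Or.inl h
  · exact Or.inr ⟨t, p, q, B, h1, hp, hq, h2, h3, h4⟩

namespace TwoStep

variable {t L p q : ℕ} {B l : List ℕ}

theorem symm (T : TwoStep t L p q B l) : TwoStep t L q p B l := by
  obtain ⟨h1, h2, h3, h4, h5, h6⟩ := T
  rw [add_comm] at h4 h5 h6
  exact ⟨h1, h3, h2, h4, h5, h6⟩

theorem base_lt (T : TwoStep t L p q B l) : ∀ y ∈ (p + q) :: B, y < 2 ^ (t + 1) :=
  List.forall_mem_cons.2 ⟨T.high, fun _ => T.hB.lt⟩

theorem ch (T : TwoStep t L p q B l) : Ch 2 L l :=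
  T.ext.ch (T.hB.small T.hp T.hq T.low T.high)

theorem base_cases (T : TwoStep t L p q B l) {z : ℕ} (hz : z ∈ l) (h : z < 2 ^ (t + 1)) :
    z = p + q ∨ z ∈ B :=
  List.mem_cons.1 (T.ext.mem_base hz h)

theorem w_mem (T : TwoStep t L p q B l) : p + q ∈ l :=
  T.ext.base_mem List.mem_cons_self

theorem nu_w (T : TwoStep t L p q B l) : nu (p + q) ≤ 4 := by
  have := nu_add_le p q
  have := T.hB.nu_le_two T.hp
  have := T.hB.nu_le_two T.hq
  omega

theorem eight_mul_le (T : TwoStep t L p q B l) : 8 * (p + q) ≤ 15 * 2 ^ t := by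
  have := two_pow_mul_add_le_of_nu_le T.high T.nu_w
  rw [pow_succ] at this
  omega

/-- If `p + q` has at least three digits, then one of `p` and `q` is at the top level. -/
theorem top_or (T : TwoStep t L p q B l) (h : 3 ≤ nu (p + q)) :
    (2 ^ t ≤ p ∧ q < 2 ^ t) ∨ (2 ^ t ≤ q ∧ p < 2 ^ t) := by
  wlog hle : q ≤ p generalizing p q
  · rw [add_comm] at h
    have := this T.symm h (by omega)
    tauto
  have h1 := T.low
  have h2 := T.high
  rw [pow_succ] at h2
  by_contra hcon
  have hp : p < 2 ^ t := by omega
  have hpos := T.hB.pos T.hp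
  cases t with
  | zero => simp at hp; omega
  | succ s =>
  have n1 := T.hB.nu_le_two T.hp
  have n2 := T.hB.nu_le_two T.hq
  rcases Nat.lt_or_ge q (2 ^ s) with hq | hq
  · cases s with
    | zero => simp at hq; have := T.hB.pos T.hq; omega
    | succ s =>
    have := nu_add_carry' s 1 (s + 1) (by omega) hp hq h1
    omega
  · rcases Nat.lt_or_ge q p with hqp | hqp
    · obtain ⟨rfl, -⟩ := T.hB.level_pair T.hq T.hp hq hqp hp
      have := nu_add_carry' s 0 s (by omega) hp (u := 2 ^ s) (by rw [pow_succ]; omega) h1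
      rw [nu_two_pow] at this
      omega
    · obtain rfl : p = q := by omega
      rw [← two_mul, nu_two_mul] at h
      omega

/-- Any term `b` of the top level can replace the larger of `p` and `q`. If it is a different term,
`Ch.level_pair` shows that the two top terms are `2 ^ t` and `2 ^ t + 2 ^ c` and that all lower
terms are powers of two. With `b` the larger one, `p + q` would have too few ones; with `b = 2 ^ t`,
the complement is `2 ^ c + 2 ^ i`, which need not lie in `B`. -/
theorem exists_compl (T : TwoStep t L p q B l) (h : 3 ≤ nu (p + q)) {b : ℕ} (hb : b ∈ B)
    (hb1 : 2 ^ t ≤ b) : ∃ r, p + q = b + r ∧ r < 2 ^ t ∧ nu r ≤ 2 ∧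
      (r ∈ B ∨ (b = 2 ^ t ∧ nu (p + q) ≤ 3)) := by
  wlog hle : 2 ^ t ≤ p generalizing p q
  · rw [add_comm] at h ⊢
    refine this T.symm h ?_
    have := T.symm.top_or h
    omega
  have hq : q < 2 ^ t := by
    have := T.high
    rw [pow_succ] at this
    omega
  have hb2 := T.hB.lt hb
  have hp2 := T.hB.lt T.hp
  rcases lt_trichotomy p b with hpb | rfl | hpb
  · exfalso
    obtain ⟨rfl, c, -, -, hc, -⟩ := T.hB.level_pair T.hp hb hle hpb hb2
    obtain ⟨i, -, rfl⟩ := hc q T.hq hq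
    have := nu_add_le (2 ^ t) (2 ^ i)
    simp [nu_two_pow] at this
    omega
  · exact ⟨q, rfl, hq, T.hB.nu_le_two T.hq, Or.inl T.hq⟩
  · obtain ⟨rfl, c, hc, rfl, hc', -⟩ := T.hB.level_pair hb T.hp hb1 hpb hp2
    obtain ⟨i, -, rfl⟩ := hc' q T.hq hq
    refine ⟨2 ^ c + 2 ^ i, by ring, ?_, ?_, Or.inr ⟨rfl, ?_⟩⟩
    · have := T.high
      rw [pow_succ] at this
      omega
    · have := nu_add_le (2 ^ c) (2 ^ i)
      simpa [nu_two_pow] using this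
    · have h1 := nu_add_le (2 ^ t + 2 ^ c) (2 ^ i)
      have h2 := nu_add_le (2 ^ t) (2 ^ c)
      simp only [nu_two_pow] at h1 h2
      omega

theorem exists_compat (T : TwoStep t L p q B l) (h : 4 ≤ nu (p + q)) {b : ℕ} (hb : b ∈ B)
    (hb1 : 2 ^ t ≤ b) : ∃ r ∈ B, p + q = b + r ∧ r < 2 ^ t ∧ Compat b r t := by
  obtain ⟨r, h1, h2, h3, h4 | h4⟩ := T.exists_compl (by omega) hb hb1
  · refine ⟨r, h4, h1, h2, T.hB.compat hb h4 hb1 (T.hB.lt hb) h2 ?_⟩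
    rw [h1] at h
    exact h.trans (nu_add_le _ _)
  · omega

/-- The sum of `p + q` and another term of the top level has at most four digits. -/
theorem nu_w_add (T : TwoStep t L p q B l) {b : ℕ} (hb : b ∈ B) (hb1 : 2 ^ t ≤ b) :
    nu (p + q + b) ≤ 4 := by
  have h1 := T.hB.nu_le_two hb
  rcases Nat.lt_or_ge (nu (p + q)) 3 with h | h
  · have := nu_add_le (p + q) b
    omega
  · obtain ⟨r, h2, -, h3, -⟩ := T.exists_compl h hb hb1
    have := nu_add_le (2 * b) r
    rw [nu_two_mul] at this
    rw [h2, show b + r + b = 2 * b + r by ring]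
    omega

theorem compat_w (T : TwoStep t L p q B l) (h : 4 ≤ nu (p + q)) :
    ∃ a r, p + q = a + r ∧ Compat a r t := by
  rcases T.top_or (by omega) with h1 | h1
  · exact ⟨p, q, rfl, T.hB.compat T.hp T.hq h1.1 (T.hB.lt T.hp) h1.2 (h.trans (nu_add_le _ _))⟩
  · refine ⟨q, p, add_comm _ _, T.hB.compat T.hq T.hp h1.1 (T.hB.lt T.hq) h1.2 ?_⟩
    rw [add_comm] at h
    exact h.trans (nu_add_le _ _)

end TwoStep

/-- Writing `3 * u = 2 * u + u`, the size condition makes a carry run through two positions; for `5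
* u = 4 * u + u` it runs through three. -/
theorem nu_three_mul_le {u i : ℕ} (hu : u < 2 ^ (i + 1)) (h : 4 * 2 ^ i ≤ 3 * u) :
    nu (3 * u) + 2 ≤ 2 * nu u := by
  have e : 2 ^ (i + 1 + 1) = 2 * 2 ^ (i + 1) := by ring
  have e' : 2 ^ (i + 1) = 2 * 2 ^ i := by ring
  have := nu_add_carry' (z := 2 * u) (u := u) i 1 (i + 1) rfl (by omega) hu (by omega)
  rw [nu_two_mul, show 2 * u + u = 3 * u by ring] at this
  omega

theorem nu_five_mul_le {u i : ℕ} (hu : u < 2 ^ (i + 1)) (h : 8 * 2 ^ i ≤ 5 * u) :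
    nu (5 * u) + 3 ≤ 2 * nu u := by
  have e : 2 ^ (i + 2 + 1) = 8 * 2 ^ i := by ring
  have e' : 2 ^ (i + 1) = 2 * 2 ^ i := by ring
  have := nu_add_carry' (z := 4 * u) (u := u) i 2 (i + 2) rfl (by omega) hu (by omega)
  rw [show 4 * u = 2 * (2 * u) by ring, nu_two_mul, nu_two_mul,
    show 2 * (2 * u) + u = 5 * u by ring] at this
  omega

namespace TwoStep

variable {t L p q : ℕ} {B l : List ℕ}

/-- A large term with four digits. -/
theorem nu_four_form (T : TwoStep t L p q B l) {u i : ℕ} (hu : u ∈ l) (hnu : 4 ≤ nu u)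
    (hi : u < 2 ^ (i + 1)) (hm : 4 * 2 ^ i ≤ 3 * u) :
    (∃ f, i = t + f ∧ u = 2 ^ f * (p + q)) ∨
    (∃ f, i = t + 1 + f ∧ ∃ b ∈ B, 2 ^ t ≤ b ∧ 2 ^ (t + 1) ≤ p + q + b ∧ u = 2 ^ f * (p + q + b)) ∨
    (∃ f, u = 2 ^ f * (3 * (p + q)) ∧ 16 * 2 ^ t ≤ 9 * (p + q)) := by
  have nub : ∀ {b}, b ∈ B → nu b ≤ 2 := T.hB.nu_le_two
  have mb : ∀ {b}, b ∈ B → 2 * b ≤ 3 * 2 ^ t := fun hb => T.hB.two_mul_le hb (T.hB.lt hb)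
  have mw := T.eight_mul_le
  have ht := Nat.two_pow_pos t
  have et : 2 ^ (t + 1) = 2 * 2 ^ t := by ring
  have hui : 2 ^ i ≤ u := by
    have := Nat.two_pow_pos i
    omega
  rcases Nat.lt_or_ge u (2 ^ (t + 1)) with hut | hut
  · rcases T.base_cases hu hut with rfl | hub
    · have h1 := lt_of_two_pow_le_of_lt hui T.high
      have h2 := lt_of_two_pow_le_of_lt T.low hi
      exact Or.inl ⟨0, by omega, by simp⟩
    · have := nub hub
      omega
  obtain ⟨f, rfl⟩ := Nat.exists_eq_add_of_le (Nat.lt_succ_iff.1 (lt_of_two_pow_le_of_lt hut hi))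
  have hf := Nat.two_pow_pos f
  have e1 : 2 ^ (t + 1 + f) = 2 ^ f * (2 * 2 ^ t) := by ring
  have e2 : 2 ^ (t + 2 + f) = 2 * 2 ^ (t + 1 + f) := by ring
  rcases T.ext.structure T.base_lt hu (f := f) (by omega) (by rw [e2, ← pow_succ']; exact hi) with
    ⟨a, ha, b, hb, ha1, hba, hab, rfl, -⟩ | ⟨a, ha, b, hb, c, hc, ha1, hb1, hc1, habc, e, rfl, rfl, -⟩ |
    ⟨a, ha, b, hb, ha1, hb1, hab, e, rfl, rfl, -⟩
  · rw [nu_two_pow_mul] at hnu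
    rw [e1, mul_left_comm 4, mul_left_comm 3] at hm
    replace hm := Nat.le_of_mul_le_mul_left hm hf
    rcases List.mem_cons.1 ha with rfl | ha' <;> rcases List.mem_cons.1 hb with rfl | hb'
    · exact Or.inl ⟨f + 1, by omega, by ring⟩
    · refine Or.inr (Or.inl ⟨f, rfl, b, hb', ?_, hab, rfl⟩)
      by_contra hcon
      have := T.hB.four_mul_le hb' (t := t) (by omega)
      omega
    · exact Or.inr (Or.inl ⟨f, rfl, a, ha', ha1, by omega, by ring⟩)
    · have := nu_add_carry' t 0 t rfl (T.hB.lt ha') (T.hB.lt hb') hab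
      have := nub ha'
      have := nub hb'
      omega
  · have he := Nat.two_pow_pos e
    rw [show 2 ^ (t + 1 + (e + 1)) = 2 ^ e * (4 * 2 ^ t) by ring, mul_left_comm 4, mul_left_comm 3] at hm
    replace hm := Nat.le_of_mul_le_mul_left hm he
    -- Here `a + b + c` is at least `16/3 * 2 ^ t`. Elements of `B` are at most `3/2 * 2 ^ t` and `p
    -- + q` at most `15/8 * 2 ^ t`, so even one element of `B` among the three leaves the sum too
    -- small.
    have key : a = p + q ∧ b = p + q ∧ c = p + q := by
      rcases List.mem_cons.1 ha with rfl | ha' <;> rcases List.mem_cons.1 hb with rfl | hb' <;>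
        rcases List.mem_cons.1 hc with rfl | hc'
      · exact ⟨rfl, rfl, rfl⟩
      · have := mb hc'
        omega
      · have := mb hb'
        omega
      · have := mb hb'
        have := mb hc'
        omega
      · have := mb ha'
        omega
      · have := mb ha'
        have := mb hc'
        omega
      · have := mb ha'
        have := mb hb'
        omega
      · have := mb ha'
        have := mb hb'
        have := mb hc'
        omega
    obtain ⟨rfl, rfl, rfl⟩ := key
    exact Or.inr (Or.inr ⟨e, by ring, by omega⟩)
  · have he := Nat.two_pow_pos e
    rw [show 2 ^ (t + 1 + (e + 2)) = 2 ^ e * (8 * 2 ^ t) by ring, mul_left_comm 4,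
      mul_left_comm 3] at hm
    replace hm := Nat.le_of_mul_le_mul_left hm he
    -- By the same bounds: `a + b` is at least `32/9 * 2 ^ t`, more than `(15/8 + 3/2) * 2 ^ t`.
    have key : a = p + q ∧ b = p + q := by
      rcases List.mem_cons.1 ha with rfl | ha' <;> rcases List.mem_cons.1 hb with rfl | hb'
      · exact ⟨rfl, rfl⟩
      · have := mb hb'
        omega
      · have := mb ha'
        omega
      · have := mb ha'
        have := mb hb'
        omega
    obtain ⟨rfl, rfl⟩ := key
    exact Or.inr (Or.inr ⟨e + 1, by ring, by omega⟩)

/-- `p + q` is a multiple of `15` if it has four digits and is large. -/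
theorem eq_fifteen (T : TwoStep t L p q B l) (h : 16 * 2 ^ t ≤ 9 * (p + q)) :
    ∃ r, p + q = 15 * 2 ^ r := by
  -- Three ones reach only `7/4`, which is less than `16/9`. Of the candidates `7`, `15` and `27`
  -- below, the first has three ones and the last reaches only `27/16`.
  have h4 : 4 ≤ nu (p + q) := by
    by_contra hcon
    have := two_pow_mul_add_le_of_nu_le T.high (show nu (p + q) ≤ 3 by omega)
    have e : 2 ^ (t + 1) = 2 * 2 ^ t := by ring
    have := Nat.two_pow_pos t
    omega
  obtain ⟨a, b, hab, hc⟩ := T.compat_w h4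
  have hh := T.high
  rw [pow_succ] at hh
  obtain ⟨r, h | h | h⟩ := hc.eq_of_le (by omega) (by omega)
  · rw [hab, h, mul_comm, nu_two_pow_mul] at h4
    norm_num [nu] at h4
  · exact ⟨r, by omega⟩
  · have := T.low
    have l1 := lt_of_two_pow_le_of_lt (i := r + 4) (j := t + 1) (x := p + q)
      (by rw [pow_add]; omega) T.high
    have l2 := lt_of_two_pow_le_of_lt (i := t) (j := r + 5) (x := p + q)
      T.low (by rw [pow_add]; omega)
    obtain rfl : t = r + 4 := by omega
    rw [pow_add] at *
    omega

theorem exists_compat_add (T : TwoStep t L p q B l) {b : ℕ} (hb : b ∈ B) (hb1 : 2 ^ t ≤ b)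
    (h : 4 ≤ nu (p + q + b)) : ∃ r ∈ B, p + q = b + r ∧ r < 2 ^ t ∧ Compat b r t := by
  have h3 : 3 ≤ nu (p + q) := by
    by_contra hcon
    have := nu_add_carry' t 0 t rfl T.high (T.hB.lt hb) (by have := T.low; rw [pow_succ]; omega)
    have := T.hB.nu_le_two hb
    omega
  obtain ⟨r, h1, h2, h4, h5⟩ := T.exists_compl h3 hb hb1
  rw [h1, show b + r + b = 2 * b + r by ring] at h
  have h6 := nu_add_le (2 * b) r
  rw [nu_two_mul] at h6
  rcases h5 with h5 | ⟨rfl, -⟩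
  · exact ⟨r, h5, h1, h2, T.hB.compat hb h5 hb1 (T.hB.lt hb) h2 (by omega)⟩
  · rw [nu_two_pow] at h6
    omega

/-- With at most three ones in `u` the carries suffice. With four, `nu_four_form` exhibits `u`, up
to a power of two, as a sum of two terms with compatible gaps or as `3 * (p + q)` with `p + q` a
shift of `15`. -/
theorem nu_three (T : TwoStep t L p q B l) {u i : ℕ} (hu : u ∈ l) (hnu : nu u ≤ 4)
    (hi : u < 2 ^ (i + 1)) (hm : 4 * 2 ^ i ≤ 3 * u) : nu (3 * u) ≤ 4 := by
  rcases Nat.lt_or_ge (nu u) 4 with h | h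
  · have := nu_three_mul_le hi hm
    omega
  have key : ∀ {f x c : ℕ}, u = 2 ^ f * x → (i = c + f → 4 * 2 ^ c ≤ 3 * x) := by
    rintro f x c rfl rfl
    rw [add_comm c, pow_add, mul_left_comm 4, mul_left_comm 3] at hm
    exact Nat.le_of_mul_le_mul_left hm (Nat.two_pow_pos f)
  rcases T.nu_four_form hu h hi hm with ⟨f, hf, e⟩ | ⟨f, hf, b, hb, hb1, -, e⟩ | ⟨f, e, h2⟩ <;>
    refine nu_shift_le f e ?_ <;> rw [e, nu_two_pow_mul] at h
  · obtain ⟨a, r, har, hc⟩ := T.compat_w h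
    have := key e hf
    rw [har] at this ⊢
    exact hc.nu_three this
  · obtain ⟨r, hr, h4, -, hc⟩ := T.exists_compat_add hb hb1 h
    have := key e hf
    rw [h4, show b + r + b = 2 * b + r by ring] at this ⊢
    exact hc.double.nu_three this
  · obtain ⟨r, hr⟩ := T.eq_fifteen h2
    rw [hr, show 3 * (3 * (15 * 2 ^ r)) = 2 ^ r * 135 by ring, nu_two_pow_mul]
    norm_num [nu]

theorem nu_five (T : TwoStep t L p q B l) {u i : ℕ} (hu : u ∈ l) (hnu : nu u ≤ 4)
    (hi : u < 2 ^ (i + 1)) (hm : 8 * 2 ^ i ≤ 5 * u) : nu (5 * u) ≤ 4 := by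
  rcases Nat.lt_or_ge (nu u) 4 with h | h
  · have := nu_five_mul_le hi hm
    omega
  have key : ∀ {f x c : ℕ}, u = 2 ^ f * x → (i = c + f → 8 * 2 ^ c ≤ 5 * x) := by
    rintro f x c rfl rfl
    rw [add_comm c, pow_add, mul_left_comm 8, mul_left_comm 5] at hm
    exact Nat.le_of_mul_le_mul_left hm (Nat.two_pow_pos f)
  rcases T.nu_four_form hu h hi (by omega) with
    ⟨f, hf, e⟩ | ⟨f, hf, b, hb, hb1, -, e⟩ | ⟨f, e, h2⟩ <;>
    refine nu_shift_le f e ?_ <;> rw [e, nu_two_pow_mul] at h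
  · obtain ⟨a, r, har, hc⟩ := T.compat_w h
    have := key e hf
    rw [har] at this ⊢
    exact hc.nu_five this
  · obtain ⟨r, hr, h4, -, hc⟩ := T.exists_compat_add hb hb1 h
    have := key e hf
    rw [h4, show b + r + b = 2 * b + r by ring] at this ⊢
    exact hc.double.nu_five this
  · obtain ⟨r, hr⟩ := T.eq_fifteen h2
    rw [hr, show 5 * (3 * (15 * 2 ^ r)) = 2 ^ r * 225 by ring, nu_two_pow_mul]
    norm_num [nu]

/-- If `p + q` has at most three ones, then `2 * (p + q + b) + (p + q)` loses three to carries.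
Otherwise `p + q = b + r` with compatible gaps, and the number is `5 * b + 3 * r`. -/
theorem nu_three_add_two (T : TwoStep t L p q B l) {b : ℕ} (hb : b ∈ B) (hb1 : 2 ^ t ≤ b)
    (hm : 8 * 2 ^ t ≤ 3 * (p + q) + 2 * b) : nu (3 * (p + q) + 2 * b) ≤ 4 := by
  have hw := T.high
  have hb2 := T.hB.lt hb
  have hb3 := T.hB.two_mul_le hb hb2
  rcases Nat.lt_or_ge (nu (p + q)) 4 with h | h
  · have e : 2 ^ (t + 1) = 2 * 2 ^ t := by ring
    have e2 : 2 ^ (t + 2 + 1) = 8 * 2 ^ t := by ring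
    have h1 := nu_add_carry' (z := 2 * (p + q + b)) (u := p + q) t 2 (t + 2) rfl (by omega) hw
      (by omega)
    have := T.nu_w_add hb hb1
    rw [nu_two_mul, show 2 * (p + q + b) + (p + q) = 3 * (p + q) + 2 * b by ring] at h1
    omega
  · obtain ⟨r, hr, h4, -, hc⟩ := T.exists_compat h hb hb1
    rw [h4, show 3 * (b + r) + 2 * b = 5 * b + 3 * r by ring] at hm ⊢
    exact hc.nu_five_add_three hm

/-- The double sum `2 * v + u`, where `v` lies one level above `u`. -/
theorem nu_two_mul_add (T : TwoStep t L p q B l) {i : ℕ} (ih : ∀ x ∈ l, x < 2 ^ (i + 2) → nu x ≤ 4)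
    (hti : t ≤ i) {u v : ℕ} (hu : u ∈ l) (hv : v ∈ l) (huB : u ∉ B) (hu1 : 2 ^ i ≤ u)
    (hu2 : u < 2 ^ (i + 1)) (hv2 : v < 2 ^ (i + 2)) (hv1 : 2 ^ (i + 1) ≤ v)
    (h : 2 ^ (i + 3) ≤ 2 * v + u) : nu (2 * v + u) ≤ 4 := by
  have e1 : 2 ^ (i + 1) = 2 * 2 ^ i := by ring
  have e2 : 2 ^ (i + 2) = 4 * 2 ^ i := by ring
  have e3 : 2 ^ (i + 3) = 8 * 2 ^ i := by ring
  obtain ⟨x, hx, y, hy, rfl, hyx, hx2, hx1⟩ := T.ext.split T.base_lt hti hv hv1 hv2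
  have hnu := ih u hu (by omega)
  have hy1 : 2 ^ i ≤ y := by omega
  have five : x = u → y = u → nu (2 * (x + y) + u) ≤ 4 := by
    rintro rfl rfl
    rw [show 2 * (y + y) + y = 5 * y by ring]
    exact T.nu_five hu hnu hu2 (by omega)
  rcases Nat.lt_or_ge t i with hlt | hge
  · exact five (T.ext.unique T.base_lt hlt hx hu hx1 hx2 hu1 hu2)
      (T.ext.unique T.base_lt hlt hy hu hy1 (by omega) hu1 hu2)
  · obtain rfl : t = i := by omega
    obtain rfl := (T.base_cases hu hu2).resolve_right huB
    rcases T.base_cases hx hx2 with rfl | hxB <;> rcases T.base_cases hy (by omega) with hyw | hyB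
    · exact five rfl hyw
    · rw [show 2 * (p + q + y) + (p + q) = 3 * (p + q) + 2 * y by ring]
      exact T.nu_three_add_two hyB hy1 (by omega)
    · rw [hyw, show 2 * (x + (p + q)) + (p + q) = 3 * (p + q) + 2 * x by ring]
      exact T.nu_three_add_two hxB hx1 (by omega)
    · have h1 := nu_add_carry' t 0 t rfl hx2 (u := y) (by omega) (by omega)
      have h2 := T.hB.nu_le_two hxB
      have h3 := T.hB.nu_le_two hyB
      have h4 := nu_add_carry' (z := 2 * (x + y)) (u := p + q) t 2 (t + 2) rfl
        (by rw [pow_succ 2 (t + 2)]; omega) hu2 (by omega)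
      rw [nu_two_mul] at h4
      omega

/-- Induction on `z = v + u`, with `v` one level below `z` and `u` another `d` levels lower. The
carry costs `d + 1` ones, which settles `d ≥ 3`, and also `d ≥ 1` if `u ∈ B`. In the remaining cases
`v` is split again, and uniqueness within levels turns `z` into `2 * u`, `3 * u`, or `2 * x + y`
with few levels between the terms, apart from sums at the level of the small step itself. -/
theorem nu_le_four (T : TwoStep t L p q B l) {z : ℕ} (hz : z ∈ l) : nu z ≤ 4 := by
  induction z using Nat.strong_induction_on with
  | _ z ih =>
  have nub : ∀ {b}, b ∈ B → nu b ≤ 2 := T.hB.nu_le_two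
  rcases Nat.lt_or_ge z (2 ^ (t + 1)) with hzt | hzt
  · rcases T.base_cases hz hzt with rfl | hzB
    · exact T.nu_w
    · exact (nub hzB).trans (by omega)
  have pos : ∀ x ∈ l, 0 < x := fun x hx => T.ch.pos hx
  obtain ⟨j', hj1, hj2⟩ := exists_level_of_pos (pos z hz)
  obtain ⟨j, rfl⟩ : ∃ j, j' = j + 1 := by
    have := lt_of_two_pow_le_of_lt hzt hj2
    exact ⟨j' - 1, by omega⟩
  have htj : t ≤ j := by
    have := lt_of_two_pow_le_of_lt hzt hj2
    omega
  obtain ⟨v, hv, u, hu, rfl, huv, hv2, hv1⟩ := T.ext.split T.base_lt htj hz hj1 hj2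
  have pu := pos u hu
  have hnv := ih v (by omega) hv
  have hnu := ih u (by have := pos v hv; omega) hu
  obtain ⟨i, hi1, hi2⟩ := exists_level_of_pos pu
  have hij : i ≤ j := by
    have := lt_of_two_pow_le_of_lt (hi1.trans huv) hv2
    omega
  obtain ⟨d, rfl⟩ := Nat.exists_eq_add_of_le hij
  have carry := nu_add_carry' i d (i + d) rfl hv2 hi2 hj1
  by_cases huB : u ∈ B
  · have h1 := nub huB
    rcases Nat.eq_zero_or_pos d with rfl | hd
    · have := lt_of_two_pow_le_of_lt hi1 (T.hB.lt huB)
      obtain rfl : t = i := by omega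
      rcases T.base_cases hv hv2 with rfl | hvB
      · exact T.nu_w_add huB hi1
      · have := nub hvB
        omega
    · omega
  have hti : t ≤ i := by
    by_contra hcon
    have := two_pow_le (show i + 1 ≤ t by omega)
    rcases T.base_cases hu (by rw [pow_succ]; omega) with h | h
    · have := T.low
      omega
    · exact huB h
  have double : nu (u + u) ≤ 4 := by
    rw [← two_mul, nu_two_mul]
    exact hnu
  have three (h : 2 ^ (i + 2) ≤ u + u + u) : nu (u + u + u) ≤ 4 := by
    rw [show u + u + u = 3 * u by ring] at h ⊢
    rw [pow_add] at h
    exact T.nu_three hu hnu hi2 (by omega)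
  have e1 : 2 ^ (i + 1) = 2 * 2 ^ i := by ring
  have e2 : 2 ^ (i + 2) = 4 * 2 ^ i := by ring
  have e3 : 2 ^ (i + 3) = 8 * 2 ^ i := by ring
  obtain rfl | rfl | rfl | hd : d = 0 ∨ d = 1 ∨ d = 2 ∨ 3 ≤ d := by omega
  · rcases Nat.lt_or_ge t i with hlt | hge
    · obtain rfl := T.ext.unique T.base_lt hlt hu hv hi1 hi2 hv1 hv2
      exact double
    · obtain rfl : t = i := by omega
      obtain rfl := (T.base_cases hu hi2).resolve_right huB
      rcases T.base_cases hv hv2 with rfl | hvB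
      · exact double
      · rw [add_comm]
        exact T.nu_w_add hvB hv1
  · obtain ⟨x, hx, y, hy, rfl, hyx, hx2, hx1⟩ := T.ext.split T.base_lt hti hv hv1 hv2
    rcases Nat.lt_or_ge t i with hlt | hge
    · obtain rfl := T.ext.unique T.base_lt hlt hx hu hx1 hx2 hi1 hi2
      have hny := ih y (by omega) hy
      rcases Nat.lt_or_ge y (2 ^ i) with hyi | hyi
      · obtain ⟨k, hk1, hk2⟩ := exists_level_of_pos (pos y hy)
        have hki := lt_of_two_pow_le_of_lt hk1 hyi
        have e : x + y + x = 2 * x + y := by ring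
        have h1 := nu_add_carry' (z := 2 * x) (u := y) k (i + 1 - k) (i + 1) (by omega) (by omega)
          hk2 (by omega)
        rw [nu_two_mul, ← e] at h1
        by_cases hyB : y ∈ B
        · have := nub hyB
          omega
        have htk : t ≤ k := by
          by_contra hcon
          have := two_pow_le (show k + 1 ≤ t by omega)
          rcases T.base_cases hy (by rw [pow_succ]; omega) with h | h
          · have := T.low
            omega
          · exact hyB h
        rcases Nat.lt_or_ge (k + 1) i with hk | hk
        · omega
        · obtain rfl : i = k + 1 := by omega
          have f1 : 2 ^ (k + 2) = 4 * 2 ^ k := by ring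
          have f2 : 2 ^ (k + 3) = 8 * 2 ^ k := by ring
          rw [e]
          exact T.nu_two_mul_add (fun c hc hlt => ih c (by omega) hc) htk hy hx hyB hk1 hk2 hi2 hi1
            (by omega)
      · obtain rfl := T.ext.unique T.base_lt hlt hy hx hyi (by omega) hi1 hi2
        exact three (by omega)
    · obtain rfl : t = i := by omega
      obtain rfl := (T.base_cases hu hi2).resolve_right huB
      have key (b : ℕ) (hb : b ∈ B) (h : 2 ^ (t + 2) ≤ 2 * (p + q) + b) :
          nu (2 * (p + q) + b) ≤ 4 := by
        have := nu_add_carry' (z := 2 * (p + q)) t 1 (t + 1) rfl (by omega) (T.hB.lt hb) h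
        rw [nu_two_mul] at this
        have := nub hb
        omega
      rcases T.base_cases hx hx2 with rfl | hxB <;>
        rcases T.base_cases hy (by omega) with hyw | hyB
      · rw [hyw]
        exact three (by omega)
      · have := key y hyB (by omega)
        rwa [show p + q + y + (p + q) = 2 * (p + q) + y by ring]
      · rw [hyw] at hj1 ⊢
        have := key x hxB (by omega)
        rwa [show x + (p + q) + (p + q) = 2 * (p + q) + x by ring]
      · have := (T.hB.big hxB hyB hv1).nu_le_two List.mem_cons_self
        omega
  · obtain ⟨x, hx, y, hy, rfl, hyx, hx2, hx1⟩ :=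
      T.ext.split (j := i + 1) T.base_lt (by omega) hv hv1 hv2
    have e4 : 2 ^ (i + 1 + 1) = 4 * 2 ^ i := by ring
    have e5 : 2 ^ (i + 2 + 1) = 8 * 2 ^ i := by ring
    obtain rfl := T.ext.unique T.base_lt (show t < i + 1 by omega) hx hy hx1 hx2 (by omega)
      (by omega)
    rw [← two_mul] at hj1 ⊢
    exact T.nu_two_mul_add (fun c hc hlt => ih c (by omega) hc) hti hu hx huB hi1 hi2 hx2 hx1 hj1
  · omega

end TwoStep

theorem Ch.nu_le_four {L z : ℕ} {l : List ℕ} (h : Ch 2 L l) (hz : z ∈ l) : nu z ≤ 4 := by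
  rcases h.two_cases with h | ⟨t, p, q, B, T⟩
  · exact (h.nu_le_two hz).trans (by omega)
  · exact T.nu_le_four hz

/-! ### An automaton for `α * y + β * u = N` with few ones in `y` and `u` -/

/-- A state of the digit-by-digit search for solutions of `α * y + β * u + carry = N`: the carry
and the numbers of nonzero digits that are left for `y` and `u`. -/
structure DigitState where
  carry : ℕ
  ay : ℕ
  au : ℕ

/-- Every solution from the first state is one from the second. -/
def DigitState.le (s t : DigitState) : Bool :=
  s.carry.beq t.carry && (s.ay.ble t.ay && s.au.ble t.au)

theorem DigitState.le_iff {s t : DigitState} :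
    s.le t = true ↔ s.carry = t.carry ∧ s.ay ≤ t.ay ∧ s.au ≤ t.au := by
  simp only [DigitState.le, Bool.and_eq_true, Nat.beq_eq, Nat.ble_eq]

/-- The successors of a state when the next digit of the target is `d`, with chosen digits of `y`
and `u`. -/
def DigitState.next (α β d : ℕ) (s : DigitState) (yu : ℕ × ℕ) : List DigitState :=
  match s.ay.blt yu.1, s.au.blt yu.2,
    ((α * yu.1 + β * yu.2 + s.carry) % 2).beq d with
  | false, false, true =>
    [⟨(α * yu.1 + β * yu.2 + s.carry) / 2, s.ay - yu.1, s.au - yu.2⟩]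
  | _, _, _ => []

def DigitState.insert (S : List DigitState) (s : DigitState) : List DigitState :=
  match S.any s.le with
  | true => S
  | false => s :: S

def digitStep (α β d : ℕ) (S : List DigitState) : List DigitState :=
  S.flatMap fun s => [(0, 0), (0, 1), (1, 0), (1, 1)].flatMap (s.next α β d)

/-- The states reachable through any number of zero digits, if the number of rounds suffices. -/
def zeroClosure (α β : ℕ) : ℕ → List DigitState → List DigitState
  | 0, S => S
  | r + 1, S => zeroClosure α β r ((digitStep α β 0 S).foldl DigitState.insert S)

/-- The digits of a target, from the lowest one; `zeros` stands for any number of zeros, and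
`cutY` and `cutU` mark where `y` and `u` end. -/
inductive DigitInstr
  | bit (d : ℕ)
  | zeros
  | cutY
  | cutU

/-- Check that there are no solutions. -/
def noSolution (α β : ℕ) : List DigitInstr → List DigitState → Bool
  | [], S => S.all fun s => !s.carry.beq 0
  | .bit d :: l, S => noSolution α β l ((digitStep α β d S).foldl DigitState.insert [])
  -- Nine rounds of closure are only a guess that need not be justified: the check includes that the
  -- resulting list is closed under reading a zero.
  | .zeros :: l, S =>
    (digitStep α β 0 (zeroClosure α β 9 S)).all (fun s => (zeroClosure α β 9 S).any s.le) &&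
      noSolution α β l (zeroClosure α β 9 S)
  | .cutY :: l, S =>
    noSolution α β l ((S.map fun s => ⟨s.carry, 0, s.au⟩).foldl DigitState.insert [])
  | .cutU :: l, S =>
    noSolution α β l ((S.map fun s => ⟨s.carry, s.ay, 0⟩).foldl DigitState.insert [])

/-- The list of instructions describes the digits of `N`, where `y` and `u` have at most `i` and
`j` digits. -/
inductive DigitPath : List DigitInstr → ℕ → ℕ → ℕ → Prop
  | nil {i j : ℕ} : DigitPath [] 0 i j
  | bit {l N i j} (d : ℕ) : DigitPath l N (i - 1) (j - 1) → d < 2 →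
      DigitPath (.bit d :: l) (2 * N + d) i j
  | zeros {l N i j} (r : ℕ) : DigitPath l N (i - r) (j - r) → DigitPath (.zeros :: l) (2 ^ r * N) i j
  | cutY {l N j} : DigitPath l N 0 j → DigitPath (.cutY :: l) N 0 j
  | cutU {l N i} : DigitPath l N i 0 → DigitPath (.cutU :: l) N i 0

/-- Some state of the list admits a solution. -/
def DigitSat (α β : ℕ) (S : List DigitState) (N i j : ℕ) : Prop :=
  ∃ s ∈ S, ∃ y u, y < 2 ^ i ∧ u < 2 ^ j ∧ nu y ≤ s.ay ∧ nu u ≤ s.au ∧ α * y + β * u + s.carry = N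

theorem DigitSat.of_le {α β N i j : ℕ} {S S' : List DigitState} (h : DigitSat α β S N i j)
    (hS : ∀ s ∈ S, ∃ t ∈ S', s.le t = true) : DigitSat α β S' N i j := by
  obtain ⟨s, hs, y, u, hy, hu, h1, h2, h3⟩ := h
  obtain ⟨t, ht, hst⟩ := hS s hs
  rw [DigitState.le_iff] at hst
  exact ⟨t, ht, y, u, hy, hu, by omega, by omega, by omega⟩

theorem DigitState.le_refl (s : DigitState) : s.le s = true := by
  simp [DigitState.le_iff]

theorem DigitState.le_insert {S : List DigitState} {s t : DigitState} (h : s = t ∨ ∃ r ∈ S, s.le r = true) :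
    ∃ r ∈ DigitState.insert S t, s.le r = true := by
  unfold DigitState.insert
  rcases h with rfl | ⟨r, hr, h⟩
  · split
    · next h => simpa using h
    · exact ⟨s, List.mem_cons_self, s.le_refl⟩
  · split
    · exact ⟨r, hr, h⟩
    · exact ⟨r, List.mem_cons_of_mem _ hr, h⟩

theorem DigitState.le_foldl_insert {l S : List DigitState} {s : DigitState}
    (h : s ∈ l ∨ ∃ r ∈ S, s.le r = true) : ∃ r ∈ l.foldl DigitState.insert S, s.le r = true := by
  induction l generalizing S with
  | nil => simpa using h
  | cons t l ih =>
    refine ih ?_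
    rcases h with h | h
    · rcases List.mem_cons.1 h with h | h
      · exact Or.inr (DigitState.le_insert (Or.inl h))
      · exact Or.inl h
    · exact Or.inr (DigitState.le_insert (Or.inr h))

theorem DigitState.trans {r s t : DigitState} (h : r.le s = true) (h' : s.le t = true) :
    r.le t = true := by
  rw [DigitState.le_iff] at *
  omega

theorem le_zeroClosure {α β : ℕ} (r : ℕ) {S : List DigitState} {s : DigitState} (h : s ∈ S) :
    ∃ t ∈ zeroClosure α β r S, s.le t = true := by
  induction r generalizing S s with
  | zero => exact ⟨s, h, s.le_refl⟩
  | succ r ih =>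
    obtain ⟨t, ht, hst⟩ := DigitState.le_foldl_insert (l := digitStep α β 0 S) (S := S)
      (Or.inr ⟨s, h, s.le_refl⟩)
    obtain ⟨t', ht', h'⟩ := ih ht
    exact ⟨t', ht', DigitState.trans hst h'⟩

theorem DigitSat.step {α β d N i j : ℕ} {S : List DigitState} (hd : d < 2)
    (h : DigitSat α β S (2 * N + d) i j) : DigitSat α β (digitStep α β d S) N (i - 1) (j - 1) := by
  obtain ⟨s, hs, y, u, hy, hu, h1, h2, h3⟩ := h
  have half : ∀ {x i : ℕ}, x < 2 ^ i → x / 2 < 2 ^ (i - 1) := by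
    intro x i h
    cases i with
    | zero => simp at h; simp [h]
    | succ i => rw [pow_succ] at h; simp; omega
  have hnu : ∀ x, nu (x / 2) + x % 2 = nu x := by
    intro x
    rcases Nat.even_or_odd' x with ⟨a, rfl | rfl⟩
    · rw [show 2 * a / 2 = a by omega, nu_two_mul]
      omega
    · rw [show (2 * a + 1) / 2 = a by omega, nu_two_mul_add_one]
      omega
  have hy' := hnu y
  have hu' := hnu u
  have ey := Nat.div_add_mod y 2
  have eu := Nat.div_add_mod u 2
  have e : 2 * (α * (y / 2) + β * (u / 2)) + (α * (y % 2) + β * (u % 2) + s.carry) = 2 * N + d := by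
    rw [← h3]
    conv_rhs => rw [← ey, ← eu]
    ring
  refine ⟨⟨(α * (y % 2) + β * (u % 2) + s.carry) / 2, s.ay - y % 2, s.au - u % 2⟩, ?_, y / 2, u / 2,
    half hy, half hu, by simp only; omega, by simp only; omega, by simp only; omega⟩
  refine List.mem_flatMap.2 ⟨s, hs, List.mem_flatMap.2 ⟨(y % 2, u % 2), ?_, ?_⟩⟩
  · rcases Nat.mod_two_eq_zero_or_one y with h | h <;>
      rcases Nat.mod_two_eq_zero_or_one u with h' | h' <;> simp [h, h']
  · have b1 : s.ay.blt (y % 2) = false := by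
      rw [Bool.eq_false_iff, Ne, Nat.blt_eq]
      omega
    have b2 : s.au.blt (u % 2) = false := by
      rw [Bool.eq_false_iff, Ne, Nat.blt_eq]
      omega
    have b3 : ((α * (y % 2) + β * (u % 2) + s.carry) % 2).beq d = true := by
      rw [Nat.beq_eq]
      omega
    simp only [DigitState.next, b1, b2, b3]
    simp

/-- A list of states closed under reading a zero absorbs a block of zeros of any length. -/
theorem DigitSat.zeros {α β N : ℕ} {C : List DigitState} (r : ℕ) {i j : ℕ}
    (h : DigitSat α β C (2 ^ r * N) i j)
    (hC : ∀ s ∈ digitStep α β 0 C, ∃ t ∈ C, s.le t = true) : DigitSat α β C N (i - r) (j - r) := by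
  induction r generalizing i j with
  | zero => simpa using h
  | succ r ih =>
    have h1 : DigitSat α β C (2 * (2 ^ r * N) + 0) i j := by
      rwa [add_zero, ← mul_assoc, ← pow_succ']
    have := ih ((h1.step (by omega)).of_le hC)
    rwa [Nat.sub_sub, Nat.sub_sub, add_comm 1] at this

/-- Soundness of the search: splitting off the last digits of `y`, `u` and `N` turns a solution for
a state into one for a successor state. When `N` is exhausted, a solution would need carry zero. -/
theorem DigitPath.not_sat {α β N i j : ℕ} {l : List DigitInstr} {S : List DigitState}
    (h : DigitPath l N i j) (hl : noSolution α β l S = true) : ¬ DigitSat α β S N i j := by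
  induction h generalizing S with
  | nil =>
    rintro ⟨s, hs, y, u, -, -, -, -, h⟩
    simp only [noSolution, List.all_eq_true] at hl
    have := hl s hs
    rw [show s.carry = 0 by omega] at this
    simp at this
  | bit d _ hd ih =>
    intro hs
    exact ih hl ((hs.step hd).of_le fun s hs => DigitState.le_foldl_insert (Or.inl hs))
  | zeros r _ ih =>
    intro hs
    simp only [noSolution, Bool.and_eq_true, List.all_eq_true, List.any_eq_true] at hl
    exact ih hl.2 ((hs.of_le fun s hs => le_zeroClosure 9 hs).zeros r hl.1)
  | cutY _ ih =>
    rintro ⟨s, hs, y, u, hy, hu, h1, h2, h3⟩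
    refine ih hl (DigitSat.of_le (S := S.map fun s => ⟨s.carry, 0, s.au⟩) ?_
      fun s hs => DigitState.le_foldl_insert (Or.inl hs))
    obtain rfl : y = 0 := by simpa using hy
    exact ⟨_, List.mem_map_of_mem hs, 0, u, hy, hu, by simp, h2, h3⟩
  | cutU _ ih =>
    rintro ⟨s, hs, y, u, hy, hu, h1, h2, h3⟩
    refine ih hl (DigitSat.of_le (S := S.map fun s => ⟨s.carry, s.ay, 0⟩) ?_
      fun s hs => DigitState.le_foldl_insert (Or.inl hs))
    obtain rfl : u = 0 := by simpa using hu
    exact ⟨_, List.mem_map_of_mem hs, y, 0, hy, hu, h1, by simp, h3⟩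

theorem DigitPath.false {α β N i j y u A B : ℕ} {l : List DigitInstr} (h : DigitPath l N i j)
    (hl : noSolution α β l [⟨0, A, B⟩] = true) (hy : y < 2 ^ i) (hu : u < 2 ^ j) (hA : nu y ≤ A)
    (hB : nu u ≤ B) (e : α * y + β * u = N) : False :=
  h.not_sat hl ⟨_, List.mem_singleton_self _, y, u, hy, hu, hA, hB, e⟩

/-- The digits of `N`, with marks where `y` and `u` end. -/
def topInstr : ℕ → ℕ → ℕ → ℕ → List DigitInstr
  | 0, _, _, _ => []
  | f + 1, 0, 0, N => .cutY :: .cutU :: .bit (N % 2) :: topInstr f 0 0 (N / 2)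
  | f + 1, 0, j + 1, N => .cutY :: .bit (N % 2) :: topInstr f 0 j (N / 2)
  | f + 1, i + 1, 0, N => .cutU :: .bit (N % 2) :: topInstr f i 0 (N / 2)
  | f + 1, i + 1, j + 1, N => .bit (N % 2) :: topInstr f i j (N / 2)

theorem DigitPath.topInstr {f : ℕ} (i j : ℕ) {N : ℕ} (h : N < 2 ^ f) :
    DigitPath (topInstr f i j N) N i j := by
  induction f generalizing i j N with
  | zero =>
    obtain rfl : N = 0 := by simpa using h
    exact .nil
  | succ f ih =>
    have h1 : N / 2 < 2 ^ f := by rw [pow_succ] at h; omega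
    have key : ∀ {l : List DigitInstr} {i j}, DigitPath l (N / 2) (i - 1) (j - 1) →
        DigitPath (.bit (N % 2) :: l) N i j := by
      intro l i j hl
      have := hl.bit (N % 2) (by omega)
      rwa [Nat.div_add_mod] at this
    cases i <;> cases j
    · exact .cutY (.cutU (key (ih 0 0 h1)))
    · exact .cutY (key (ih 0 _ h1))
    · exact .cutU (key (ih _ 0 h1))
    · exact key (ih _ _ h1)

theorem DigitPath.replicate {l : List DigitInstr} {N : ℕ} (r : ℕ) {i j : ℕ}
    (h : DigitPath l N (i - r) (j - r)) :
    DigitPath (List.replicate r (.bit 0) ++ l) (2 ^ r * N) i j := by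
  induction r generalizing i j with
  | zero => simpa using h
  | succ r ih =>
    have := (ih (i := i - 1) (j := j - 1) (by rwa [Nat.sub_sub, Nat.sub_sub, add_comm 1])).bit 0
      (by omega)
    rwa [add_zero, ← mul_assoc, ← pow_succ'] at this

theorem DigitPath.replicate_zeros {l : List DigitInstr} {N r r0 : ℕ} (hr : r0 ≤ r) {i j : ℕ}
    (h : DigitPath l N (i - r) (j - r)) :
    DigitPath (List.replicate r0 (.bit 0) ++ .zeros :: l) (2 ^ r * N) i j := by
  obtain ⟨d, rfl⟩ := Nat.exists_eq_add_of_le hr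
  rw [pow_add, mul_assoc]
  refine (DigitPath.zeros d ?_).replicate r0
  rwa [Nat.sub_sub, Nat.sub_sub]

/-- The instructions for a target that agrees with a Thurber number in the low digits: `wm` and `up`
describe the lower block of `m` zeros and the part above the block of `k ≥ k₀` zeros. -/
def thurberInstr (k₀ : ℕ) (wm up : List DigitInstr) : List DigitInstr :=
  .bit 1 :: (wm ++ .bit 1 :: .bit 1 :: (List.replicate k₀ (.bit 0) ++ .zeros :: up))

/-- Check that `α * y + β * u` has no solution for a target that agrees with a Thurber number with
`m = 1` and `k₀ ≤ k` in the low digits, and has the given digits at the top. -/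
def thurberCheckOne (k₀ α β A B cy cu top : ℕ) : Bool :=
  noSolution α β (thurberInstr k₀ (List.replicate 1 (.bit 0)) (topInstr 9 cy cu (top + 3)))
    [⟨0, A, B⟩]

/-- Check that `α * y + β * u` has no solution for a target that agrees with a Thurber number with
`2 ≤ m` in the low digits, and has the given digits at the top. -/
def thurberCheckTwo (α β A B cy cu top : ℕ) : Bool :=
  noSolution α β (thurberInstr 3 (List.replicate 2 (.bit 0))
    (topInstr 9 (cy + 1) (cu + 1) (2 * top + 3))) [⟨0, A, B⟩] &&
  (noSolution α β (thurberInstr 3 (List.replicate 3 (.bit 0))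
    (.bit 1 :: .bit 1 :: topInstr 9 cy cu top)) [⟨0, A, B⟩] &&
  (noSolution α β (thurberInstr 3 (List.replicate 4 (.bit 0))
    (.bit 1 :: .bit 1 :: .bit 0 :: topInstr 9 cy cu top)) [⟨0, A, B⟩] &&
  noSolution α β (thurberInstr 3 (List.replicate 5 (.bit 0) ++ [.zeros])
    (.bit 1 :: .bit 1 :: (List.replicate 2 (.bit 0) ++ .zeros :: topInstr 9 cy cu top)))
    [⟨0, A, B⟩]))

theorem digitPath_thurberInstr {wm up : List DigitInstr} {k₀ m k N i j : ℕ} (hk : k₀ ≤ k)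
    (hm : ∀ {l N i j}, DigitPath l N (i - m) (j - m) → DigitPath (wm ++ l) (2 ^ m * N) i j)
    (hup : DigitPath up N (i - (m + k + 3)) (j - (m + k + 3))) :
    DigitPath (thurberInstr k₀ wm up) (N * 2 ^ (m + k + 3) + (3 * 2 ^ (m + 1) + 1)) i j := by
  have e (i : ℕ) : i - (m + k + 3) = i - 1 - m - 1 - 1 - k := by omega
  rw [e i, e j] at hup
  have := (hm (((hup.replicate_zeros hk).bit 1 (by omega)).bit 1 (by omega))).bit 1 (by omega)
  rwa [show 2 * (2 ^ m * (2 * (2 * (2 ^ k * N) + 1) + 1)) + 1 =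
    N * 2 ^ (m + k + 3) + (3 * 2 ^ (m + 1) + 1) by ring] at this

/-- Above the block of `k` zeros the target reads `2 ^ (m - 1) * top + 3`. For `m ≥ 3` this is `11`,
then `m - 3` zeros, then `top`; for `m = 1` and `m = 2` the digits of `top` overlap with those of
`3`, hence the separate checks. For `m ≥ 5` the two blocks governed by `m` become independent
`zeros` instructions, which only enlarges the set of excluded targets. -/
theorem no_thurber_solution {k₀ α β A B cy cu top m k y u : ℕ}
    (hc : m = 1 → thurberCheckOne k₀ α β A B cy cu top = true)
    (hc' : m ≠ 1 → thurberCheckTwo α β A B cy cu top = true)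
    (htop : top < 2 ^ 7) (hm : 1 ≤ m) (hk : 3 ≤ k) (hk₀ : m = 1 → k₀ ≤ k)
    (hy : y < 2 ^ (2 * m + k + 2 + cy)) (hu : u < 2 ^ (2 * m + k + 2 + cu)) (hA : nu y ≤ A)
    (hB : nu u ≤ B) :
    α * y + β * u ≠ top * 2 ^ (2 * m + k + 2) + (3 * 2 ^ (m + k + 3) + (3 * 2 ^ (m + 1) + 1)) := by
  intro e
  have ei (c : ℕ) : 2 * m + k + 2 + c - (m + k + 3) = m - 1 + c := by omega
  have eN : top * 2 ^ (2 * m + k + 2) + (3 * 2 ^ (m + k + 3) + (3 * 2 ^ (m + 1) + 1)) =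
      (2 ^ (m - 1) * top + 3) * 2 ^ (m + k + 3) + (3 * 2 ^ (m + 1) + 1) := by
    rw [show 2 * m + k + 2 = m - 1 + (m + k + 3) by omega, pow_add]
    ring
  rw [eN] at e
  have fin : ∀ {k₀ : ℕ} {wm up : List DigitInstr}, k₀ ≤ k →
      noSolution α β (thurberInstr k₀ wm up) [⟨0, A, B⟩] = true →
      (∀ {l N i j}, DigitPath l N (i - m) (j - m) → DigitPath (wm ++ l) (2 ^ m * N) i j) →
      ¬ DigitPath up (2 ^ (m - 1) * top + 3) (m - 1 + cy) (m - 1 + cu) := by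
    intro k₀ wm up hk hs hwm hup
    rw [← ei, ← ei] at hup
    exact (digitPath_thurberInstr hk hwm hup).false hs hy hu hA hB e
  have fin' : ∀ {wm up : List DigitInstr}, 3 ≤ m →
      noSolution α β (thurberInstr 3 wm (.bit 1 :: .bit 1 :: up)) [⟨0, A, B⟩] = true →
      (∀ {l N i j}, DigitPath l N (i - m) (j - m) → DigitPath (wm ++ l) (2 ^ m * N) i j) →
      ¬ DigitPath up (2 ^ (m - 3) * top) (m - 3 + cy) (m - 3 + cu) := by
    intro wm up hm3 hs hwm hup
    refine fin hk hs hwm ?_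
    rw [show m - 3 + cy = m - 1 + cy - 1 - 1 by omega,
      show m - 3 + cu = m - 1 + cu - 1 - 1 by omega] at hup
    have := (hup.bit 1 (by omega)).bit 1 (by omega)
    rwa [show 2 * (2 * (2 ^ (m - 3) * top) + 1) + 1 = 2 ^ (m - 1) * top + 3 by
      rw [show m - 1 = m - 3 + 2 by omega, pow_add]; ring] at this
  have top9 : DigitPath (topInstr 9 cy cu top) top cy cu :=
    .topInstr _ _ (htop.trans (by norm_num))
  rcases Nat.eq_or_lt_of_le hm with rfl | hm2
  · refine fin (hk₀ rfl) (hc rfl) (.replicate 1) ?_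
    have := DigitPath.topInstr (f := 9) cy cu (N := top + 3) (by norm_num at htop ⊢; omega)
    simpa using this
  specialize hc' (by omega)
  simp only [thurberCheckTwo, Bool.and_eq_true] at hc'
  obtain ⟨h2, h3, h4, h5⟩ := hc'
  obtain rfl | rfl | rfl | hm5 : m = 2 ∨ m = 3 ∨ m = 4 ∨ 5 ≤ m := by omega
  · refine fin hk h2 (.replicate 2) ?_
    have := DigitPath.topInstr (f := 9) (cy + 1) (cu + 1) (N := 2 * top + 3)
      (by norm_num at htop ⊢; omega)
    simpa [add_comm 1] using this
  · refine fin' le_rfl h3 (.replicate 3) ?_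
    simpa using top9
  · refine fin' (by omega) h4 (.replicate 4) ?_
    exact DigitPath.replicate (l := topInstr 9 cy cu top) 1 (by simpa using top9)
  · refine fin' (by omega) h5 (fun {l N i j} h => ?_) (.replicate_zeros (by omega) ?_)
    · rw [List.append_assoc]
      exact .replicate_zeros hm5 h
    · rwa [Nat.add_sub_cancel_left, Nat.add_sub_cancel_left]

/-! ### Reduction of three small steps to three representations of the target -/

namespace TwoStep

variable {t L p q : ℕ} {B l : List ℕ}

theorem trunc (T : TwoStep t L p q B l) {j : ℕ} (htj : t ≤ j) (hj : j ≤ L) :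
    ∃ l', TwoStep t j p q B l' ∧ ∀ z, z ∈ l' ↔ z ∈ l ∧ z < 2 ^ (j + 1) := by
  obtain ⟨l', h1, h2⟩ := T.ext.trunc T.base_lt htj hj
  exact ⟨l', ⟨T.hB, T.hp, T.hq, T.low, T.high, h1⟩, h2⟩

theorem unique (T : TwoStep t L p q B l) {j y z : ℕ} (htj : t < j) (hy : y ∈ l) (hz : z ∈ l)
    (hy1 : 2 ^ j ≤ y) (hy2 : y < 2 ^ (j + 1)) (hz1 : 2 ^ j ≤ z) (hz2 : z < 2 ^ (j + 1)) : y = z :=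
  T.ext.unique T.base_lt htj hy hz hy1 hy2 hz1 hz2

theorem split (T : TwoStep t L p q B l) {j z : ℕ} (htj : t ≤ j) (hz : z ∈ l)
    (hz1 : 2 ^ (j + 1) ≤ z) (hz2 : z < 2 ^ (j + 2)) :
    ∃ v ∈ l, ∃ u ∈ l, z = v + u ∧ u ≤ v ∧ v < 2 ^ (j + 1) ∧ 2 ^ j ≤ v :=
  T.ext.split T.base_lt htj hz hz1 hz2

/-- One of the bounds by six ones for sums of four terms of level `t`, meant to contradict the seven
ones of the target. If `p + q` has four ones it equals `b + r`, and the sum becomes `4 * b + 3 * r`;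
otherwise a carry in `2 * (p + q) + (p + q + b)` loses a one. -/
theorem nu_three_w_add (T : TwoStep t L p q B l) {b : ℕ} (hb : b ∈ B) (hb1 : 2 ^ t ≤ b) :
    nu (3 * (p + q) + b) ≤ 6 := by
  have hb2 := T.hB.lt hb
  have hnb := T.hB.nu_le_two hb
  rcases Nat.lt_or_ge (nu (p + q)) 4 with h | h
  · have := T.low
    have := T.high
    have e : 2 ^ (t + 1) = 2 * 2 ^ t := by ring
    have e2 : 2 ^ (t + 1 + 1) = 4 * 2 ^ t := by ring
    have h1 := nu_add_carry' (z := 2 * (p + q)) (u := p + q + b) (t + 1) 0 (t + 1) rfl (by omega)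
      (by omega) (by omega)
    have := T.nu_w_add hb hb1
    rw [nu_two_mul, show 2 * (p + q) + (p + q + b) = 3 * (p + q) + b by ring] at h1
    omega
  · obtain ⟨r, hr, h1, -, -⟩ := T.exists_compat h hb hb1
    have h2 := nu_add_le (2 ^ 2 * b) (3 * r)
    have h3 := nu_mul_le 3 r
    have h4 := T.hB.nu_le_two hr
    rw [nu_two_pow_mul] at h2
    rw [show nu 3 = 2 by norm_num [nu]] at h3
    rw [h1, show 3 * (b + r) + b = 2 ^ 2 * b + 3 * r by ring]
    omega

end TwoStep

/-- Two of three terms of the same level of a chain with at most one small step agree. -/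
theorem Ch.two_eq {L t x y z : ℕ} {l : List ℕ} (h : Ch 1 L l) (hx : x ∈ l) (hy : y ∈ l) (hz : z ∈ l)
    (hx1 : 2 ^ t ≤ x) (hx2 : x < 2 ^ (t + 1)) (hy1 : 2 ^ t ≤ y) (hy2 : y < 2 ^ (t + 1))
    (hz1 : 2 ^ t ≤ z) (hz2 : z < 2 ^ (t + 1)) : x = y ∨ x = z ∨ y = z := by
  rcases lt_trichotomy x y with hxy | hxy | hxy
  · obtain ⟨-, -, -, -, -, h1⟩ := h.level_pair hx hy hx1 hxy hy2
    have := h1 z hz hz1 hz2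
    omega
  · exact Or.inl hxy
  · obtain ⟨-, -, -, -, -, h1⟩ := h.level_pair hy hx hy1 hxy hx2
    have := h1 z hz hz1 hz2
    omega

theorem Ch.nu_add_le_two {t x y : ℕ} {l : List ℕ} (h : Ch 1 t l) (hx : x ∈ l) (hy : y ∈ l)
    (hxy : 2 ^ (t + 1) ≤ x + y) : nu (x + y) ≤ 2 :=
  (h.big hx hy hxy).nu_le_two List.mem_cons_self

namespace TwoStep

variable {t L p q : ℕ} {B l : List ℕ}

theorem nu_two_w_add (T : TwoStep t L p q B l) {b c : ℕ} (hb : b ∈ B) (hb1 : 2 ^ t ≤ b)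
    (hc : c ∈ B) (hc1 : 2 ^ t ≤ c) : nu (2 * (p + q) + (b + c)) ≤ 6 := by
  have h1 := nu_add_le (2 * (p + q)) (b + c)
  have h2 := T.hB.nu_add_le_two hb hc (by rw [pow_succ]; omega)
  have h3 := T.nu_w
  rw [nu_two_mul] at h1
  omega

theorem nu_w_add_three (T : TwoStep t L p q B l) {b c d : ℕ} (hb : b ∈ B) (hb1 : 2 ^ t ≤ b)
    (hc : c ∈ B) (hc1 : 2 ^ t ≤ c) (hd : d ∈ B) (hd1 : 2 ^ t ≤ d) :
    nu (p + q + (b + c + d)) ≤ 6 := by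
  have key : ∀ {b c : ℕ}, b ∈ B → 2 ^ t ≤ b → c ∈ B → 2 ^ t ≤ c → nu (p + q + b + 2 * c) ≤ 6 := by
    intro b c hb hb1 hc hc1
    have h1 := nu_add_le (p + q + b) (2 * c)
    have h2 := T.nu_w_add hb hb1
    have h3 := T.hB.nu_le_two hc
    rw [nu_two_mul] at h1
    omega
  rcases T.hB.two_eq hb hc hd hb1 (T.hB.lt hb) hc1 (T.hB.lt hc) hd1 (T.hB.lt hd) with rfl | rfl | rfl
  · rw [show p + q + (b + b + d) = p + q + d + 2 * b by ring]
    exact key hd hd1 hb hb1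
  · rw [show p + q + (b + c + b) = p + q + c + 2 * b by ring]
    exact key hc hc1 hb hb1
  · rw [show p + q + (b + c + c) = p + q + b + 2 * c by ring]
    exact key hb hb1 hc hc1

theorem nu_four_sum (T : TwoStep t L p q B l) {x y z r : ℕ} (hx : x ∈ l) (hy : y ∈ l) (hz : z ∈ l)
    (hr : r ∈ l) (hx1 : 2 ^ t ≤ x) (hx2 : x < 2 ^ (t + 1)) (hy1 : 2 ^ t ≤ y) (hy2 : y < 2 ^ (t + 1))
    (hz1 : 2 ^ t ≤ z) (hz2 : z < 2 ^ (t + 1)) (hr1 : 2 ^ t ≤ r) (hr2 : r < 2 ^ (t + 1))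
    (hodd : (x + y + z + r) % 2 = 1) : nu (x + y + z + r) ≤ 6 := by
  rcases T.base_cases hx hx2 with rfl | hxB <;> rcases T.base_cases hy hy2 with rfl | hyB <;>
    rcases T.base_cases hz hz2 with rfl | hzB <;> rcases T.base_cases hr hr2 with rfl | hrB
  · omega
  · convert T.nu_three_w_add hrB hr1 using 2; ring
  · convert T.nu_three_w_add hzB hz1 using 2; ring
  · convert T.nu_two_w_add hzB hz1 hrB hr1 using 2; ring
  · convert T.nu_three_w_add hyB hy1 using 2; ring
  · convert T.nu_two_w_add hyB hy1 hrB hr1 using 2; ring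
  · convert T.nu_two_w_add hyB hy1 hzB hz1 using 2; ring
  · convert T.nu_w_add_three hyB hy1 hzB hz1 hrB hr1 using 2; ring
  · convert T.nu_three_w_add hxB hx1 using 2; ring
  · convert T.nu_two_w_add hxB hx1 hrB hr1 using 2; ring
  · convert T.nu_two_w_add hxB hx1 hzB hz1 using 2; ring
  · convert T.nu_w_add_three hxB hx1 hzB hz1 hrB hr1 using 2; ring
  · convert T.nu_two_w_add hxB hx1 hyB hy1 using 2; ring
  · convert T.nu_w_add_three hxB hx1 hyB hy1 hrB hr1 using 2; ring
  · convert T.nu_w_add_three hxB hx1 hyB hy1 hzB hz1 using 2; ring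
  · have h1 := T.hB.nu_add_le_two hxB hyB (by rw [pow_succ]; omega)
    have h2 := T.hB.nu_add_le_two hzB hrB (by rw [pow_succ]; omega)
    have h3 := nu_add_le (x + y) (z + r)
    rw [← add_assoc] at h3
    omega

end TwoStep

/-- The properties of the target number of level `E` that restrict the last steps of a chain. -/
structure Target (n E : ℕ) : Prop where
  low : 5 * 2 ^ E ≤ 4 * n
  high : 8 * n < 11 * 2 ^ E
  mod_four : n % 4 = 1
  nu_eq : nu n = 7

/-- `n` is a sum of two terms of a chain with two small steps, one of them at level `E`. -/
def IsTopSum (n E : ℕ) : Prop :=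
  ∃ V x y, Ch 2 E V ∧ x ∈ V ∧ y ∈ V ∧ 2 ^ E ≤ x ∧ n = x + y

/-- `n = 3 * X + 2 * q` for terms of a chain with two small steps, where `X` has level `e` and `q`
is lower. -/
def IsThreeTwoSum (n e : ℕ) : Prop :=
  ∃ V L X q, Ch 2 L V ∧ X ∈ V ∧ q ∈ V ∧ 2 ^ e ≤ X ∧ X < 2 ^ (e + 1) ∧ q < 2 ^ e ∧ n = 3 * X + 2 * q

/-- `n = 3 * (x + y)` for terms of a chain with two small steps. -/
def IsTripleSum (n : ℕ) : Prop :=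
  ∃ V L x y, Ch 2 L V ∧ x ∈ V ∧ y ∈ V ∧ n = 3 * (x + y)

namespace Target

variable {n E t : ℕ} {V : List ℕ}

theorem not_mem (H : Target n E) {L : ℕ} {l : List ℕ} (h : Ch 2 L l) : n ∉ l := by
  intro hn
  have := h.nu_le_four hn
  rw [H.nu_eq] at this
  omega

/-- Since `z < 2 ^ (t + 1)`, both `x + y` and `x + y + z` gain a level, so they cost no small step.
-/
theorem _root_.Ch.isTopSum_of_four (h : Ch 2 t V) {x y z r : ℕ} (hx : x ∈ V)
    (hy : y ∈ V) (hz : z ∈ V) (hr : r ∈ V) (hn : n = x + y + z + r)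
    (hxyz : 2 ^ (t + 2) ≤ x + y + z) : IsTopSum n (t + 2) := by
  have := h.lt hz
  have e : 2 ^ (t + 2) = 2 * 2 ^ (t + 1) := by ring
  have h1 := h.big hx hy (by omega)
  have h2 := h1.big (a := x + y) (b := z) (by simp) (by simp [hz]) hxyz
  exact ⟨_, x + y + z, r, h2, by simp, by simp [hr], hxyz, hn⟩

/-- Let `x` be the largest term. If `x + y` gains a level, it is the required summand; if `x` is
below level `t`, the whole sum is formed without a third small step. Otherwise `y` and `z` are
lower. When `x = v + u` comes from above the last small step, three of `v, u, y, z` supply the top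
summand, or all four share one level; then they coincide, contradicting `n % 4 = 1`, or
`nu_four_sum` applies. When `x` is at the level of that small step, `y + z` has at most two ones and
`n` at most six. -/
theorem isTopSum_of_three (H : Target n (t + 1)) (h : Ch 2 t V) {x y z : ℕ} (hx : x ∈ V)
    (hy : y ∈ V) (hz : z ∈ V) (hn : n = x + y + z) : IsTopSum n (t + 1) := by
  wlog hxy : y ≤ x ∧ z ≤ y generalizing x y z
  · rcases Nat.le_total y x with h1 | h1 <;> rcases Nat.le_total z y with h2 | h2 <;>
      rcases Nat.le_total z x with h3 | h3
    · exact this hx hy hz (by omega) (by omega)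
    · exact this hx hy hz (by omega) (by omega)
    · exact this hx hz hy (by omega) (by omega)
    · exact this hz hx hy (by omega) (by omega)
    · exact this hy hx hz (by omega) (by omega)
    · exact this hy hz hx (by omega) (by omega)
    · exact this hz hy hx (by omega) (by omega)
    · exact this hz hy hx (by omega) (by omega)
  obtain ⟨hxy, hyz⟩ := hxy
  have H1 := H.low
  have H2 := H.high
  have H3 := H.mod_four
  have H4 := H.nu_eq
  have e : 2 ^ (t + 1) = 2 * 2 ^ t := by ring
  have pos := Nat.two_pow_pos t
  rcases Nat.lt_or_ge (x + y) (2 ^ (t + 1)) with hsum | hsum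
  swap
  · exact ⟨_, x + y, z, h.big hx hy hsum, by simp, by simp [hz], hsum, hn⟩
  obtain ⟨s, rfl⟩ : ∃ s, t = s + 1 := by
    cases t with
    | zero => simp at H1 H2; omega
    | succ s => exact ⟨s, rfl⟩
  have e' : 2 ^ (s + 1) = 2 * 2 ^ s := by ring
  have htr := h.trunc (j := s) (by omega)
  rcases Nat.lt_or_ge x (2 ^ (s + 1)) with hx1 | hx1
  · exfalso
    obtain ⟨V', h', hV'⟩ := htr
    have h1 := h'.big ((hV' x).2 ⟨hx, hx1⟩) ((hV' y).2 ⟨hy, by omega⟩) (by omega)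
    have h2 := h1.big (a := x + y) (b := z) (by simp)
      (List.mem_cons_of_mem _ ((hV' z).2 ⟨hz, by omega⟩)) (by omega)
    exact H.not_mem h2 (by simp [hn])
  rcases h.two_cases with hc | ⟨t0, p, q, B, T⟩
  · have h1 := hc.nu_le_two hx
    have h2 := hc.nu_le_two hy
    have h3 := hc.nu_le_two hz
    have h4 := nu_add_le (x + y) z
    have h5 := nu_add_le x y
    rw [← hn] at h4
    omega
  rcases Nat.lt_or_ge t0 (s + 1) with hlt | hge
  · obtain ⟨v, hv, u, hu, rfl, huv, hv2, hv1⟩ := T.split (j := s) (by omega) hx hx1 (T.ch.lt hx)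
    obtain ⟨V', T', hV'⟩ := T.trunc (j := s) (by omega) (by omega)
    have hv' := (hV' v).2 ⟨hv, hv2⟩
    have hu' := (hV' u).2 ⟨hu, by omega⟩
    have hy' := (hV' y).2 ⟨hy, by omega⟩
    have hz' := (hV' z).2 ⟨hz, by omega⟩
    have e2 : 2 ^ (s + 2) = 4 * 2 ^ s := by ring
    by_cases c1 : 2 ^ (s + 2) ≤ v + u + y
    · exact T'.ch.isTopSum_of_four hv' hu' hy' hz' (by omega) c1
    by_cases c2 : 2 ^ (s + 2) ≤ v + u + z
    · exact T'.ch.isTopSum_of_four hv' hu' hz' hy' (by omega) c2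
    by_cases c3 : 2 ^ (s + 2) ≤ v + y + z
    · exact T'.ch.isTopSum_of_four hv' hy' hz' hu' (by omega) c3
    by_cases c4 : 2 ^ (s + 2) ≤ u + y + z
    · exact T'.ch.isTopSum_of_four hu' hy' hz' hv' (by omega) c4
    exfalso
    rw [show s + 1 + 1 = s + 2 by omega] at *
    rcases Nat.lt_or_ge t0 s with hlt' | hge
    · have a1 := T'.unique hlt' hv' hu' (by omega) (by omega) (by omega) (by omega)
      have a2 := T'.unique hlt' hv' hy' (by omega) (by omega) (by omega) (by omega)
      have a3 := T'.unique hlt' hv' hz' (by omega) (by omega) (by omega) (by omega)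
      omega
    · obtain rfl : t0 = s := by omega
      have := T'.nu_four_sum hv' hu' hy' hz' (by omega) (by omega) (by omega) (by omega) (by omega)
        (by omega) (by omega) (by omega) (by omega)
      rw [← hn] at this
      omega
  · exfalso
    obtain rfl : t0 = s + 1 := by
      have := T.ext.le
      omega
    have hw := T.low
    have hyB := (T.base_cases hy (by omega)).resolve_left (by omega)
    have hzB := (T.base_cases hz (by omega)).resolve_left (by omega)
    obtain ⟨B', h', hB'⟩ := T.hB.trunc (j := s) (by omega)
    have h1 := h'.nu_add_le_two ((hB' y).2 ⟨hyB, by omega⟩) ((hB' z).2 ⟨hzB, by omega⟩) (by omega)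
    have h2 := nu_add_le x (y + z)
    have h3 := T.nu_le_four hx
    rw [← add_assoc, ← hn] at h2
    omega

/-- The carry in `2 * (p + q) + X` loses two ones, so `p + q` and `X` need nine together, which
excludes a last small step at level `t`. Below that level, either `p = X`, or `p` and `q` are lower
than `X = v + u`, and then `p + q`, its double and the sum with `v` each gain a level. -/
theorem of_two_mul_add (H : Target n (t + 2)) (h : Ch 2 t V) {p q X : ℕ} (hp : p ∈ V) (hq : q ∈ V)
    (hX : X ∈ V) (hX1 : 2 ^ t ≤ X) (hw1 : 2 ^ t ≤ p + q) (hw2 : p + q < 2 ^ (t + 1))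
    (hn : n = 2 * (p + q) + X) : IsTopSum n (t + 2) ∨ IsThreeTwoSum n t := by
  wlog hqp : q ≤ p generalizing p q
  · exact this hq hp (by omega) (by omega) (by omega) (by omega)
  have H1 := H.low
  have H2 := H.high
  have H4 := H.nu_eq
  have e : 2 ^ (t + 1) = 2 * 2 ^ t := by ring
  have e2 : 2 ^ (t + 2) = 4 * 2 ^ t := by ring
  have pos := Nat.two_pow_pos t
  have hX2 := h.lt hX
  have hcarry := nu_add_carry' (z := 2 * (p + q)) (u := X) t 1 (t + 1) rfl (by omega) hX2
    (by omega)
  rw [nu_two_mul, ← hn] at hcarry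
  have hpq := nu_add_le p q
  rcases h.two_cases with hc | ⟨t0, p', q', B, T⟩
  · have h1 := hc.nu_le_two hp
    have h2 := hc.nu_le_two hq
    have h3 := hc.nu_le_two hX
    omega
  have nX := T.nu_le_four hX
  by_cases hpX : p = X
  · exact Or.inr ⟨V, t, p, q, h, hp, hq, by omega, by omega, by omega, by omega⟩
  rcases Nat.lt_or_ge t0 t with hlt | hge
  · obtain ⟨s, rfl⟩ : ∃ s, t = s + 1 := ⟨t - 1, by omega⟩
    have hp1 : p < 2 ^ (s + 1) := by
      by_contra hcon
      exact hpX (T.unique hlt hp hX (by omega) (by omega) hX1 hX2)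
    obtain ⟨v, hv, u, hu, rfl, huv, hv2, hv1⟩ := T.split (j := s) (by omega) hX hX1 hX2
    obtain ⟨V', h', hV'⟩ := h.trunc (j := s) (by omega)
    have h1 := h'.big ((hV' p).2 ⟨hp, hp1⟩) ((hV' q).2 ⟨hq, by omega⟩) hw1
    have h2 := h1.big (a := p + q) (b := p + q) (by simp) (by simp) (by omega)
    have h3 := h2.big (a := p + q + (p + q)) (b := v) (by simp) (by simp [hV', hv, hv2]) (by omega)
    have hu2 : u < 2 ^ (s + 1) := by omega
    exact Or.inl ⟨_, p + q + (p + q) + v, u, h3, by simp, by simp [hV', hu, hu2],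
      by omega, by omega⟩
  · exfalso
    obtain rfl : t0 = t := by
      have := T.ext.le
      omega
    have hw := T.low
    have hqB := (T.base_cases hq (by omega)).resolve_left (by omega)
    have n1 := T.hB.nu_le_two hqB
    have n2 := T.nu_le_four hp
    rcases T.base_cases hX hX2 with rfl | hXB
    · have hpB := (T.base_cases hp (by omega)).resolve_left hpX
      have := T.hB.nu_le_two hpB
      omega
    · have := T.hB.nu_le_two hXB
      omega

/-- The chain is cut at its third small step `p + q`. As `n` is odd, every power of two in
`BigExt.structure` is trivial, so `n` is `a + b`, `a + b + c` or `3 * (a + b)` with entries from `V`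
and `p + q`. If none of them is `p + q`, then `n` needs only two small steps; the other cases are
regrouped so that the third small step is not needed for the terms that are named. -/
theorem cases (H : Target n E) {l : List ℕ} (h : Ch 3 E l) (hn : n ∈ l) :
    IsTopSum n E ∨ (∃ e, E = e + 2 ∧ IsThreeTwoSum n e) ∨ IsTripleSum n := by
  have H1 := H.low
  have H2 := H.high
  have H3 := H.mod_four
  rcases h.decomp (by omega) with h | ⟨t, V, p, q, hV, hp, hq, hw1, hw2, hext⟩
  · exact absurd hn (H.not_mem h)
  have hb : ∀ y ∈ (p + q) :: V, y < 2 ^ (t + 1) := List.forall_mem_cons.2 ⟨hw2, fun _ => hV.lt⟩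
  have e : 2 ^ (t + 1) = 2 * 2 ^ t := by ring
  have pos := Nat.two_pow_pos t
  rcases Nat.eq_or_lt_of_le hext.le with rfl | hlt
  · rcases List.mem_cons.1 (hext.mem_base hn (by omega)) with hw | hn'
    · left
      suffices key : ∀ {p q}, p ∈ V → q ∈ V → n = p + q → 2 ^ t ≤ p + q → q ≤ p →
          IsTopSum n t by
        rcases Nat.le_total q p with hqp | hqp
        · exact key hp hq hw hw1 hqp
        · exact key hq hp (by omega) (by omega) hqp
      clear hw hw1 hw2 hp hq hext hb
      intro p q hp hq hw hw1 hqp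
      rcases Nat.lt_or_ge p (2 ^ t) with hpt | hpt
      · exfalso
        obtain ⟨s, rfl⟩ : ∃ s, t = s + 1 := by
          cases t with
          | zero => simp at H1 H2; omega
          | succ s => exact ⟨s, rfl⟩
        obtain ⟨V', h', hV'⟩ := hV.trunc (j := s) (by omega)
        exact H.not_mem (h'.big ((hV' p).2 ⟨hp, hpt⟩) ((hV' q).2 ⟨hq, by omega⟩) hw1) (by simp [hw])
      · exact ⟨V, p, q, hV, hp, hq, hpt, hw⟩
    · exact absurd hn' (H.not_mem hV)
  obtain ⟨f, rfl⟩ := Nat.exists_eq_add_of_lt hlt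
  have even : ∀ {e x : ℕ}, n = 2 ^ e * x → e = 0 := by
    rintro e x rfl
    by_contra he
    obtain ⟨d, rfl⟩ : ∃ d, e = d + 1 := ⟨e - 1, by omega⟩
    rw [pow_succ, mul_assoc, mul_left_comm] at H3
    omega
  have ef : 2 ^ (t + f + 1) = 2 ^ (t + 1 + f) := by ring
  have ef2 : 2 ^ (t + 2 + f) = 2 * 2 ^ (t + 1 + f) := by ring
  rw [ef] at H1 H2
  rcases hext.structure hb hn (f := f) H1 (by omega) with
    ⟨a, ha, b, hb', ha1, hba, hab, hn', -⟩ |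
    ⟨a, ha, b, hb', c, hc, ha1, hb1, hc1, habc, e, rfl, hn', -⟩ |
    ⟨a, ha, b, hb', ha1, hba, hab, e, rfl, hn', -⟩
  · obtain rfl := even hn'
    rw [pow_zero, one_mul] at hn'
    rw [add_zero] at H ⊢
    left
    rcases List.mem_cons.1 ha with rfl | haV <;> rcases List.mem_cons.1 hb' with rfl | hbV
    · omega
    · exact H.isTopSum_of_three hV hp hq hbV hn'
    · exact H.isTopSum_of_three hV hp hq haV (by omega)
    · exact absurd (by simp [hn']) (H.not_mem (hV.big haV hbV hab))
  · obtain rfl := even hn'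
    rw [pow_zero, one_mul] at hn'
    rw [show t + (0 + 1) + 1 = t + 2 by ring] at H ⊢
    have e4 : 2 ^ (t + 1 + 1) = 4 * 2 ^ t := by ring
    have two : ∀ {X}, X ∈ V → 2 ^ t ≤ X → n = 2 * (p + q) + X →
        IsTopSum n (t + 2) ∨ (∃ e, t + 2 = e + 2 ∧ IsThreeTwoSum n e) ∨ IsTripleSum n := by
      intro X hX hX1 e
      rcases H.of_two_mul_add hV hp hq hX hX1 hw1 hw2 e with h | h
      · exact Or.inl h
      · exact Or.inr (Or.inl ⟨t, rfl, h⟩)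
    have one : ∀ {X Y}, X ∈ V → Y ∈ V → 2 ^ t ≤ X → 2 ^ t ≤ Y → n = p + q + X + Y →
        IsTopSum n (t + 2) ∨ (∃ e, t + 2 = e + 2 ∧ IsThreeTwoSum n e) ∨ IsTripleSum n := by
      intro X Y hX hY hX1 hY1 e
      left
      rcases Nat.le_total q p with hqp | hqp
      · exact hV.isTopSum_of_four hX hY hp hq (by omega) (by rw [pow_add]; omega)
      · exact hV.isTopSum_of_four hX hY hq hp (by omega) (by rw [pow_add]; omega)
    rcases List.mem_cons.1 ha with rfl | haV <;> rcases List.mem_cons.1 hb' with rfl | hbV <;>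
      rcases List.mem_cons.1 hc with rfl | hcV
    · exact Or.inr (Or.inr ⟨V, t, p, q, hV, hp, hq, by omega⟩)
    · exact two hcV hc1 (by omega)
    · exact two hbV hb1 (by omega)
    · exact one hbV hcV hb1 hc1 (by omega)
    · exact two haV ha1 (by omega)
    · exact one haV hcV ha1 hc1 (by omega)
    · exact one haV hbV ha1 hb1 (by omega)
    · have h1 := hV.big haV hbV (by omega)
      have h2 := h1.big (a := a + b) (b := c) (by simp) (by simp [hcV]) (by omega)
      exact absurd (by simp [hn']) (H.not_mem h2)
  · obtain rfl := even hn'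
    rw [pow_zero, one_mul] at hn'
    have e4 : 2 ^ (t + 1 + 1) = 4 * 2 ^ t := by ring
    have e8 : 2 ^ (t + 1 + 1 + 1) = 8 * 2 ^ t := by ring
    right
    right
    have one : ∀ {X}, X ∈ V → 10 * 2 ^ t ≤ 3 * (p + q + X) → n = 3 * (p + q + X) →
        IsTripleSum n := by
      intro X hX h1 h2
      rcases Nat.le_total q p with hqp | hqp
      · have h1 := hV.big hX hp (by omega)
        exact ⟨_, _, X + p, q, h1, by simp, by simp [hq], by omega⟩
      · have h1 := hV.big hX hq (by omega)
        exact ⟨_, _, X + q, p, h1, by simp, by simp [hp], by omega⟩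
    rcases List.mem_cons.1 ha with rfl | haV <;> rcases List.mem_cons.1 hb' with rfl | hbV
    · omega
    · exact one hbV hab hn'
    · exact one haV (by omega) (by omega)
    · exfalso
      have h1 := hV.big haV hbV (by omega)
      have h2 := h1.big (a := a + b) (b := a + b) (by simp) (by simp) (by omega)
      have h3 := h2.big (a := a + b + (a + b)) (b := a + b) (by simp) (by simp) (by omega)
      refine H.not_mem h3 ?_
      rw [hn']
      simp only [List.mem_cons]
      omega

end Target

/-! ### The Thurber numbers as targets, and the representation `3 * X + 2 * q` -/

/-- With `S = 2 ^ (2 * m + k + 2)` the number is `40 * S` plus its lower blocks. Known leading ones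
of the unknowns are moved into `off * S`, which lowers the budgets `A` and `B` of ones left to the
automaton. -/
theorem thurber_ne {m k : ℕ} (hm : 1 ≤ m) (hk : 3 ≤ k) {α β A B cy cu : ℕ} (off : ℕ)
    (hc : (thurberCheckOne 3 α β A B cy cu (40 - off) &&
      thurberCheckTwo α β A B cy cu (40 - off)) = true) (hoff : off ≤ 40) {y u : ℕ}
    (hy : y < 2 ^ cy * 2 ^ (2 * m + k + 2)) (hu : u < 2 ^ cu * 2 ^ (2 * m + k + 2))
    (hA : nu y ≤ A) (hB : nu u ≤ B) :
    α * y + β * u + off * 2 ^ (2 * m + k + 2) ≠ thurberNumber m k := by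
  intro e
  rw [Bool.and_eq_true] at hc
  rw [← pow_add, add_comm cy] at hy
  rw [← pow_add, add_comm cu] at hu
  refine no_thurber_solution (fun _ => hc.1) (fun _ => hc.2) (by norm_num; omega) hm hk
    (fun _ => hk) hy hu hA hB (Nat.add_right_cancel (e.trans ?_))
  have e1 : (40 - off) * 2 ^ (2 * m + k + 2) + off * 2 ^ (2 * m + k + 2) =
      40 * 2 ^ (2 * m + k + 2) := by
    rw [← add_mul, Nat.sub_add_cancel hoff]
  have e2 : thurberNumber m k = 40 * 2 ^ (2 * m + k + 2) +
      (3 * 2 ^ (m + k + 3) + (3 * 2 ^ (m + 1) + 1)) := by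
    rw [thurberNumber]
    ring
  rw [e2, ← e1]
  ring

theorem thurberNumber_target {m k : ℕ} (hm : 1 ≤ m) (hk : 3 ≤ k) :
    Target (thurberNumber m k) (2 * m + k + 7) := by
  have e : thurberNumber m k = 5 * 2 ^ (2 * m + k + 5) + 3 * 2 ^ (m + k + 3) + 3 * 2 ^ (m + 1) + 1 := by
    rw [thurberNumber]
    ring
  have e1 : 2 ^ (2 * m + k + 7) = 4 * 2 ^ (2 * m + k + 5) := by ring
  have e2 : 2 ^ (m + k + 3 + 3) = 8 * 2 ^ (m + k + 3) := by ring
  have h1 := two_pow_le (show m + k + 3 + 3 ≤ 2 * m + k + 5 by omega)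
  have h2 := two_pow_le (show (m + 1) + 3 ≤ m + k + 3 by omega)
  have e4 : 2 ^ (m + 1 + 3) = 8 * 2 ^ (m + 1) := by ring
  have h3 := Nat.two_pow_pos (m + 1)
  refine ⟨by omega, by omega, ?_, ?_⟩
  · have f1 : 2 ^ (m + 1) = 4 * 2 ^ (m - 1) := by
      rw [show m + 1 = m - 1 + 2 by omega, pow_add]
      ring
    have f3 : 2 ^ (2 * m + k + 5) = 4 * 2 ^ (2 * m + k + 3) := by ring
    have f2 : 2 ^ (m + k + 3) = 4 * 2 ^ (m + k + 1) := by ring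
    omega
  · have b1 : 3 * 2 ^ (m + 1) + 1 < 2 ^ (m + k + 3) := by omega
    have b2 : 3 < 2 ^ (m + 2) := by
      have := two_pow_le (show 2 ≤ m + 2 by omega)
      omega
    have b3 : 1 < 2 ^ (m + 1) := Nat.one_lt_two_pow (by omega)
    have a1 := nu_two_pow_mul_add (5 * 2 ^ (m + 2) + 3) b1
    have a2 := nu_two_pow_mul_add 5 b2
    have a3 := nu_two_pow_mul_add 3 b3
    rw [mul_comm] at a1 a2 a3
    rw [thurberNumber, a1, a2, a3]
    norm_num [nu]

namespace TwoStep

variable {t L p q : ℕ} {B l : List ℕ}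

/-- A value of `p + q` of at least `5 / 3` of the power of two below it. -/
theorem eq_of_five_le (T : TwoStep t L p q B l) (h : 5 * 2 ^ t ≤ 3 * (p + q)) :
    ∃ r, p + q = 7 * 2 ^ r ∨ p + q = 15 * 2 ^ r ∨ p + q = 27 * 2 ^ r := by
  have hh := T.high
  have hl := T.low
  have e : 2 ^ (t + 1) = 2 * 2 ^ t := by ring
  have hpos := Nat.two_pow_pos t
  rcases Nat.lt_or_ge (nu (p + q)) 4 with h4 | h4
  swap
  · obtain ⟨a, b, hab, hc⟩ := T.compat_w h4
    rw [hab] at h hh ⊢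
    exact hc.eq_of_le h (by omega)
  generalize p + q = w at *
  have p1 := nu_pos (show 0 < w by omega)
  obtain ⟨k, r, rfl, hr, e1⟩ := exists_two_pow_add (show 0 < w by omega)
  obtain rfl : k = t := by
    have h1 := lt_of_two_pow_le_of_lt hl (show 2 ^ k + r < 2 ^ (k + 1) by rw [pow_succ]; omega)
    have h2 := lt_of_two_pow_le_of_lt (Nat.le_add_right _ r) hh
    omega
  obtain ⟨i, r', rfl, hr', e2⟩ := exists_two_pow_add (show 0 < r by omega)
  have hi := lt_of_two_pow_le_of_lt (Nat.le_add_right _ r') hr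
  have hi2 : k < i + 2 := by
    by_contra hcon
    have := two_pow_le (show i + 2 ≤ k by omega)
    rw [pow_add] at this
    omega
  obtain rfl : k = i + 1 := by omega
  have e3 : 2 ^ (i + 1) = 2 * 2 ^ i := by ring
  obtain ⟨j, r'', rfl, hr'', e4⟩ := exists_two_pow_add (show 0 < r' by omega)
  obtain rfl : r'' = 0 := by
    by_contra hcon
    have := nu_pos (Nat.pos_of_ne_zero hcon)
    omega
  have hj := lt_of_two_pow_le_of_lt (Nat.le_add_right _ 0) hr'
  have hj2 : i < j + 2 := by
    by_contra hcon
    have := two_pow_le (show j + 2 ≤ i by omega)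
    rw [pow_add] at this
    omega
  obtain rfl : i = j + 1 := by omega
  exact ⟨j, Or.inl (by ring)⟩

/-- The only candidates are `7`, `15` and `27` times a power of two, and an odd one has level at
most `4`. -/
theorem w_even_of_five_le (T : TwoStep t L p q B l) (h : 5 * 2 ^ t ≤ 3 * (p + q)) (ht : 5 ≤ t) :
    (p + q) % 2 = 0 := by
  obtain ⟨r, hr⟩ := T.eq_of_five_le h
  have hl := T.low
  have : 0 < r := by
    by_contra hcon
    obtain rfl : r = 0 := by omega
    have := two_pow_le ht
    omega
  obtain ⟨s, rfl⟩ : ∃ s, r = s + 1 := ⟨r - 1, by omega⟩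
  rw [pow_succ] at hr
  omega

/-- An element of level above `t + 1` in the upper half of its level is twice another element. -/
theorem exists_half (T : TwoStep t L p q B l) {j z : ℕ} (htj : t < j) (hz : z ∈ l)
    (hz1 : 3 * 2 ^ j ≤ z) (hz2 : z < 2 ^ (j + 2)) :
    ∃ v ∈ l, z = 2 * v := by
  have e : 2 ^ (j + 1) = 2 * 2 ^ j := by ring
  have e2 : 2 ^ (j + 2) = 4 * 2 ^ j := by ring
  obtain ⟨v, hv, u, hu, rfl, huv, hv2, hv1⟩ := T.split htj.le hz (by omega) hz2
  obtain rfl := T.unique htj hu hv (by omega) (by omega) hv1 hv2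
  exact ⟨u, hv, by omega⟩

end TwoStep

theorem Ch.le_of_odd {L t b : ℕ} {l : List ℕ} (h : Ch 1 L l) (hb : b ∈ l)
    (hodd : b % 2 = 1) (hb2 : b < 2 ^ (t + 1)) : b ≤ 2 ^ t + 1 := by
  have even : ∀ {i x : ℕ}, 2 ^ i * x % 2 = 1 → i = 0 := by
    intro i x hx
    by_contra hcon
    obtain ⟨s, rfl⟩ : ∃ s, i = s + 1 := ⟨i - 1, by omega⟩
    rw [pow_succ, mul_assoc, mul_left_comm] at hx
    omega
  have h1 := Nat.two_pow_pos t
  rcases h.shape hb with ⟨i, rfl⟩ | ⟨j, g, hg, rfl⟩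
  · obtain rfl := even (i := i) (x := 1) (by simpa using hodd)
    omega
  · obtain rfl := even hodd
    have := lt_of_two_pow_le_of_lt (i := g) (x := 2 ^ 0 * (2 ^ g + 1)) (by omega) hb2
    have := two_pow_le (show g ≤ t by omega)
    omega

/-- An odd element with at least three digits in the upper three quarters of its level. -/
theorem TwoStep.exists_eq_w_add {t L p q e X : ℕ} {B l : List ℕ} (T : TwoStep t L p q B l)
    (hX : X ∈ l) (hodd : X % 2 = 1) (hnu : 3 ≤ nu X) (hte : t < e) (he : 8 ≤ e)
    (hX1 : 5 * 2 ^ e ≤ 4 * X) (hX2 : X < 2 ^ (e + 1)) : e = t + 1 ∧ ∃ b ∈ B, X = p + q + b := by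
  have mb : ∀ {b}, b ∈ B → 2 * b ≤ 3 * 2 ^ t := fun hb => T.hB.two_mul_le hb (T.hB.lt hb)
  have mw := T.eight_mul_le
  have hpos := Nat.two_pow_pos t
  have even : ∀ {i x : ℕ}, X = 2 ^ i * x → i = 0 := by
    intro i x hx
    by_contra hcon
    obtain ⟨s, rfl⟩ : ∃ s, i = s + 1 := ⟨i - 1, by omega⟩
    rw [pow_succ, mul_assoc, mul_left_comm] at hx
    omega
  obtain ⟨f, rfl⟩ := Nat.exists_eq_add_of_lt hte
  have bodd : ∀ {b}, b ∈ B → b % 2 = 1 → b ≤ 2 ^ t + 1 := fun hb h => T.hB.le_of_odd hb h (T.hB.lt hb)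
  have p5 : 5 ≤ t → 2 ^ 5 ≤ 2 ^ t := two_pow_le
  rcases T.ext.structure T.base_lt hX (f := f)
      (by rwa [show t + 1 + f = t + f + 1 by ring])
      (by rwa [show t + 2 + f = t + f + 1 + 1 by ring]) with
    ⟨a, ha, b, hb, ha1, hba, hab, hX', -⟩ |
    ⟨a, ha, b, hb, c, hc, ha1, hb1, hc1, habc, i, rfl, hX', -⟩ |
    ⟨a, ha, b, hb, ha1, hba, hab, i, rfl, hX', -⟩
  · obtain rfl := even hX'
    rw [pow_zero, one_mul] at hX'
    refine ⟨rfl, ?_⟩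
    rcases List.mem_cons.1 ha with rfl | haB <;> rcases List.mem_cons.1 hb with rfl | hbB
    · omega
    · exact ⟨b, hbB, hX'⟩
    · exact ⟨a, haB, by omega⟩
    · have := T.hB.nu_add_le_two haB hbB hab
      rw [← hX'] at this
      omega
  · exfalso
    obtain rfl := even hX'
    rw [pow_zero, one_mul] at hX'
    have e4 : 2 ^ (t + (0 + 1) + 1) = 4 * 2 ^ t := by ring
    -- As `b` is at most `3/2 * 2 ^ t`, the value of `p + q` is at least `7/4 * 2 ^ t` and hence
    -- even. So `b` is odd and at most `2 ^ t + 1`, which pushes `p + q` beyond `15/8 * 2 ^ t`.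
    have two : ∀ {b}, b ∈ B → 2 ^ t ≤ b → X = 2 * (p + q) + b → False := by
      intro b hb hb1 e
      have := mb hb
      have := T.w_even_of_five_le (by omega) (by omega)
      have := bodd hb (by omega)
      have := p5 (by omega)
      omega
    have one : ∀ {b c}, b ∈ B → c ∈ B → X = p + q + (b + c) → False := by
      intro b c hb hc e
      have := mb hb
      have := mb hc
      omega
    rcases List.mem_cons.1 ha with rfl | haB <;> rcases List.mem_cons.1 hb with rfl | hbB <;>
      rcases List.mem_cons.1 hc with rfl | hcB
    · have := T.w_even_of_five_le (by omega) (by omega)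
      omega
    · exact two hcB hc1 (by omega)
    · exact two hbB hb1 (by omega)
    · exact one hbB hcB (by omega)
    · exact two haB ha1 (by omega)
    · exact one haB hcB (by omega)
    · exact one haB hbB (by omega)
    · have h1 := T.hB.big haB hbB (by omega)
      have e5 : 2 ^ (t + 1 + 1) = 4 * 2 ^ t := by ring
      have := h1.nu_add_le_two (x := a + b) (y := c) (by simp) (by simp [hcB]) (by omega)
      rw [← hX'] at this
      omega
  · exfalso
    obtain rfl := even hX'
    rw [pow_zero, one_mul] at hX'
    have one : ∀ {b}, b ∈ B → 2 ^ t ≤ b → X = 3 * (p + q + b) → 10 * 2 ^ t ≤ X → False := by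
      intro b hb hb1 e e'
      have := mb hb
      have := T.w_even_of_five_le (by omega) (by omega)
      have := bodd hb (by omega)
      have := p5 (by omega)
      omega
    rcases List.mem_cons.1 ha with rfl | haB <;> rcases List.mem_cons.1 hb with rfl | hbB
    · omega
    · exact one hbB (by omega) hX' (by omega)
    · exact one haB (by omega) (by omega) (by omega)
    · have := mb haB
      have := mb hbB
      omega

/-- The automaton shows that `X` and `q` have at least three ones and that `X` starts with `101` or
more. Being odd, `X` is then `w + b` with `w = p' + q'`, and `q = w`, so the number is `5 * w + 3 *
b`. For low `b` the automaton applies again. For `b` at the level of `w`, put `w = b + r`: then `8 *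
b + 5 * r` has at most six ones. -/
theorem IsThreeTwoSum.false {m k e : ℕ} (hm : 1 ≤ m) (hk : 3 ≤ k) (he : 2 * m + k + 7 = e + 2)
    (h : IsThreeTwoSum (thurberNumber m k) e) : False := by
  have H := thurberNumber_target hm hk
  obtain ⟨V, L, X, q, hV, hX, hq, hX1, hX2, hq2, hn⟩ := h
  obtain rfl : e = 2 * m + k + 5 := by omega
  have H1 := H.low
  have H2 := H.high
  have H3 := H.mod_four
  set S := 2 ^ (2 * m + k + 2) with hS
  have eE : 2 ^ (2 * m + k + 7) = 32 * S := by rw [hS]; ring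
  have ee : 2 ^ (2 * m + k + 5) = 8 * S := by rw [hS]; ring
  have ee1 : 2 ^ (2 * m + k + 5 + 1) = 16 * S := by rw [hS]; ring
  have nX := hV.nu_le_four hX
  have nq := hV.nu_le_four hq
  have nq3 : 3 ≤ nu q := by
    by_contra hcon
    exact thurber_ne hm hk (α := 3) (β := 2) (A := 4) (B := 2) (cy := 4) (cu := 3) (y := X) (u := q)
      0 (by decide +kernel) (by omega) (by omega) (by omega) nX (by omega) (by omega)
  have nX3 : 3 ≤ nu X := by
    by_contra hcon
    exact thurber_ne hm hk (α := 3) (β := 2) (A := 2) (B := 4) (cy := 4) (cu := 3) (y := X) (u := q)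
      0 (by decide +kernel) (by omega) (by omega) (by omega) (by omega) nq (by omega)
  have X125 : 10 * S ≤ X := by
    by_contra hcon
    obtain ⟨X', rfl⟩ := Nat.exists_eq_add_of_le hX1
    rw [nu_two_pow_add (by omega)] at nX
    exact thurber_ne hm hk (α := 3) (β := 2) (A := 3) (B := 4) (cy := 1) (cu := 3) (y := X') (u := q)
      24 (by decide +kernel) (by omega) (by omega) (by omega) (by omega) nq (by omega)
  rcases hV.two_cases with hc | ⟨t, p', q', B, T⟩
  · have := hc.nu_le_two hq
    omega
  have hXB : X ∉ B := fun h => by have := T.hB.nu_le_two h; omega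
  have hqB : q ∉ B := fun h => by have := T.hB.nu_le_two h; omega
  have hqt : 2 ^ t ≤ q := by
    by_contra hcon
    rcases T.base_cases hq (by rw [pow_succ]; omega) with h | h
    · have := T.low
      omega
    · exact hqB h
  have hte := lt_of_two_pow_le_of_lt hqt hq2
  have hwl := T.low
  have hwh := T.high
  have et : 2 ^ (t + 1) = 2 * 2 ^ t := by ring
  obtain ⟨hf, b, hb, hXb⟩ := T.exists_eq_w_add hX (by omega) nX3 hte (by omega) (by omega) hX2
  have hqw : q = p' + q' := (T.base_cases hq (by rwa [← hf])).resolve_right hqB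
  rw [hqw] at nq3 nq hn
  rw [hf] at ee
  have nb := T.hB.nu_le_two hb
  rcases Nat.lt_or_ge b (2 ^ t) with hbt | hbt
  · obtain ⟨w', hw'⟩ := Nat.exists_eq_add_of_le hwl
    rw [hw'] at hwh nq hn hXb
    rw [nu_two_pow_add (by omega)] at nq
    exact thurber_ne hm hk (α := 5) (β := 3) (A := 3) (B := 2) (cy := 2) (cu := 2) (y := w')
      (u := b) 20 (by decide +kernel) (by omega) (by omega) (by omega) (by omega) nb (by omega)
  · obtain ⟨r, hr, -, nr, -⟩ := T.exists_compl nq3 hb hbt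
    have e8 : thurberNumber m k = 2 ^ 3 * b + 5 * r := by omega
    have h1 := nu_add_le (2 ^ 3 * b) (5 * r)
    have h2 := nu_mul_le 5 r
    rw [show nu 5 = 2 by norm_num [nu]] at h2
    rw [nu_two_pow_mul, ← e8, H.nu_eq] at h1
    omega

/-! ### The representation `3 * (x + y)` -/

/-- The number of nonzero digits among the lowest `f` binary digits. -/
def lowDigitSum : ℕ → ℕ → ℕ
  | 0, _ => 0
  | f + 1, n => n % 2 + lowDigitSum f (n / 2)

theorem lowDigitSum_eq_nu {f n : ℕ} (h : n < 2 ^ f) : lowDigitSum f n = nu n := by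
  induction f generalizing n with
  | zero =>
    obtain rfl : n = 0 := by simpa using h
    simp [lowDigitSum]
  | succ f ih =>
    have h1 : n / 2 < 2 ^ f := by rw [pow_succ] at h; omega
    rw [lowDigitSum, ih h1]
    rcases Nat.even_or_odd' n with ⟨a, rfl | rfl⟩
    · rw [show 2 * a / 2 = a by omega, nu_two_mul]
      omega
    · rw [show (2 * a + 1) / 2 = a by omega, nu_two_mul_add_one]
      omega

set_option synthInstance.maxHeartbeats 200000 in
set_option synthInstance.maxSize 2000 in
-- Since `1839` has eight ones, `x` and `y` share them out four and four without carries, which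
-- leaves a short list. The number `2 * x - 1839` is `x - y`, the other summand of `x` when `y` is
-- one of its summands.
theorem nu_1839_table {x y : ℕ} (h : x + y = 1839) (hyx : y ≤ x) (hx : nu x ≤ 4) (hy : nu y ≤ 4) :
    (1031 ≤ x ∧ x ≤ 1068 ∧ (nu (2 * x - 1839) ≤ 4 → 4 ≤ nu (2 * x - 1839) ∧ 1065 ≤ x)) ∨
    (1283 ≤ x ∧ x ≤ 1320 ∧ 3 ≤ nu (2 * x - 1839)) ∨
    (1536 ≤ x ∧ (256 ≤ y ∨ y < 64) ∧ y ≤ 303 ∧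
      (x % 4 = 0 → y < 64 → (x = 1824 ∧ y < 16) ∨ x = 1800 ∨ x = 1796)) := by
  have key : ∀ x < 1840, 1839 ≤ 2 * x → lowDigitSum 11 x ≤ 4 → lowDigitSum 11 (1839 - x) ≤ 4 →
      (1031 ≤ x ∧ x ≤ 1068 ∧ (lowDigitSum 11 (2 * x - 1839) ≤ 4 →
        4 ≤ lowDigitSum 11 (2 * x - 1839) ∧ 1065 ≤ x)) ∨
      (1283 ≤ x ∧ x ≤ 1320 ∧ 3 ≤ lowDigitSum 11 (2 * x - 1839)) ∨
      (1536 ≤ x ∧ (256 ≤ 1839 - x ∨ 1839 - x < 64) ∧ 1839 - x ≤ 303 ∧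
        (x % 4 = 0 → 1839 - x < 64 → (x = 1824 ∧ 1839 - x < 16) ∨ x = 1800 ∨ x = 1796)) := by
    decide +kernel
  have h1 := key x (by omega) (by omega)
  rw [lowDigitSum_eq_nu (n := x) (by norm_num; omega), show 1839 - x = y by omega,
    lowDigitSum_eq_nu (n := y) (by norm_num; omega),
    lowDigitSum_eq_nu (n := 2 * x - 1839) (by norm_num; omega)] at h1
  exact h1 hx hy

/-- The number `1839` is not a sum of two terms of a chain with two small steps. -/
theorem Ch.add_ne_1839 {L x y : ℕ} {l : List ℕ} (h : Ch 2 L l) (hx : x ∈ l) (hy : y ∈ l) :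
    x + y ≠ 1839 := by
  intro e
  wlog hyx : y ≤ x generalizing x y
  · exact this hy hx (by omega) (by omega)
  have nx := h.nu_le_four hx
  have ny := h.nu_le_four hy
  have nxy := nu_add_le x y
  rw [e, show nu 1839 = 8 by norm_num [nu]] at nxy
  rcases h.two_cases with hc | ⟨t, p, q, B, T⟩
  · have := hc.nu_le_two hx
    omega
  have nub : ∀ {b}, b ∈ B → nu b ≤ 2 := T.hB.nu_le_two
  have hxB : x ∉ B := fun h => by have := nub h; omega
  have hyB : y ∉ B := fun h => by have := nub h; omega
  have mb : ∀ {b}, b ∈ B → 2 * b ≤ 3 * 2 ^ t := fun hb => T.hB.two_mul_le hb (T.hB.lt hb)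
  have hl := T.low
  have hh := T.high
  have low : ∀ {z}, z ∈ l → z ∉ B → 2 ^ t ≤ z := by
    intro z hz hzB
    by_contra hcon
    rcases T.base_cases hz (by rw [pow_succ]; omega) with h | h
    · omega
    · exact hzB h
  have hyt := low hy hyB
  have table := nu_1839_table e hyx nx ny
  have pw : ∀ {i j : ℕ}, i ≤ j → 2 ^ i ≤ 2 ^ j := two_pow_le
  have ht : t < 10 := by
    by_contra hcon
    have := pw (show 10 ≤ t by omega)
    omega
  obtain ⟨v, hv, u, hu, rfl, huv, hv2, hv1⟩ := T.split (j := 9) (by omega) hx (by omega) (by omega)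
  norm_num at hv1 hv2
  rcases Nat.lt_or_ge t 9 with ht9 | ht9
  · rcases table with hC | hA | ⟨hB1, hB2, hB3, hB4⟩
    · obtain rfl := T.unique ht9 hv hy (by omega) (by omega) (by omega) (by omega)
      have nu_u := T.nu_le_four hu
      rw [show 2 * (v + u) - 1839 = u by omega] at hC
      obtain ⟨v', hv', u', hu', rfl, huv', hv2', hv1'⟩ :=
        T.split (j := 8) (by omega) hv (by omega) (by omega)
      norm_num at hv1' hv2'
      rcases Nat.lt_or_ge t 8 with ht8 | ht8
      · obtain rfl := T.unique ht8 hv' hu (by omega) (by omega) (by omega) (by omega)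
        omega
      · obtain rfl : t = 8 := by omega
        norm_num at hl hh
        have huw := (T.base_cases hu (by omega)).resolve_right fun h => by
          have := nub h
          omega
        rcases T.base_cases hv' (by omega) with h1 | h1
        · omega
        · rcases T.base_cases hu' (by omega) with h2 | h2
          · have := mb h1
            omega
          · have := T.hB.nu_add_le_two h1 h2 (by omega)
            omega
    · have := T.unique ht9 hv hy (by omega) (by omega) (by omega) (by omega)
      omega
    · obtain rfl := T.unique ht9 hu hv (by omega) (by omega) (by omega) (by omega)
      obtain ⟨v, hv', u', hu', rfl, huv', hv2', hv1'⟩ :=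
        T.split (j := 8) (by omega) hu (by omega) (by omega)
      norm_num at hv1' hv2'
      rcases Nat.lt_or_ge t 8 with ht8 | ht8
      · obtain rfl := T.unique ht8 hv' hu' (by omega) (by omega) (by omega) (by omega)
        rcases Nat.lt_or_ge y 64 with hy64 | hy64
        -- Here `x` is four times a term, and terms in the upper half of a level above `t + 1` are
        -- doubles of terms. Of the three candidates only `1824 = 2 ^ 5 * 57` survives two halvings,
        -- and its odd factor `57` would have to be halved again.
        · have ht6 : t < 6 := by
            by_contra hcon
            have := pw (show 6 ≤ t by omega)
            omega
          obtain ⟨a, ha, e1⟩ := T.exists_half (j := 7) (by omega) hv' (by omega) (by omega)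
          obtain ⟨b, hb, e2⟩ := T.exists_half (j := 6) (by omega) ha (by omega) (by omega)
          have ht4 : t < 4 := by
            by_contra hcon
            have := pw (show 4 ≤ t by omega)
            omega
          obtain ⟨c, hc, e3⟩ := T.exists_half (j := 5) (by omega) hb (by omega) (by omega)
          obtain ⟨d, hd, e4⟩ := T.exists_half (j := 4) (by omega) hc (by omega) (by omega)
          omega
        · have := T.unique ht8 hv' hy (by omega) (by omega) (by omega) (by omega)
          omega
      · obtain rfl : t = 8 := by omega
        norm_num at hl hh hyt
        have hyw := (T.base_cases hy (by omega)).resolve_right hyB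
        rcases T.base_cases hv' (by omega) with h1 | h1 <;>
          rcases T.base_cases hu' (by omega) with h2 | h2
        · omega
        · have := mb h2
          omega
        · have := mb h1
          omega
        · have := T.hB.nu_add_le_two h1 h2 (by omega)
          rw [← two_mul, nu_two_mul] at nxy
          omega
  · obtain rfl : t = 9 := by omega
    norm_num at hl hh hyt
    have hyw := (T.base_cases hy (by omega)).resolve_right hyB
    rcases T.base_cases hv (by omega) with h1 | h1 <;>
      rcases T.base_cases hu (by omega) with h2 | h2
    · omega
    · have := nub h2
      rw [show 2 * (v + u) - 1839 = u by omega] at table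
      omega
    · have := nub h1
      rw [show 2 * (v + u) - 1839 = v by omega] at table
      omega
    · have := T.hB.nu_add_le_two h1 h2 (by omega)
      omega

/-- For `m = 1` and `k = 3` a third of the number is `1839`, which does split into two numbers with
four ones each. Counting ones cannot exclude this pair, so it is treated by `Ch.add_ne_1839`; this
is why the automaton starts at `k₀ = 4` for `m = 1`. -/
theorem IsTripleSum.false {m k : ℕ} (hm : 1 ≤ m) (hk : 3 ≤ k) (h : IsTripleSum (thurberNumber m k)) :
    False := by
  have H := (thurberNumber_target hm hk).high
  obtain ⟨V, L, x, y, hV, hx, hy, hn⟩ := h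
  by_cases h13 : m = 1 ∧ k = 3
  · obtain ⟨rfl, rfl⟩ := h13
    refine hV.add_ne_1839 hx hy ?_
    norm_num [thurberNumber] at hn
    omega
  · refine no_thurber_solution (k₀ := 4) (α := 3) (β := 3) (A := 4) (B := 4) (cy := 5) (cu := 5)
      (top := 40) (y := x) (u := y) (fun _ => by decide +kernel) (fun _ => by decide +kernel)
      (by norm_num) hm hk (by omega) ?_ ?_ (hV.nu_le_four hx) (hV.nu_le_four hy) ?_
    · rw [show 2 * m + k + 2 + 5 = 2 * m + k + 7 by ring]
      omega
    · rw [show 2 * m + k + 2 + 5 = 2 * m + k + 7 by ring]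
      omega
    · rw [← mul_add, ← hn, thurberNumber]
      ring

/-! ### Sums with one summand at the level of the Thurber number -/

theorem TwoStep.le_of_not_mem {t L p q z : ℕ} {B l : List ℕ} (T : TwoStep t L p q B l)
    (hz : z ∈ l) (hzB : z ∉ B) : 2 ^ t ≤ z := by
  by_contra hcon
  rcases T.base_cases hz (by rw [pow_succ]; omega) with h | h
  · have := T.low
    omega
  · exact hzB h

theorem eq_zero_of_two_pow_mul_odd {i x : ℕ} (h : 2 ^ i * x % 2 = 1) : i = 0 := by
  by_contra hcon
  obtain ⟨s, rfl⟩ : ∃ s, i = s + 1 := ⟨i - 1, by omega⟩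
  rw [pow_succ, mul_assoc, mul_left_comm] at h
  omega

theorem four_dvd_two_pow_mul {i : ℕ} (x : ℕ) (h : 2 ≤ i) : 2 ^ i * x % 4 = 0 := by
  obtain ⟨s, rfl⟩ := Nat.exists_eq_add_of_le h
  rw [pow_add, mul_assoc]
  omega

theorem two_pow_eq_two_mul {i n : ℕ} (h : n < 2 ^ i) (h' : 2 ^ i < 4 * n) (j : ℕ) (hn : 2 * n = 2 ^ j) :
    2 ^ i = 2 * n := by
  have e : 2 ^ (i + 1) = 2 * 2 ^ i := by ring
  have e' : 2 ^ (j + 1) = 2 * 2 ^ j := by ring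
  have h1 := (Nat.pow_lt_pow_iff_right (a := 2) (n := j) (m := i + 1) (by omega)).1 (by omega)
  have h2 := (Nat.pow_lt_pow_iff_right (a := 2) (n := i) (m := j + 1) (by omega)).1 (by omega)
  rw [hn, show i = j by omega]

theorem thurberNumber_eq (m k : ℕ) : thurberNumber m k =
    40 * 2 ^ (2 * m + k + 2) + 3 * 2 ^ (m + k + 3) + 3 * 2 ^ (m + 1) + 1 := by
  rw [thurberNumber]
  ring

theorem thurberNumber_mod {m k : ℕ} (i : ℕ) (hi : i ≤ m + k + 3) :
    ∃ A, thurberNumber m k = 2 ^ i * A + (3 * 2 ^ (m + 1) + 1) := by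
  obtain ⟨c, hc⟩ := Nat.exists_eq_add_of_le hi
  refine ⟨(5 * 2 ^ (m + 2) + 3) * 2 ^ c, ?_⟩
  rw [thurberNumber, hc, pow_add]
  ring

/-- Numbers with few digits that end like a Thurber number. -/
theorem eq_of_low_digits {m h j y : ℕ} (hm : 1 ≤ m) (hy : y = 2 ^ (m + 3) * h + (3 * 2 ^ (m + 1) + 1))
    (hnu : nu y ≤ 4) (h1 : 2 ^ j ≤ y) (h3 : 5 * 2 ^ j ≤ 4 * y) (h2 : y < 2 ^ (j + 1)) :
    (y = 3 * 2 ^ (m + 1) + 1 ∧ j = m + 2) ∨ (y = 7 * 2 ^ (m + 1) + 1 ∧ j = m + 3) ∨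
      (y = 11 * 2 ^ (m + 1) + 1 ∧ j = m + 4) := by
  have hM := two_pow_le (show 2 ≤ m + 1 by omega)
  have e2 : 2 ^ (m + 2) = 2 * 2 ^ (m + 1) := by ring
  have e3 : 2 ^ (m + 3) = 4 * 2 ^ (m + 1) := by ring
  have e4 : 2 ^ (m + 4) = 8 * 2 ^ (m + 1) := by ring
  have e5 : 2 ^ (m + 5) = 16 * 2 ^ (m + 1) := by ring
  have level : ∀ i, 2 ^ i ≤ y → y < 2 ^ (i + 1) → j = i := by
    intro i hi hi'
    have := lt_of_two_pow_le_of_lt h1 hi'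
    have := lt_of_two_pow_le_of_lt hi h2
    omega
  have n1 := nu_two_pow_mul_add h (show 3 * 2 ^ (m + 1) + 1 < 2 ^ (m + 3) by omega)
  have n2 := nu_two_pow_mul_add 3 (show 1 < 2 ^ (m + 1) by omega)
  rw [mul_comm (2 ^ (m + 1)) 3] at n2
  rw [← hy, n2, show nu 3 = 2 by norm_num [nu], nu_one] at n1
  rcases Nat.eq_zero_or_pos h with rfl | hpos
  · exact Or.inl ⟨by omega, level _ (by omega) (by omega)⟩
  · obtain ⟨i, rfl⟩ := exists_two_pow_of_nu_le_one hpos (by omega)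
    obtain rfl | rfl | hi : i = 0 ∨ i = 1 ∨ 2 ≤ i := by omega
    · exact Or.inr (Or.inl ⟨by omega, level _ (by omega) (by omega)⟩)
    · exact Or.inr (Or.inr ⟨by omega, level _ (by omega) (by omega)⟩)
    · exfalso
      have e6 : 2 ^ (m + 3) * 2 ^ i = 2 ^ (m + 3 + i) := by ring
      have e7 : 2 ^ (m + 3 + i + 1) = 2 * 2 ^ (m + 3 + i) := by ring
      have e8 : 2 ^ (m + 3 + 2) = 16 * 2 ^ (m + 1) := by ring
      have h4 := two_pow_le (show m + 3 + 2 ≤ m + 3 + i by omega)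
      have := level (m + 3 + i) (by omega) (by omega)
      subst this
      omega

/-- The lowest `m + 3` digits of `y` are those of the Thurber number, and its leading digits are
those of `x`, between `5/4` and `11/8`. With four ones, the low digits leave only `3`, `7` or `11`
times `2 ^ (m + 1)`, plus one, and all of these exceed `11/8` of their leading power. -/
theorem thurberNumber_ne_two_pow_mul_add {m k e x y : ℕ} (hm : 1 ≤ m) (hk : 3 ≤ k)
    (hn : thurberNumber m k = x + y) (hx : x = 2 ^ e * y) (hx1 : 40 * 2 ^ (2 * m + k + 2) ≤ x)
    (hnu : nu y ≤ 4) : False := by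
  have H := (thurberNumber_target hm hk).high
  have hneq := thurberNumber_eq m k
  have h1 := two_pow_le (show m + 3 ≤ m + k + 3 by omega)
  have e1 : 2 ^ (m + 3) = 4 * 2 ^ (m + 1) := by ring
  have e2 : 2 ^ (m + k + 5) = 4 * 2 ^ (m + k + 3) := by ring
  have e3 : 2 ^ (2 * m + k + 7) = 32 * 2 ^ (2 * m + k + 2) := by ring
  have hpos := Nat.two_pow_pos (2 * m + k + 2)
  have hM := Nat.two_pow_pos (m + 1)
  have hy0 : 0 < y := by
    rcases Nat.eq_zero_or_pos y with rfl | h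
    · simp at hx
      omega
    · exact h
  obtain ⟨j, hj1, hj2⟩ := exists_level_of_pos hy0
  have hj : j < m + k + 5 := lt_of_two_pow_le_of_lt hj1 (by omega)
  have p := Nat.two_pow_pos e
  have hx2 : 2 ^ (e + j) ≤ x := by
    rw [hx, pow_add]
    exact Nat.mul_le_mul_left _ hj1
  have hx3 : x < 2 ^ (e + j + 1) := by
    rw [hx, add_assoc, pow_add]
    exact Nat.mul_lt_mul_of_pos_left hj2 p
  have hej : e + j = 2 * m + k + 7 := by
    have := lt_of_two_pow_le_of_lt hx2 (show x < 2 ^ (2 * m + k + 7 + 1) by rw [pow_succ]; omega)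
    have := lt_of_two_pow_le_of_lt (show 2 ^ (2 * m + k + 7) ≤ x by omega) hx3
    omega
  have e4 : 2 ^ e * 2 ^ j = 32 * 2 ^ (2 * m + k + 2) := by rw [← pow_add, hej, e3]
  have b1 : 5 * 2 ^ j ≤ 4 * y := by
    refine Nat.le_of_mul_le_mul_left (c := 2 ^ e) ?_ p
    rw [mul_left_comm (2 ^ e) 5, mul_left_comm (2 ^ e) 4, ← hx, e4]
    omega
  have b2 : 8 * y < 11 * 2 ^ j := by
    refine Nat.lt_of_mul_lt_mul_left (a := 2 ^ e) ?_
    rw [mul_left_comm (2 ^ e) 8, mul_left_comm (2 ^ e) 11, ← hx, e4]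
    omega
  obtain ⟨A, hA⟩ := thurberNumber_mod (m := m) (k := k) (m + 3) (by omega)
  obtain ⟨c, rfl⟩ := Nat.exists_eq_add_of_le (show m + 3 ≤ e by omega)
  have hy : y = 2 ^ (m + 3) * (y / 2 ^ (m + 3)) + (3 * 2 ^ (m + 1) + 1) := by
    have h2 : (x + y) % 2 ^ (m + 3) = y % 2 ^ (m + 3) := by
      rw [hx, pow_add, mul_assoc, Nat.mul_add_mod]
    rw [← hn, hA, Nat.mul_add_mod, Nat.mod_eq_of_lt (by omega)] at h2
    rw [h2, Nat.div_add_mod]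
  rcases eq_of_low_digits hm hy hnu hj1 b1 hj2 with ⟨h, rfl⟩ | ⟨h, rfl⟩ | ⟨h, rfl⟩
  · rw [pow_add] at *; omega
  · rw [pow_add] at *; omega
  · rw [pow_add] at *; omega

theorem TwoStep.w_mod_four {t L p q : ℕ} {B l : List ℕ} (T : TwoStep t L p q B l)
    (h : 5 * 2 ^ t ≤ 3 * (p + q)) (hodd : (p + q) % 2 = 1) : (p + q) % 4 = 3 ∧ t ≤ 4 := by
  have hl := T.low
  obtain ⟨r, hr⟩ := T.eq_of_five_le h
  have hr0 : r = 0 := by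
    rcases hr with hr | hr | hr <;> rw [hr, mul_comm] at hodd <;>
      exact eq_zero_of_two_pow_mul_odd hodd
  subst hr0
  have : t < 5 := lt_of_two_pow_le_of_lt hl (by norm_num; omega)
  omega

/-- The number of nonzero digits of `y`, if the lowest of them are known. -/
theorem eq_of_low_digits_short {m k w : ℕ} (hm : 1 ≤ m) (hk : 3 ≤ k)
    (hw : w % 2 ^ (m + 2) = 2 ^ (m + 1) + 1) (hnu : nu w ≤ 4) (h1 : 2 ^ (m + k + 4) ≤ w)
    (h2 : w < 2 ^ (m + k + 5)) (h3 : 5 * 2 ^ (m + k + 4) ≤ 4 * w) :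
    w = 12 * 2 ^ k * 2 ^ (m + 1) + 2 ^ (m + 1) + 1 ∨
      w = 10 * 2 ^ k * 2 ^ (m + 1) + 2 ^ (m + 1) + 1 := by
  have hM := two_pow_le (show 2 ≤ m + 1 by omega)
  have hK := two_pow_le hk
  have e2 : 2 ^ (m + 2) = 2 * 2 ^ (m + 1) := by ring
  have e4 : 2 ^ (m + k + 4) = 2 ^ (m + 2) * (4 * 2 ^ k) := by ring
  have e5 : 2 ^ (m + k + 5) = 2 ^ (m + 2) * (8 * 2 ^ k) := by ring
  obtain ⟨h, rfl⟩ : ∃ h, w = 2 ^ (m + 2) * h + (2 ^ (m + 1) + 1) :=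
    ⟨w / 2 ^ (m + 2), by rw [← hw, Nat.div_add_mod]⟩
  have n1 := nu_two_pow_mul_add h (show 2 ^ (m + 1) + 1 < 2 ^ (m + 2) by omega)
  rw [nu_two_pow_add (show 1 < 2 ^ (m + 1) by omega), nu_one] at n1
  have b1 : 4 * 2 ^ k ≤ h := by
    by_contra hcon
    have := Nat.mul_le_mul_left (2 ^ (m + 2)) (show h + 1 ≤ 4 * 2 ^ k by omega)
    rw [mul_add, mul_one] at this
    omega
  have b2 : h < 8 * 2 ^ k := by
    by_contra hcon
    have := Nat.mul_le_mul_left (2 ^ (m + 2)) (show 8 * 2 ^ k ≤ h by omega)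
    omega
  obtain ⟨h', rfl⟩ := Nat.exists_eq_add_of_le b1
  have n2 := nu_two_pow_add (k := k + 2) (r := h') (by rw [pow_add]; omega)
  rw [show 2 ^ (k + 2) = 4 * 2 ^ k by ring] at n2
  rcases Nat.eq_zero_or_pos h' with rfl | hpos
  · have h7 := Nat.mul_le_mul_left (2 ^ (m + 2)) hK
    rw [add_zero, mul_left_comm] at h3 h1
    rw [mul_left_comm] at e4
    omega
  obtain ⟨j, rfl⟩ := exists_two_pow_of_nu_le_one hpos (by omega)
  have hj : j < k + 2 := (Nat.pow_lt_pow_iff_right (a := 2) (by omega)).1 (by rw [pow_add 2 k]; omega)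
  obtain hj' | rfl | rfl : j + 1 ≤ k ∨ j = k ∨ j = k + 1 := by omega
  · exfalso
    have h5 := two_pow_le hj'
    have h6 := Nat.mul_le_mul_left (2 ^ (m + 2)) (show 2 * 2 ^ j ≤ 2 ^ k by rw [pow_succ] at h5; omega)
    have h7 := Nat.mul_le_mul_left (2 ^ (m + 2)) hK
    have e7 : 2 ^ (m + 2) * (4 * 2 ^ k + 2 ^ j) = 4 * (2 ^ (m + 2) * 2 ^ k) + 2 ^ (m + 2) * 2 ^ j := by
      ring
    rw [mul_left_comm] at e4
    rw [mul_left_comm _ 2] at h6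
    omega
  · right
    rw [e2]
    ring
  · left
    rw [e2]
    ring

/-- Let `w = p + q`. Congruence modulo `2 ^ f` shows how `w` ends. For `t < m + k + 4` this forces
`w = 3 * 2 ^ (m + 1) + 1`, and the rest of the equation fails by parity. For `t = m + k + 4` two
values of `w` remain. One gives a `b` below level `t`; the other gives a `b` with two ones only if
`k = m + 1`, and then the gaps `2` of `b` and `m + 1` of its complement in `w` are incompatible
because `k ≥ 3`. -/
theorem TwoStep.thurberNumber_ne {m k t L p q f b : ℕ} {B l : List ℕ} (T : TwoStep t L p q B l)
    (hm : 1 ≤ m) (hk : 3 ≤ k) (hnu : 3 ≤ nu (p + q)) (hb : b ∈ B) (hf : t + f + 1 = 2 * m + k + 7)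
    (ht : t ≤ m + k + 4) (hx : 40 * 2 ^ (2 * m + k + 2) ≤ 2 ^ f * (p + q + b)) :
    thurberNumber m k ≠ 2 ^ f * (p + q + b) + (p + q) := by
  intro hn
  have H := thurberNumber_target hm hk
  have H3 := H.mod_four
  have h4 := four_dvd_two_pow_mul (p + q + b) (show 2 ≤ f by omega)
  have hw4 := T.nu_w
  have hl := T.low
  have hh := T.high
  have hpf := Nat.two_pow_pos f
  have hsize : 5 * 2 ^ t ≤ 2 * (p + q + b) := by
    refine Nat.le_of_mul_le_mul_left (c := 2 ^ f) ?_ hpf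
    have e : 2 ^ f * (5 * 2 ^ t) = 2 * (40 * 2 ^ (2 * m + k + 2)) := by
      have : 2 ^ f * 2 ^ t = 2 ^ (2 * m + k + 6) := by rw [← pow_add]; congr 1; omega
      rw [mul_left_comm, this]
      ring
    rw [e, mul_left_comm (2 ^ f) 2]
    omega
  rcases Nat.lt_or_ge b (2 ^ t) with hbt | hbt
  · have := T.hB.four_mul_le hb hbt
    have := T.w_mod_four (by omega) (by omega)
    omega
  obtain ⟨r, hr, hrt, nr, hrB⟩ := T.exists_compl hnu hb hbt
  have hM := two_pow_le (show 2 ≤ m + 1 by omega)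
  rcases Nat.lt_or_ge t (m + k + 4) with htP | htP
  · obtain ⟨A, hA⟩ := thurberNumber_mod (m := m) (k := k) (m + 3) (by omega)
    have e3 : 2 ^ (m + 3) = 4 * 2 ^ (m + 1) := by ring
    have hy : p + q = 2 ^ (m + 3) * ((p + q) / 2 ^ (m + 3)) + (3 * 2 ^ (m + 1) + 1) := by
      obtain ⟨c, hc⟩ := Nat.exists_eq_add_of_le (show m + 3 ≤ f by omega)
      have h2 : (2 ^ f * (p + q + b) + (p + q)) % 2 ^ (m + 3) = (p + q) % 2 ^ (m + 3) := by
        rw [hc, pow_add, mul_assoc, Nat.mul_add_mod]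
      rw [← hn, hA, Nat.mul_add_mod, Nat.mod_eq_of_lt (by omega)] at h2
      rw [h2, Nat.div_add_mod]
    have htm : t ≤ m + 4 := by
      rcases eq_of_low_digits hm hy hw4 hl (by omega) hh with h | h | h <;> omega
    obtain ⟨A', hA'⟩ := thurberNumber_mod (m := m) (k := k) (m + 5) (by omega)
    have e5 : 2 ^ (m + 5) = 16 * 2 ^ (m + 1) := by ring
    have hw : p + q = 3 * 2 ^ (m + 1) + 1 := by
      obtain ⟨c, hc⟩ := Nat.exists_eq_add_of_le (show m + 5 ≤ f by omega)
      have h2 : (2 ^ f * (p + q + b) + (p + q)) % 2 ^ (m + 5) = (p + q) % 2 ^ (m + 5) := by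
        rw [hc, pow_add, mul_assoc, Nat.mul_add_mod]
      have h3 := two_pow_le (show t + 1 ≤ m + 5 by omega)
      rw [← hn, hA', Nat.mul_add_mod, Nat.mod_eq_of_lt (by omega), Nat.mod_eq_of_lt (by omega)] at h2
      exact h2.symm
    have e2 : 2 ^ (m + 2) = 2 * 2 ^ (m + 1) := by ring
    have ht2 : t = m + 2 := by
      have := lt_of_two_pow_le_of_lt (i := m + 2) (by omega) hh
      have := lt_of_two_pow_le_of_lt (j := m + 3) hl (by omega)
      omega
    obtain rfl : f = m + k + 4 := by omega
    rw [hw, thurberNumber_eq, show 40 * 2 ^ (2 * m + k + 2) =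
      2 ^ (m + k + 3) * (2 * (5 * 2 ^ (m + 1))) by ring, show 2 ^ (m + k + 4) =
      2 ^ (m + k + 3) * 2 by ring, mul_assoc] at hn
    have h5 : 2 ^ (m + k + 3) * (2 * (5 * 2 ^ (m + 1)) + 3) =
        2 ^ (m + k + 3) * (2 * (3 * 2 ^ (m + 1) + 1 + b)) := by
      rw [mul_add]
      omega
    have := Nat.eq_of_mul_eq_mul_left (Nat.two_pow_pos _) h5
    omega
  · obtain rfl : t = m + k + 4 := by omega
    obtain rfl : f = m + 2 := by omega
    obtain ⟨A, hA⟩ := thurberNumber_mod (m := m) (k := k) (m + 2) (by omega)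
    have e2 : 2 ^ (m + 2) = 2 * 2 ^ (m + 1) := by ring
    have hmod : (p + q) % 2 ^ (m + 2) = 2 ^ (m + 1) + 1 := by
      have h2 : (2 ^ (m + 2) * (p + q + b) + (p + q)) % 2 ^ (m + 2) = (p + q) % 2 ^ (m + 2) := by
        rw [Nat.mul_add_mod]
      rw [← hn, hA, show 2 ^ (m + 2) * A + (3 * 2 ^ (m + 1) + 1) =
        2 ^ (m + 2) * (A + 1) + (2 ^ (m + 1) + 1) by ring, Nat.mul_add_mod,
        Nat.mod_eq_of_lt (by omega)] at h2
      exact h2.symm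
    have hb2 := T.hB.lt hb
    have hK := two_pow_le hk
    rw [thurberNumber_eq] at hn
    have e6 : 2 ^ (2 * m + k + 2) = 2 ^ k * 2 ^ (m + 1) * 2 ^ (m + 1) := by ring
    have e7 : 2 ^ (m + k + 3) = 4 * (2 ^ k * 2 ^ (m + 1)) := by ring
    have e8 : 2 ^ (m + 2) = 2 * 2 ^ (m + 1) := by ring
    have cases := eq_of_low_digits_short hm hk hmod hw4 hl hh (by omega)
    have eK : 2 ^ (m + k + 4) = 8 * (2 ^ k * 2 ^ (m + 1)) := by ring
    set M := 2 ^ (m + 1) with hMdef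
    set K := 2 ^ k with hKdef
    rw [e6, e7, e8] at hn
    have hKM : 8 * M ≤ K * M := Nat.mul_le_mul_right _ hK
    have hKM' : 4 * K ≤ K * M := by
      rw [mul_comm 4]
      exact Nat.mul_le_mul_left _ hM
    rcases cases with hw | hw
    · have h5 : 2 * M * (p + q + b) = 2 * M * (20 * (K * M) + 1) := by
        rw [hw] at hn ⊢
        linarith
      have := Nat.eq_of_mul_eq_mul_left (by omega) h5
      rw [mul_assoc 12] at hw
      omega
    · have h5 : 2 * M * (p + q + b) = 2 * M * (20 * (K * M) + K + 1) := by
        rw [hw] at hn ⊢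
        linarith
      have := Nat.eq_of_mul_eq_mul_left (by omega) h5
      rw [mul_assoc 10] at hw
      have hb' : b + M = 10 * (K * M) + K := by omega
      have htop : ∀ i, 2 ^ i ≤ b → b < 2 ^ (i + 1) → i = m + k + 4 := by
        intro i hi hi'
        have := lt_of_two_pow_le_of_lt hi hb2
        have := lt_of_two_pow_le_of_lt hbt hi'
        omega
      have hrM : r = M + 1 ∨ K ≠ M := by omega
      have hbt' : b ≠ 2 ^ (m + k + 4) := by omega
      rcases T.hB.shape hb with ⟨i, hi⟩ | ⟨i, g, hg, hi⟩
      · have := htop i hi.ge (by rw [hi, pow_succ]; have := Nat.two_pow_pos i; omega)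
        rw [this] at hi
        exact hbt' hi
      have e9 : 2 ^ i * (2 ^ g + 1) = 2 ^ (i + g) + 2 ^ i := by ring
      have h6 := two_mul_two_pow_le (show i < i + g by omega)
      have hpi := Nat.two_pow_pos i
      have h7 := htop (i + g) (by omega) (by rw [pow_succ]; omega)
      rw [h7] at e9
      have h8 : 2 ^ i = 2 * (K * M) := two_pow_eq_two_mul (by omega) (by omega) (m + k + 2)
        (by rw [hMdef, hKdef]; ring)
      have hKM2 : K = M := by omega
      have hkm : k = m + 1 := Nat.pow_right_injective le_rfl hKM2
      have h9 : i = m + k + 2 := by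
        refine Nat.pow_right_injective le_rfl (show 2 ^ i = 2 ^ (m + k + 2) from ?_)
        rw [h8, hMdef, hKdef]
        ring
      have hrB' := hrB.resolve_right fun h => hbt' h.1
      rw [show r = 2 ^ 0 * (2 ^ (m + 1) + 1) by omega] at hrB'
      rw [hi] at hb
      have := T.hB.gap_compat hg (by omega) hb hrB' (by omega)
      omega

namespace IsTopSum

variable {m k t p q x y : ℕ} {B V : List ℕ}

/-- The case of a large first term. -/
theorem false_of_le (hm : 1 ≤ m) (hk : 3 ≤ k) (T : TwoStep t (2 * m + k + 7) p q B V) (hx : x ∈ V)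
    (hy : y ∈ V) (hyB : y ∉ B) (hnx : 3 ≤ nu x) (hny : 3 ≤ nu y)
    (hn : thurberNumber m k = x + y) (hx1 : 40 * 2 ^ (2 * m + k + 2) ≤ x) : False := by
  have H := thurberNumber_target hm hk
  have H2 := H.high
  have H3 := H.mod_four
  have hneq := thurberNumber_eq m k
  have eE : 2 ^ (2 * m + k + 7) = 32 * 2 ^ (2 * m + k + 2) := by ring
  have h1 := two_pow_le (show m + 3 ≤ m + k + 3 by omega)
  have e1 : 2 ^ (m + 3) = 4 * 2 ^ (m + 1) := by ring
  have e2 : 2 ^ (m + k + 5) = 4 * 2 ^ (m + k + 3) := by ring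
  have hM := Nat.two_pow_pos (m + 1)
  have hyt := T.le_of_not_mem hy hyB
  have ht : t < m + k + 5 := lt_of_two_pow_le_of_lt hyt (by omega)
  have nx := T.nu_le_four hx
  have ny := T.nu_le_four hy
  have lemA : ∀ e, x = 2 ^ e * y → False :=
    fun e he => thurberNumber_ne_two_pow_mul_add hm hk hn he hx1 ny
  have nub : ∀ {b}, b ∈ B → nu b ≤ 2 := T.hB.nu_le_two
  have mb : ∀ {b}, b ∈ B → 2 * b ≤ 3 * 2 ^ t := fun hb => T.hB.two_mul_le hb (T.hB.lt hb)
  have mw := T.eight_mul_le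
  have hpos := Nat.two_pow_pos t
  obtain ⟨f, hf⟩ := Nat.exists_eq_add_of_lt (show t < 2 * m + k + 7 by omega)
  have x4 : ∀ i z, 2 ≤ i → x = 2 ^ i * z → y % 4 = 1 := by
    intro i z hi e
    have := four_dvd_two_pow_mul z hi
    omega
  have lowcase : y < 2 ^ (t + 1) → y = p + q := fun h => (T.base_cases hy h).resolve_right hyB
  -- The last clause of each form locates `y`: as an odd term it is `p + q`, the bracket `a + b`, or
  -- the bracket whose shift is `x`. The last possibility is excluded by `lemA`; the others are
  -- settled by parity and size.
  rcases T.ext.structure T.base_lt hx (f := f)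
      (by rw [show t + 1 + f = t + f + 1 by ring, ← hf]; omega)
      (by rw [show t + 2 + f = 2 * m + k + 7 + 1 by omega, pow_succ]; omega) with
    ⟨a, ha, b, hb, ha1, hba, hab, hx', tail⟩ |
    ⟨a, ha, b, hb, c, hc, ha1, hb1, hc1, habc, i, rfl, hx', tail⟩ |
    ⟨a, ha, b, hb, ha1, hba, hab, i, rfl, hx', tail⟩
  · have hy4 := x4 f _ (by omega) hx'
    rcases Nat.lt_or_ge y (2 ^ (t + 1)) with hyl | hyl
    · have hyw := lowcase hyl
      rw [hyw] at hn hny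
      rcases List.mem_cons.1 ha with rfl | haB <;> rcases List.mem_cons.1 hb with rfl | hbB
      · exact lemA (f + 1) (by rw [hx', hyw]; ring)
      · exact T.thurberNumber_ne hm hk hny hbB hf.symm (by omega) (by omega) (by omega)
      · rw [add_comm a] at hx'
        exact T.thurberNumber_ne hm hk hny haB hf.symm (by omega) (by omega) (by omega)
      · have := T.hB.nu_add_le_two haB hbB hab
        rw [hx', nu_two_pow_mul] at hnx
        omega
    · obtain ⟨g, hg, e⟩ := tail y hy hyl (by omega)
      obtain rfl := eq_zero_of_two_pow_mul_odd (i := g) (x := a + b) (by omega)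
      exact lemA f (by rw [hx', e]; ring)
  · have hy4 := x4 i _ (by omega) hx'
    have tail' : y = p + q ∨ y = a + b := by
      rcases Nat.lt_or_ge y (2 ^ (t + 1)) with hyl | hyl
      · exact Or.inl (lowcase hyl)
      · rcases tail y hy hyl (by omega) with h | ⟨g, -, e⟩
        · exact Or.inr h
        · obtain rfl := eq_zero_of_two_pow_mul_odd (i := g) (x := a + b + c) (by omega)
          exact (lemA i (by rw [hx', e]; ring)).elim
    have two : ∀ {b'}, b' ∈ B → a + b + c = 2 * (p + q) + b' →
        y = p + q ∨ y = 2 * (p + q) ∨ y = p + q + b' → False := by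
      intro b' hb' e hy'
      have hb2 := mb hb'
      rcases Nat.mod_two_eq_zero_or_one (p + q) with hw | hw
      · have := T.hB.le_of_odd hb' (by omega) (T.hB.lt hb')
        have : t < 3 := lt_of_two_pow_le_of_lt le_rfl (by norm_num; omega)
        interval_cases t <;> omega
      · obtain ⟨h, ht4⟩ := T.w_mod_four (by omega) hw
        have e20 : a + b + c = 20 ∨ a + b + c = 40 := by interval_cases t <;> omega
        rw [hx', nu_two_pow_mul] at hnx
        rcases e20 with e | e <;> rw [e] at hnx <;> norm_num [nu] at hnx
    have one : ∀ {b' c'}, b' ∈ B → c' ∈ B → a + b + c = p + q + (b' + c') → False := by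
      intro b' c' hb' hc' e
      have := mb hb'
      have := mb hc'
      omega
    rcases List.mem_cons.1 ha with rfl | haB <;> rcases List.mem_cons.1 hb with rfl | hbB <;>
      rcases List.mem_cons.1 hc with rfl | hcB
    · have := T.w_mod_four (by omega) (by omega)
      omega
    · exact two hcB (by omega) (by omega)
    · exact two hbB (by omega) (by omega)
    · exact one hbB hcB (by omega)
    · exact two haB (by omega) (by omega)
    · exact one haB hcB (by omega)
    · exact one haB hbB (by omega)
    · have e2 : 2 ^ (t + 1) = 2 * 2 ^ t := by ring
      have e4 : 2 ^ (t + 1 + 1) = 4 * 2 ^ t := by ring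
      have := (T.hB.big haB hbB (by omega)).nu_add_le_two (x := a + b) (y := c) (by simp)
        (by simp [hcB]) (by omega)
      rw [hx', nu_two_pow_mul] at hnx
      omega
  · have small : t ≤ 4 → y % 4 = 1 := fun h => x4 i _ (by omega) hx'
    have hodd : y % 2 = 1 := by
      have : x % 2 = 0 := by
        by_contra hcon
        have := eq_zero_of_two_pow_mul_odd (i := i) (x := 3 * (a + b)) (by omega)
        omega
      omega
    have tail' : y = p + q ∨ y = a + b := by
      rcases Nat.lt_or_ge y (2 ^ (t + 1)) with hyl | hyl
      · exact Or.inl (lowcase hyl)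
      · rcases tail y hy hyl (by omega) with ⟨g, e⟩ | ⟨g, e⟩
        · obtain rfl := eq_zero_of_two_pow_mul_odd (i := g) (x := a + b) (by omega)
          exact Or.inr (by omega)
        · obtain rfl := eq_zero_of_two_pow_mul_odd (i := g) (x := 3 * (a + b)) (by omega)
          exact (lemA i (by rw [hx', e]; ring)).elim
    have one : ∀ {b'}, b' ∈ B → a + b = p + q + b' → False := by
      intro b' hb' e
      have hb2 := mb hb'
      rcases Nat.mod_two_eq_zero_or_one (p + q) with hw | hw
      · have := T.hB.le_of_odd hb' (by omega) (T.hB.lt hb')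
        have : t < 2 := lt_of_two_pow_le_of_lt le_rfl (by norm_num; omega)
        interval_cases t <;> omega
      · obtain ⟨h, ht4⟩ := T.w_mod_four (by omega) hw
        have := small ht4
        interval_cases t <;> omega
    rcases List.mem_cons.1 ha with rfl | haB <;> rcases List.mem_cons.1 hb with rfl | hbB
    · obtain ⟨h, ht4⟩ := T.w_mod_four (by omega) (by omega)
      have := small ht4
      omega
    · exact one hbB rfl
    · exact one haB (by omega)
    · have := mb haB
      have := mb hbB
      omega

end IsTopSum

/-- For `m = 1` the numbers `b = 2 ^ (k + 7) + 2` and `r = 2 ^ (k + 4) + 1` do solve the equation,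
so counting ones is not enough. The congruences lead to this solution, whose gaps `k + 6` and `k +
4` are incompatible. -/
theorem TwoStep.thurberNumber_ne_five_mul_add {m k t L p q b r : ℕ} {B l : List ℕ}
    (T : TwoStep t L p q B l) (hm : 1 ≤ m) (hk : 3 ≤ k) (ht : t = 2 * m + k + 5) (hb : b ∈ B)
    (hr : r ∈ B) (hbt : 2 ^ t ≤ b) (hrt : r < 2 ^ t) : thurberNumber m k ≠ 5 * b + 3 * r := by
  intro hn
  have hb2 := T.hB.lt hb
  have nb := T.hB.nu_le_two hb
  have nr := T.hB.nu_le_two hr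
  obtain rfl | hm2 : m = 1 ∨ m ≠ 1 := by omega
  · have hnu : 4 ≤ nu b + nu r := by
      have h1 := nu_add_le (5 * b) (3 * r)
      have h2 := nu_mul_le 5 b
      have h3 := nu_mul_le 3 r
      rw [show nu 5 = 2 by norm_num [nu]] at h2
      rw [show nu 3 = 2 by norm_num [nu]] at h3
      rw [← hn, (thurberNumber_target hm hk).nu_eq] at h1
      omega
    obtain ⟨i, g, j, h, hg, hh, hgh, hlt, hi, rfl, rfl⟩ :=
      T.hB.compat hb hr hbt hb2 hrt hnu
    have e1 : 2 ^ i * (2 ^ g + 1) = 2 ^ (i + g) + 2 ^ i := by ring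
    have e2 : 2 ^ j * (2 ^ h + 1) = 2 ^ (j + h) + 2 ^ j := by ring
    have e3 : thurberNumber 1 k = 43 * 2 ^ (k + 4) + 13 := by
      rw [thurberNumber]
      ring
    have e4 : 2 ^ (k + 7) = 8 * 2 ^ (k + 4) := by ring
    have hp := two_pow_le (show 3 ≤ k + 4 by omega)
    have e5 : 2 ^ (k + 4) = 8 * 2 ^ (k + 1) := by ring
    rw [e1, e2, e3, hi, ht, show 2 * 1 + k + 5 = k + 7 by ring, e4] at hn
    have even : ∀ s, 0 < s → 2 ^ s % 2 = 0 := fun s hs => by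
      rw [show s = s - 1 + 1 by omega, pow_succ]
      omega
    have four : ∀ s, 2 ≤ s → 2 ^ s % 4 = 0 := fun s hs => by
      rw [show s = s - 2 + 2 by omega, pow_add]
      omega
    have eight : ∀ s, 3 ≤ s → 2 ^ s % 8 = 0 := fun s hs => by
      rw [show s = s - 3 + 3 by omega, pow_add]
      omega
    have hjh := even (j + h) (by omega)
    rcases Nat.eq_zero_or_pos i with rfl | hi0
    · omega
    have hi2 := even i hi0
    obtain rfl : j = 0 := by
      by_contra hj
      have := even j (by omega)
      omega
    rw [zero_add, pow_zero] at hn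
    obtain rfl | hh2 : h = 1 ∨ 2 ≤ h := by omega
    · obtain rfl | rfl | hi3 : i = 1 ∨ i = 2 ∨ 3 ≤ i := by omega
      · omega
      · omega
      · have := eight i hi3
        omega
    · have := four h hh2
      obtain rfl | hi3 : i = 1 ∨ 2 ≤ i := by omega
      · have h6 : 2 ^ h = 2 ^ (k + 4) := by omega
        have h7 : h = k + 4 := Nat.pow_right_injective le_rfl h6
        rw [GapCompat] at hgh
        omega
      · have := four i hi3
        omega
  · have e5 : 2 ^ t = 8 * 2 ^ (2 * m + k + 2) := by rw [ht]; ring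
    refine no_thurber_solution (k₀ := 3) (α := 5) (β := 3) (A := 2) (B := 2) (cy := 5) (cu := 5)
      (top := 40) (y := b) (u := r) (fun h => (hm2 h).elim) (fun _ => by decide +kernel)
      (by norm_num) hm hk (fun _ => hk) ?_ ?_ nb nr ?_
    · rw [pow_succ] at hb2
      rw [pow_add]
      omega
    · rw [pow_add]
      omega
    · rw [← hn, thurberNumber_eq]
      ring

namespace IsTopSum

variable {m k t p q x y : ℕ} {B V : List ℕ}

/-- The case of a second term two levels below the first. -/
theorem false_of_le_right (hm : 1 ≤ m) (hk : 3 ≤ k) (T : TwoStep t (2 * m + k + 7) p q B V)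
    (hx : x ∈ V) (hy : y ∈ V) (hyB : y ∉ B) (hny : 3 ≤ nu y) (hn : thurberNumber m k = x + y)
    (hx0 : 2 ^ (2 * m + k + 7) ≤ x) (hx1 : x < 40 * 2 ^ (2 * m + k + 2))
    (hy8 : 8 * 2 ^ (2 * m + k + 2) ≤ y) : False := by
  have H := thurberNumber_target hm hk
  have H1 := H.low
  have H2 := H.high
  have H3 := H.mod_four
  have eE : 2 ^ (2 * m + k + 7) = 32 * 2 ^ (2 * m + k + 2) := by ring
  have e5 : 2 ^ (2 * m + k + 5) = 8 * 2 ^ (2 * m + k + 2) := by ring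
  have e6 : 2 ^ (2 * m + k + 6) = 16 * 2 ^ (2 * m + k + 2) := by ring
  have e8 : 2 ^ (2 * m + k + 8) = 64 * 2 ^ (2 * m + k + 2) := by ring
  have hneq := thurberNumber_eq m k
  have ny := T.ch.nu_le_four hy
  have hyt := T.le_of_not_mem hy hyB
  have ht : t < 2 * m + k + 6 := lt_of_two_pow_le_of_lt hyt (by omega)
  have five : ∀ z, nu z ≤ 4 → thurberNumber m k = 5 * z → False := by
    intro z hz e
    exact thurber_ne hm hk (α := 5) (β := 1) (A := 4) (B := 0) (cy := 5) (cu := 0) (y := z) (u := 0)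
      0 (by decide +kernel) (by omega) (by omega) (by omega) hz (by simp [nu_zero]) (by omega)
  have threeTwo : ∀ X z, X ∈ V → z ∈ V → 2 ^ (2 * m + k + 5) ≤ X → X < 2 ^ (2 * m + k + 6) →
      z < 2 ^ (2 * m + k + 5) → thurberNumber m k = 3 * X + 2 * z → False :=
    fun X z hX hz h1 h2 h3 h4 => IsThreeTwoSum.false hm hk (e := 2 * m + k + 5) (by omega)
      ⟨V, _, X, z, T.ch, hX, hz, h1, h2, h3, h4⟩
  obtain ⟨v, hv, u, hu, rfl, huv, hv2, hv1⟩ :=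
    T.split (j := 2 * m + k + 6) (by omega) hx hx0
      (by rw [show 2 * m + k + 6 + 2 = 2 * m + k + 8 by ring]; omega)
  obtain ⟨a, ha, c, hc, rfl, hca, ha2, ha1⟩ :=
    T.split (j := 2 * m + k + 5) (by omega) hv (by omega) (by omega)
  rw [show 2 * m + k + 6 + 1 = 2 * m + k + 7 by ring] at hv2
  rw [show 2 * m + k + 5 + 1 = 2 * m + k + 6 by ring] at ha2
  have huv' : 2 ^ (2 * m + k + 6) ≤ u → u = a + c := fun h =>
    T.unique (j := 2 * m + k + 6) (by omega) hu hv h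
      (by rw [show 2 * m + k + 6 + 1 = 2 * m + k + 7 by ring]; omega) hv1
      (by rw [show 2 * m + k + 6 + 1 = 2 * m + k + 7 by ring]; omega)
  rcases Nat.lt_or_ge t (2 * m + k + 5) with ht5 | ht5
  -- The number is now `a + c + u + y`. Above the last small step the level of `y` has no other
  -- term, so `a = y`, and the sum collapses to `5 * y` or `3 * y + 2 * c`.
  · have uniq : ∀ z ∈ V, 2 ^ (2 * m + k + 5) ≤ z → z < 2 ^ (2 * m + k + 6) → z = y :=
      fun z hz h1 h2 => T.unique (j := 2 * m + k + 5) ht5 hz hy h1 h2 (by omega) (by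
        rw [show 2 * m + k + 5 + 1 = 2 * m + k + 6 by ring]; omega)
    obtain rfl := uniq a ha ha1 ha2
    rcases Nat.lt_or_ge u (2 ^ (2 * m + k + 6)) with hu6 | hu6
    · rcases Nat.lt_or_ge u (2 ^ (2 * m + k + 5)) with hu5 | hu5
      · omega
      · have := uniq u hu hu5 hu6
        have := uniq c hc (by omega) (by omega)
        omega
    · have := huv' hu6
      rcases Nat.lt_or_ge c (2 ^ (2 * m + k + 5)) with hc5 | hc5
      · exact threeTwo a c ha hc (by omega) (by omega) hc5 (by omega)
      · have := uniq c hc hc5 (by omega)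
        exact five a ny (by omega)
  obtain rfl : t = 2 * m + k + 5 := by omega
  have et : 2 ^ (2 * m + k + 5 + 1) = 2 ^ (2 * m + k + 6) := by ring
  have hyw : y = p + q := (T.base_cases hy (by omega)).resolve_right hyB
  have mb : ∀ {b}, b ∈ B → 2 * b ≤ 3 * 2 ^ (2 * m + k + 5) :=
    fun hb => T.hB.two_mul_le hb (T.hB.lt hb)
  have mV : ∀ {z}, z ∈ V → z < 2 ^ (2 * m + k + 6) → z ≤ 12 * 2 ^ (2 * m + k + 2) := by
    intro z hz hz2
    rcases T.base_cases hz (by omega) with h | h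
    · omega
    · have := mb h
      omega
  have ma := mV ha ha2
  have mc := mV hc (by omega)
  rcases Nat.lt_or_ge u (2 ^ (2 * m + k + 6)) with hu6 | hu6
  · have mu := mV hu hu6
    have := T.nu_four_sum ha hc hu hy ha1 (by omega) (by omega) (by omega) (by omega) (by omega)
      (by omega) (by omega) (by omega)
    rw [← hn, H.nu_eq] at this
    omega
  have := huv' hu6
  have one : ∀ {b}, b ∈ B → b ∈ V → thurberNumber m k = 3 * (p + q) + 2 * b → False := by
    intro b hb hbV e
    rcases Nat.lt_or_ge b (2 ^ (2 * m + k + 5)) with hbt | hbt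
    · exact threeTwo _ b T.w_mem hbV T.low (by omega) hbt e
    · obtain ⟨r, hr, hrt, -, hrB⟩ := T.exists_compl (hyw ▸ hny) hb hbt
      rcases hrB with hrB | ⟨hb', -⟩
      · exact T.thurberNumber_ne_five_mul_add hm hk rfl hb hrB hbt hrt (by omega)
      · omega
  rcases T.base_cases ha (by omega) with h1 | h1 <;> rcases T.base_cases hc (by omega) with h2 | h2
  · exact five y ny (by omega)
  · exact one h2 hc (by omega)
  · exact one h1 ha (by omega)
  · have h3 := T.hB.nu_add_le_two h1 h2 (by omega)
    have h4 := nu_add_le (2 * (a + c)) y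
    rw [nu_two_mul, show 2 * (a + c) + y = a + c + u + y by omega, ← hn, H.nu_eq] at h4
    omega

end IsTopSum

theorem thurberNumber_ne_seven_mul {m k z : ℕ} (hm : 1 ≤ m) (hk : 3 ≤ k) (hz : nu z ≤ 4) :
    thurberNumber m k ≠ 7 * z := by
  intro e
  have := (thurberNumber_target hm hk).high
  have eE : 2 ^ (2 * m + k + 7) = 32 * 2 ^ (2 * m + k + 2) := by ring
  exact thurber_ne hm hk (α := 7) (β := 1) (A := 4) (B := 0) (cy := 5) (cu := 0) (y := z) (u := 0)
    0 (by decide +kernel) (by omega) (by omega) (by omega) hz (by simp [nu_zero]) (by omega)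

theorem thurberNumber_ne_nine_mul {m k z : ℕ} (hm : 1 ≤ m) (hk : 3 ≤ k) (hz : nu z ≤ 4) :
    thurberNumber m k ≠ 9 * z := by
  intro e
  have := (thurberNumber_target hm hk).high
  have eE : 2 ^ (2 * m + k + 7) = 32 * 2 ^ (2 * m + k + 2) := by ring
  exact thurber_ne hm hk (α := 9) (β := 1) (A := 4) (B := 0) (cy := 5) (cu := 0) (y := z) (u := 0)
    0 (by decide +kernel) (by omega) (by omega) (by omega) hz (by simp [nu_zero]) (by omega)

/-- Below `7 * S`, where `S = 2 ^ (2 * m + k + 2)`, the leading digits of `y` are known. Removing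
the ones at `4 * S` and, if present, at `2 * S` leaves few enough ones for the automaton. -/
theorem seven_mul_le_of_eq_five_mul_add {m k y z : ℕ} (hm : 1 ≤ m) (hk : 3 ≤ k) (ny : nu y ≤ 4)
    (nz : nu z ≤ 2) (hz : z < 4 * 2 ^ (2 * m + k + 2)) (hy : 4 * 2 ^ (2 * m + k + 2) ≤ y)
    (hn : thurberNumber m k = 5 * y + 4 * z) : 7 * 2 ^ (2 * m + k + 2) ≤ y := by
  by_contra hcon
  have e4 : 2 ^ (2 * m + k + 4) = 4 * 2 ^ (2 * m + k + 2) := by ring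
  have e3 : 2 ^ (2 * m + k + 3) = 2 * 2 ^ (2 * m + k + 2) := by ring
  obtain ⟨y', rfl⟩ := Nat.exists_eq_add_of_le hy
  rw [← e4, nu_two_pow_add (by omega)] at ny
  rcases Nat.lt_or_ge y' (2 ^ (2 * m + k + 3)) with h | h
  · exact thurber_ne hm hk (α := 5) (β := 4) (A := 3) (B := 2) (cy := 1) (cu := 2) (y := y') (u := z)
      20 (by decide +kernel) (by omega) (by omega) (by omega) (by omega) nz (by omega)
  · obtain ⟨y'', rfl⟩ := Nat.exists_eq_add_of_le h
    rw [nu_two_pow_add (by omega)] at ny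
    exact thurber_ne hm hk (α := 5) (β := 4) (A := 2) (B := 2) (cy := 0) (cu := 2) (y := y'')
      (u := z) 30 (by decide +kernel) (by omega) (by omega) (by omega) (by omega) nz (by omega)

theorem thurberNumber_ne_five_mul_add_two_mul {m k y z : ℕ} (hm : 1 ≤ m) (hk : 3 ≤ k)
    (ny : nu y ≤ 4) (nz : nu z ≤ 2) (hz : z < 4 * 2 ^ (2 * m + k + 2))
    (hy : y < 8 * 2 ^ (2 * m + k + 2)) : thurberNumber m k ≠ 5 * y + 2 * z := by
  intro hn
  exact thurber_ne hm hk (α := 5) (β := 2) (A := 4) (B := 2) (cy := 3) (cu := 2) (y := y) (u := z)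
    0 (by decide +kernel) (by omega) (by omega) (by omega) ny nz (by omega)

namespace TwoStep

variable {m k t L p q y z : ℕ} {B l : List ℕ}

/-- If `y` is not close to the lower end of its level, then `y` and `z` involve the second small
step. -/
theorem exists_of_eq_five_mul_add (T : TwoStep t L p q B l) (hm : 1 ≤ m) (hk : 3 ≤ k)
    (ht : t < 2 * m + k + 4) (hy : y ∈ l) (hz : z ∈ l) (ny : 3 ≤ nu y) (hodd : y % 2 = 1)
    (hy1 : 5 * 2 ^ (2 * m + k + 2) ≤ y) (hy2 : y < 8 * 2 ^ (2 * m + k + 2))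
    (hz2 : z < 4 * 2 ^ (2 * m + k + 2)) :
    t = 2 * m + k + 3 ∧ ∃ b ∈ B, y = p + q + b ∧ (3 ≤ nu z → z = p + q) := by
  have e4 : 2 ^ (2 * m + k + 4) = 4 * 2 ^ (2 * m + k + 2) := by ring
  have e5 : 2 ^ (2 * m + k + 4 + 1) = 8 * 2 ^ (2 * m + k + 2) := by ring
  obtain ⟨h, b, hb, hyb⟩ := T.exists_eq_w_add hy hodd ny ht (by omega) (by omega) (by omega)
  refine ⟨by omega, b, hb, hyb, fun nz => (T.base_cases hz (by rw [← h]; omega)).resolve_right ?_⟩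
  intro hzB
  have := T.hB.nu_le_two hzB
  omega

theorem thurberNumber_ne_mul_add {α β : ℕ} (T : TwoStep t L p q B l) (hm : 1 ≤ m) (hk : 3 ≤ k)
    (ht : t = 2 * m + k + 3) {b : ℕ} (hb : b ∈ B)
    (h1 : (thurberCheckOne 3 α β 3 1 1 1 (40 - (2 * α + 2 * β)) &&
      thurberCheckTwo α β 3 1 1 1 (40 - (2 * α + 2 * β))) = true)
    (h2 : (thurberCheckOne 3 α β 3 2 1 1 (40 - 2 * α) &&
      thurberCheckTwo α β 3 2 1 1 (40 - 2 * α)) = true) (h3 : 2 * α + 2 * β ≤ 40) :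
    thurberNumber m k ≠ α * (p + q) + β * b := by
  intro hn
  have nw := T.nu_w
  have nb := T.hB.nu_le_two hb
  have hl := T.low
  have hh := T.high
  have hb2 := T.hB.lt hb
  rw [pow_succ] at hh hb2
  have e3 : 2 ^ t = 2 * 2 ^ (2 * m + k + 2) := by rw [ht]; ring
  obtain ⟨w', hw⟩ := Nat.exists_eq_add_of_le hl
  rw [hw] at nw hn
  rw [nu_two_pow_add (by omega)] at nw
  rcases Nat.lt_or_ge b (2 ^ t) with h | h
  · refine thurber_ne hm hk (2 * α) h2 (y := w') (u := b) (by omega) (by omega)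
      (by omega) (by omega) nb ?_
    rw [hn, e3]
    ring
  · obtain ⟨b', rfl⟩ := Nat.exists_eq_add_of_le h
    rw [nu_two_pow_add (by omega)] at nb
    refine thurber_ne hm hk (2 * α + 2 * β) h1 (y := w') (u := b') (by omega) (by omega)
      (by omega) (by omega) (by omega) ?_
    rw [hn, e3]
    ring

theorem thurberNumber_ne_five_mul_add_two_mul' (T : TwoStep t L p q B l) (hm : 1 ≤ m) (hk : 3 ≤ k)
    (ht : t < 2 * m + k + 4) (hy : y ∈ l) (hz : z ∈ l) (ny : 3 ≤ nu y)
    (hy1 : 4 * 2 ^ (2 * m + k + 2) ≤ y) (hy2 : y < 8 * 2 ^ (2 * m + k + 2))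
    (hz2 : z < 4 * 2 ^ (2 * m + k + 2)) : thurberNumber m k ≠ 5 * y + 2 * z := by
  intro hn
  have ny' := T.ch.nu_le_four hy
  have nz := T.ch.nu_le_four hz
  have H3 := (thurberNumber_target hm hk).mod_four
  have e4 : 2 ^ (2 * m + k + 4) = 4 * 2 ^ (2 * m + k + 2) := by ring
  rcases Nat.lt_or_ge (nu z) 3 with n3 | n3
  · exact thurberNumber_ne_five_mul_add_two_mul hm hk ny' (by omega) hz2 hy2 hn
  rcases Nat.lt_or_ge y (5 * 2 ^ (2 * m + k + 2)) with h | h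
  · obtain ⟨y', rfl⟩ := Nat.exists_eq_add_of_le hy1
    rw [← e4, nu_two_pow_add (by omega)] at ny'
    exact thurber_ne hm hk (α := 5) (β := 2) (A := 3) (B := 4) (cy := 0) (cu := 2) (y := y') (u := z)
      20 (by decide +kernel) (by omega) (by omega) (by omega) (by omega) nz (by omega)
  · obtain ⟨ht', b, hb, hyb, hzw⟩ := T.exists_of_eq_five_mul_add hm hk ht hy hz ny (by omega) h hy2 hz2
    refine T.thurberNumber_ne_mul_add (α := 7) (β := 5) hm hk ht' hb (by decide +kernel)
      (by decide +kernel) (by norm_num) ?_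
    rw [hn, hyb, hzw n3]
    ring

/-- The automaton handles a `y` that starts with `100`. Otherwise `y = p + q + b`. If `z` has at
most two ones, `y` would have to be larger than such a sum can be; if `z` has more, then `z = p +
q`, and the combination `9 * (p + q) + 5 * b` is excluded after peeling off leading ones. -/
theorem thurberNumber_ne_five_mul_add_four_mul (T : TwoStep t L p q B l) (hm : 1 ≤ m) (hk : 3 ≤ k)
    (ht : t < 2 * m + k + 4) (hy : y ∈ l) (hz : z ∈ l) (ny : 3 ≤ nu y)
    (hy1 : 4 * 2 ^ (2 * m + k + 2) ≤ y) (hy2 : y < 8 * 2 ^ (2 * m + k + 2))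
    (hz2 : z < 4 * 2 ^ (2 * m + k + 2)) : thurberNumber m k ≠ 5 * y + 4 * z := by
  intro hn
  have ny' := T.ch.nu_le_four hy
  have nz := T.ch.nu_le_four hz
  have H3 := (thurberNumber_target hm hk).mod_four
  have e4 : 2 ^ (2 * m + k + 4) = 4 * 2 ^ (2 * m + k + 2) := by ring
  have h2 := seven_mul_le_of_eq_five_mul_add (m := m) (k := k) (y := y) (z := z) hm hk ny'
  rcases Nat.lt_or_ge y (5 * 2 ^ (2 * m + k + 2)) with h | h
  · obtain ⟨y', rfl⟩ := Nat.exists_eq_add_of_le hy1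
    rw [← e4, nu_two_pow_add (by omega)] at ny'
    exact thurber_ne hm hk (α := 5) (β := 4) (A := 3) (B := 4) (cy := 0) (cu := 2) (y := y') (u := z)
      20 (by decide +kernel) (by omega) (by omega) (by omega) (by omega) nz (by omega)
  · obtain ⟨ht', b, hb, hyb, hzw⟩ := T.exists_of_eq_five_mul_add hm hk ht hy hz ny (by omega) h hy2 hz2
    rcases Nat.lt_or_ge (nu z) 3 with n3 | n3
    · have := h2 (by omega) hz2 hy1 hn
      have hb2 := T.hB.two_mul_le hb (T.hB.lt hb)
      have mw := T.eight_mul_le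
      have hpos := Nat.two_pow_pos (2 * m + k + 2)
      rw [ht', show 2 ^ (2 * m + k + 3) = 2 * 2 ^ (2 * m + k + 2) by ring] at hb2 mw
      omega
    · refine T.thurberNumber_ne_mul_add (α := 9) (β := 5) hm hk ht' hb (by decide +kernel)
        (by decide +kernel) (by norm_num) ?_
      rw [hn, hyb, hzw n3]
      ring

/-- The four ways in which a number in a quarter of a level arises from terms at least two levels
lower. -/
theorem eq_cases (T : TwoStep t L p q B l) {e x : ℕ} (hte : t ≤ e) (hx : x ∈ l)
    (hx1 : 9 * 2 ^ e ≤ x) (hx2 : x < 10 * 2 ^ e) :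
    ∃ a ∈ l, ∃ c ∈ l, 2 ^ e ≤ a ∧ a < 2 * 2 ^ e ∧ c ≤ a ∧ (x = 4 * (a + c) ∨ x = 3 * (a + c) ∨
      ∃ z ∈ l, z < 2 * 2 ^ e ∧ (x = 2 * (a + c + z) ∨ x = 2 * (a + c) + z)) := by
  have e1 : 2 ^ (e + 1) = 2 * 2 ^ e := by ring
  have e2 : 2 ^ (e + 2) = 4 * 2 ^ e := by ring
  have e3 : 2 ^ (e + 3) = 8 * 2 ^ e := by ring
  have e4 : 2 ^ (e + 4) = 16 * 2 ^ e := by ring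
  obtain ⟨v, hv, u, hu, rfl, huv, hv2, hv1⟩ := T.split (j := e + 2) (by omega) hx
    (by rw [add_assoc]; norm_num; omega) (by rw [add_assoc]; norm_num; omega)
  rw [add_assoc, show 2 + 1 = 3 by norm_num] at hv2
  obtain ⟨X, hX, z, hz, rfl, hzX, hX2, hX1⟩ := T.split (j := e + 1) (by omega) hv
    (by rw [add_assoc]; norm_num; omega) (by rw [add_assoc]; norm_num; omega)
  rw [add_assoc, show 1 + 1 = 2 by norm_num] at hX2
  obtain ⟨a, ha, c, hc, rfl, hca, ha2, ha1⟩ := T.split (j := e) hte hX hX1 hX2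
  have uniq1 : ∀ y ∈ l, 2 ^ (e + 1) ≤ y → y ≤ a + c → y = a + c := fun y hy h1 h2 =>
    T.unique (j := e + 1) (by omega) hy hX h1 (by rw [add_assoc]; norm_num; omega) hX1
      (by rw [add_assoc]; norm_num; omega)
  have uniq2 : 2 ^ (e + 2) ≤ u → u = a + c + z := fun h =>
    T.unique (j := e + 2) (by omega) hu hv h (by rw [add_assoc]; norm_num; omega) hv1
      (by rw [add_assoc]; omega)
  have uniqu : 2 ^ (e + 1) ≤ u → u < 2 ^ (e + 2) → u = a + c := fun h h' =>
    T.unique (j := e + 1) (by omega) hu hX h (by rw [add_assoc]; norm_num; omega) hX1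
      (by rw [add_assoc]; norm_num; omega)
  refine ⟨a, ha, c, hc, ha1, by omega, hca, ?_⟩
  rcases Nat.lt_or_ge z (2 ^ (e + 1)) with h1 | h1
  · rcases Nat.lt_or_ge u (2 ^ (e + 2)) with h2 | h2
    · have := uniqu (by omega) h2
      exact Or.inr (Or.inr ⟨z, hz, by omega, Or.inr (by omega)⟩)
    · have := uniq2 h2
      exact Or.inr (Or.inr ⟨z, hz, by omega, Or.inl (by omega)⟩)
  · obtain rfl := uniq1 z hz h1 hzX
    rcases Nat.lt_or_ge u (2 ^ (e + 2)) with h2 | h2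
    · rcases Nat.lt_or_ge u (2 ^ (e + 1)) with h3 | h3
      · exact Or.inr (Or.inr ⟨u, hu, by omega, Or.inr (by omega)⟩)
      · have := uniqu h3 h2
        exact Or.inr (Or.inl (by omega))
    · have := uniq2 h2
      exact Or.inl (by omega)

end TwoStep

namespace IsTopSum

variable {m k t p q x y : ℕ} {B V : List ℕ}

/-- The case of a second term three levels below the first and above the last small step. -/
theorem false_of_lt_level (hm : 1 ≤ m) (hk : 3 ≤ k) (T : TwoStep t (2 * m + k + 7) p q B V)
    (hx : x ∈ V) (hy : y ∈ V) (hny : 3 ≤ nu y) (hn : thurberNumber m k = x + y)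
    (hx0 : 36 * 2 ^ (2 * m + k + 2) ≤ x) (hx1 : x < 40 * 2 ^ (2 * m + k + 2))
    (hy1 : 4 * 2 ^ (2 * m + k + 2) ≤ y) (hy2 : y < 8 * 2 ^ (2 * m + k + 2))
    (ht : t < 2 * m + k + 4) : False := by
  have H3 := (thurberNumber_target hm hk).mod_four
  have e4 : 2 ^ (2 * m + k + 4) = 4 * 2 ^ (2 * m + k + 2) := by ring
  have e5 : 2 ^ (2 * m + k + 4 + 1) = 8 * 2 ^ (2 * m + k + 2) := by ring
  have ny := T.ch.nu_le_four hy
  have uniq : ∀ z ∈ V, 4 * 2 ^ (2 * m + k + 2) ≤ z → z < 8 * 2 ^ (2 * m + k + 2) → z = y :=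
    fun z hz h1 h2 => T.unique ht hz hy (by omega) (by omega) (by omega) (by omega)
  have h52 : ∀ z ∈ V, z < 4 * 2 ^ (2 * m + k + 2) → thurberNumber m k ≠ 5 * y + 2 * z :=
    fun z hz h => T.thurberNumber_ne_five_mul_add_two_mul' hm hk ht hy hz hny hy1 hy2 h
  obtain ⟨a, ha, c, hc, ha1, ha2, hca, h⟩ := T.eq_cases ht.le hx (by omega) (by omega)
  obtain rfl := uniq a ha (by omega) (by omega)
  have hc' : c = a ∨ c < 4 * 2 ^ (2 * m + k + 2) := by
    rcases Nat.lt_or_ge c (4 * 2 ^ (2 * m + k + 2)) with h | h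
    · exact Or.inr h
    · exact Or.inl (uniq c hc h (by omega))
  rcases h with h | h | ⟨z, hz, hz2, h⟩
  · rcases hc' with rfl | hc'
    · exact thurberNumber_ne_nine_mul hm hk ny (by omega)
    · exact T.thurberNumber_ne_five_mul_add_four_mul hm hk ht hy hc hny hy1 hy2 hc' (by omega)
  · rcases hc' with rfl | hc'
    · exact thurberNumber_ne_seven_mul hm hk ny (by omega)
    · omega
  have hz' : z = a ∨ z < 4 * 2 ^ (2 * m + k + 2) := by
    rcases Nat.lt_or_ge z (4 * 2 ^ (2 * m + k + 2)) with h | h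
    · exact Or.inr h
    · exact Or.inl (uniq z hz h (by omega))
  rcases h with h | h
  · rcases hc' with hc' | hc' <;> rcases hz' with hz' | hz'
    · exact thurberNumber_ne_seven_mul hm hk ny (by omega)
    · exact h52 z hz hz' (by omega)
    · exact h52 c hc hc' (by omega)
    · omega
  · omega

/-- The case of a second term three levels below the first and produced by the last small step. -/
theorem false_of_eq_level (hm : 1 ≤ m) (hk : 3 ≤ k)
    (T : TwoStep (2 * m + k + 4) (2 * m + k + 7) p q B V)
    (hx : x ∈ V) (hnx : 4 ≤ nu x) (hny : 4 ≤ nu (p + q)) (hn : thurberNumber m k = x + (p + q))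
    (hx0 : 36 * 2 ^ (2 * m + k + 2) ≤ x) (hx1 : x < 40 * 2 ^ (2 * m + k + 2)) : False := by
  have H := thurberNumber_target hm hk
  have H2 := H.high
  have H3 := H.mod_four
  have e4 : 2 ^ (2 * m + k + 4) = 4 * 2 ^ (2 * m + k + 2) := by ring
  have e5 : 2 ^ (2 * m + k + 4 + 1) = 8 * 2 ^ (2 * m + k + 2) := by ring
  have e7 : 2 ^ (2 * m + k + 7) = 32 * 2 ^ (2 * m + k + 2) := by ring
  have S8 := two_pow_le (show 3 ≤ 2 * m + k + 2 by omega)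
  have Seven : 2 ^ (2 * m + k + 2) = 4 * 2 ^ (2 * m + k) := by ring
  have ny := T.nu_w
  have hl := T.low
  have hh := T.high
  have mw := T.eight_mul_le
  have mb : ∀ {b}, b ∈ B → b ≤ 6 * 2 ^ (2 * m + k + 2) := fun hb => by
    have := T.hB.two_mul_le hb (T.hB.lt hb)
    omega
  have x36 : x ≠ 36 * 2 ^ (2 * m + k + 2) := by
    rintro rfl
    rw [mul_comm, nu_two_pow_mul] at hnx
    norm_num [nu] at hnx
  -- Replacing `p + q` by `b + r` rewrites each combination of `p + q` and a top-level `b` in terms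
  -- of two numbers with at most two ones each, which the automaton can exclude.
  have compl : ∀ {b}, b ∈ B → 4 * 2 ^ (2 * m + k + 2) ≤ b → ∃ r, p + q = b + r ∧ nu r ≤ 2 ∧
      r < 4 * 2 ^ (2 * m + k + 2) := by
    intro b hb hb1
    obtain ⟨r, hr, hr1, hr2, -⟩ := T.exists_compat hny hb (by omega)
    exact ⟨r, hr1, T.hB.nu_le_two hr, by omega⟩
  have nub : ∀ {b}, b ∈ B → nu b ≤ 2 := T.hB.nu_le_two
  have h54 : ∀ b, b ∈ B → thurberNumber m k ≠ 5 * (p + q) + 4 * b := by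
    intro b hb e
    have b6 := mb hb
    rcases Nat.lt_or_ge b (4 * 2 ^ (2 * m + k + 2)) with h | h
    · have := seven_mul_le_of_eq_five_mul_add hm hk ny (nub hb) h (by omega) e
      have := T.w_even_of_five_le (by omega) (by omega)
      omega
    · obtain ⟨r, hr, nr, -⟩ := compl hb h
      obtain ⟨b', rfl⟩ := Nat.exists_eq_add_of_le h
      have nb := nub hb
      rw [← e4, nu_two_pow_add (by omega)] at nb
      exact thurber_ne hm hk (α := 9) (β := 5) (A := 1) (B := 2) (cy := 2) (cu := 5) (y := b')
        (u := r) 36 (by decide +kernel) (by omega) (by omega) (by omega) (by omega) nr (by omega)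
  have h52 : ∀ b, b ∈ B → thurberNumber m k ≠ 5 * (p + q) + 2 * b := by
    intro b hb e
    have b6 := mb hb
    rcases Nat.lt_or_ge b (4 * 2 ^ (2 * m + k + 2)) with h | h
    · exact thurberNumber_ne_five_mul_add_two_mul hm hk ny (nub hb) h (by omega) e
    · obtain ⟨r, hr, nr, -⟩ := compl hb h
      exact thurber_ne hm hk (α := 7) (β := 5) (A := 2) (B := 2) (cy := 5) (cu := 5) (y := b)
        (u := r) 0 (by decide +kernel) (by omega) (by omega) (by omega) (nub hb) nr (by omega)
  have h43 : ∀ b, b ∈ B → 4 * 2 ^ (2 * m + k + 2) ≤ b →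
      thurberNumber m k ≠ 4 * (p + q) + 3 * b := by
    intro b hb h e
    obtain ⟨r, hr, nr, -⟩ := compl hb h
    exact thurber_ne hm hk (α := 7) (β := 4) (A := 2) (B := 2) (cy := 5) (cu := 5) (y := b)
      (u := r) 0 (by decide +kernel) (by omega) (by omega) (by omega) (nub hb) nr (by omega)
  have h34 : ∀ b c, b ∈ B → c ∈ B → 36 * 2 ^ (2 * m + k + 2) ≤ 2 * (p + q + (b + c)) →
      thurberNumber m k ≠ 3 * (p + q) + 2 * (b + c) := by
    intro b c hb hc h e
    have b6 := mb hb
    have c6 := mb hc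
    rcases lt_trichotomy b c with hbc | rfl | hbc
    · obtain ⟨h1, -⟩ := T.hB.level_pair hb hc (by omega) hbc (T.hB.lt hc)
      omega
    · obtain ⟨r, hr, nr, -⟩ := compl hb (by omega)
      exact thurber_ne hm hk (α := 7) (β := 3) (A := 2) (B := 2) (cy := 5) (cu := 5) (y := b)
        (u := r) 0 (by decide +kernel) (by omega) (by omega) (by omega) (nub hb) nr (by omega)
    · obtain ⟨h1, -⟩ := T.hB.level_pair hc hb (by omega) hbc (T.hB.lt hb)
      omega
  obtain ⟨a, ha, c, hc, ha1, ha2, hca, h⟩ := T.eq_cases le_rfl hx (by omega) (by omega)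
  have hac : (a = p + q ∧ c = p + q) ∨ (∃ b ∈ B, a + c = p + q + b) ∨ (a ∈ B ∧ c ∈ B) := by
    rcases T.base_cases ha (by omega) with h1 | h1 <;>
      rcases T.base_cases hc (by omega) with h2 | h2
    · exact Or.inl ⟨h1, h2⟩
    · exact Or.inr (Or.inl ⟨c, h2, by omega⟩)
    · exact Or.inr (Or.inl ⟨a, h1, by omega⟩)
    · exact Or.inr (Or.inr ⟨h1, h2⟩)
  have hz' : ∀ z ∈ V, z < 2 * 2 ^ (2 * m + k + 4) → z = p + q ∨ z ∈ B :=
    fun z hz h => T.base_cases hz (by omega)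
  have h9 := thurberNumber_ne_nine_mul hm hk ny
  have h7 := thurberNumber_ne_seven_mul hm hk ny
  rcases hac with ⟨ha', hc'⟩ | ⟨b, hb, hab⟩ | ⟨ha', hc'⟩
  · rcases h with h | h | ⟨z, hz, hz2, h⟩
    · omega
    · omega
    · rcases hz' z hz hz2 with hzw | hzB
      · omega
      · have z6 := mb hzB
        rcases h with h | h
        · exact h52 z hzB (by omega)
        · omega
  · have b6 := mb hb
    rcases h with h | h | ⟨z, hz, hz2, h⟩
    · exact h54 b hb (by omega)
    · exact h43 b hb (by omega) (by omega)
    · rcases hz' z hz hz2 with hzw | hzB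
      · rcases h with h | h
        · exact h52 b hb (by omega)
        · omega
      · have z6 := mb hzB
        rcases h with h | h
        · exact h34 b z hb hzB (by omega) (by omega)
        · omega
  · have a6 := mb ha'
    have c6 := mb hc'
    rcases h with h | h | ⟨z, hz, hz2, h⟩
    · have := T.hB.nu_add_le_two ha' hc' (by omega)
      rw [h, show 4 * (a + c) = 2 ^ 2 * (a + c) by norm_num, nu_two_pow_mul] at hnx
      omega
    · omega
    · rcases hz' z hz hz2 with hzw | hzB
      · rcases h with h | h
        · exact h34 a c ha' hc' (by omega) (by omega)
        · omega
      · have z6 := mb hzB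
        omega

/-- Seven ones require at least three in each summand, so `y ∉ B`. With `S = 2 ^ (2 * m + k + 2)`,
after the cases `x ≥ 40 * S` and `y ≥ 8 * S`, the leading digit `32 * S` of `x` is removed: `x'` and
`y` lie below `8 * S` but their sum does not. If either were below `4 * S`, the carry would lose two
ones. So both lie in `[4 * S, 8 * S)`, and it remains to compare that level with the last small
step. -/
protected theorem false (hm : 1 ≤ m) (hk : 3 ≤ k)
    (h : IsTopSum (thurberNumber m k) (2 * m + k + 7)) : False := by
  have H := thurberNumber_target hm hk
  have H1 := H.low
  have H2 := H.high
  have H3 := H.nu_eq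
  have e3 : 2 ^ (2 * m + k + 3) = 2 * 2 ^ (2 * m + k + 2) := by ring
  have e4 : 2 ^ (2 * m + k + 4) = 4 * 2 ^ (2 * m + k + 2) := by ring
  have e5 : 2 ^ (2 * m + k + 5) = 8 * 2 ^ (2 * m + k + 2) := by ring
  have e4' : 2 ^ (2 * m + k + 3 + 1) = 4 * 2 ^ (2 * m + k + 2) := by ring
  have e5' : 2 ^ (2 * m + k + 4 + 1) = 8 * 2 ^ (2 * m + k + 2) := by ring
  have e7 : 2 ^ (2 * m + k + 7) = 32 * 2 ^ (2 * m + k + 2) := by ring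
  obtain ⟨V, x, y, hV, hx, hy, hx0, hn⟩ := h
  have nxy := nu_add_le x y
  rw [← hn] at nxy
  have nx := hV.nu_le_four hx
  have ny := hV.nu_le_four hy
  rcases hV.two_cases with hc | ⟨t, p, q, B, T⟩
  · have := hc.nu_le_two hx
    have := hc.nu_le_two hy
    omega
  have hyB : y ∉ B := fun h => by
    have := T.hB.nu_le_two h
    omega
  rcases Nat.lt_or_ge x (40 * 2 ^ (2 * m + k + 2)) with hx1 | hx1
  swap
  · exact false_of_le hm hk T hx hy hyB (by omega) (by omega) hn hx1
  rcases Nat.lt_or_ge y (8 * 2 ^ (2 * m + k + 2)) with hy8 | hy8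
  swap
  · exact false_of_le_right hm hk T hx hy hyB (by omega) hn hx0 hx1 hy8
  obtain ⟨x', rfl⟩ := Nat.exists_eq_add_of_le hx0
  have nx' := nu_two_pow_add (k := 2 * m + k + 7) (r := x') (by omega)
  have nn := nu_two_pow_add (k := 2 * m + k + 7) (r := x' + y) (by omega)
  rw [← add_assoc, ← hn] at nn
  rcases Nat.lt_or_ge y (4 * 2 ^ (2 * m + k + 2)) with hy4 | hy4
  · have := nu_add_carry' (z := x') (u := y) (2 * m + k + 3) 1 (2 * m + k + 4) (by omega)
      (by omega) (by omega) (by omega)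
    omega
  rcases Nat.lt_or_ge x' (4 * 2 ^ (2 * m + k + 2)) with hx4 | hx4
  · have := nu_add_carry' (z := y) (u := x') (2 * m + k + 3) 1 (2 * m + k + 4) (by omega)
      (by omega) (by omega) (by omega)
    rw [add_comm y] at this
    omega
  have hyt := T.le_of_not_mem hy hyB
  have ht : t < 2 * m + k + 5 := lt_of_two_pow_le_of_lt hyt (by omega)
  rcases Nat.lt_or_ge t (2 * m + k + 4) with ht4 | ht4
  · exact false_of_lt_level hm hk T hx hy (by omega) hn (by omega) hx1 hy4 hy8 ht4
  obtain rfl : t = 2 * m + k + 4 := by omega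
  have hyw := (T.base_cases hy (by omega)).resolve_right hyB
  obtain ⟨x'', rfl⟩ := Nat.exists_eq_add_of_le hx4
  obtain ⟨y', hy'⟩ := Nat.exists_eq_add_of_le hy4
  have h5 := nu_two_pow_add (k := 2 * m + k + 5) (r := x'' + y') (by omega)
  have h6 := nu_add_le x'' y'
  have h7 := nu_two_pow_add (k := 2 * m + k + 4) (r := y') (by omega)
  have h8 := nu_two_pow_add (k := 2 * m + k + 4) (r := x'') (by omega)
  rw [e4, ← hy'] at h7
  rw [e4] at h8
  rw [show 4 * 2 ^ (2 * m + k + 2) + x'' + y = 2 ^ (2 * m + k + 5) + (x'' + y') by omega, h5] at nn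
  have hny : 4 ≤ nu y := by omega
  rw [hyw] at hny hn
  exact false_of_eq_level hm hk T hx (by omega) hny hn (by omega) hx1

end IsTopSum

/-! ### Lower bounds and conclusion -/

theorem lt_chainLength_thurberNumber {m k : ℕ} (hm : 1 ≤ m) (hk : 3 ≤ k) :
    2 * m + k + 10 < chainLength (thurberNumber m k) := by
  have H := thurberNumber_target hm hk
  have H1 := H.low
  have H2 := H.high
  refine lt_chainLength (E := 2 * m + k + 7) (s := 3) (by omega) (by rw [pow_succ]; omega) ?_
  intro l hl hn
  rcases H.cases hl hn with h | ⟨e, he, h⟩ | h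
  · exact h.false hm hk
  · exact h.false hm hk he
  · exact h.false hm hk

/-- The doubled number lies one level higher, so the same length allows only two small steps, and
four ones are not enough. -/
theorem lt_chainLength_two_mul_thurberNumber {m k : ℕ} (hm : 1 ≤ m) (hk : 3 ≤ k) :
    2 * m + k + 10 < chainLength (2 * thurberNumber m k) := by
  have H := thurberNumber_target hm hk
  have H1 := H.low
  have H2 := H.high
  refine lt_chainLength (E := 2 * m + k + 8) (s := 2) (by rw [pow_succ]; omega)
    (by rw [pow_succ, pow_succ]; omega) ?_
  intro l hl hn
  have := hl.nu_le_four hn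
  rw [nu_two_mul, H.nu_eq] at this
  omega

theorem mainTheorem3 :
    (∀ m k : ℕ, 1 ≤ m → 3 ≤ k →
      chainLength (2 * thurberNumber m k) = chainLength (thurberNumber m k) ∧
        ScholzHolds (thurberNumber m k) ∧ ScholzHolds (2 * thurberNumber m k)) ∧
    {n : ℕ | 0 < n ∧ chainLength (2 * n) = chainLength n ∧
      ScholzHolds n ∧ ScholzHolds (2 * n)}.Infinite := by
  have key : ∀ m k : ℕ, 1 ≤ m → 3 ≤ k →
      chainLength (2 * thurberNumber m k) = chainLength (thurberNumber m k) ∧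
        ScholzHolds (thurberNumber m k) ∧ ScholzHolds (2 * thurberNumber m k) := by
    intro m k hm hk
    obtain ⟨l, hl⟩ := thurberNumber_starChain m k
    obtain ⟨l', hl'⟩ := two_mul_thurberNumber_starChain m k
    have h1 := lt_chainLength_thurberNumber hm hk
    have h2 := lt_chainLength_two_mul_thurberNumber hm hk
    have h3 := chainLength_le_of_addChain hl.addChain
    have h4 := chainLength_le_of_addChain hl'.addChain
    exact ⟨by omega, scholzHolds_of_starChain hl (by omega), scholzHolds_of_starChain hl' (by omega)⟩
  refine ⟨key, infinite_of_thurberNumber fun k hk => ⟨?_, key 1 k le_rfl hk⟩⟩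
  rw [thurberNumber]
  positivity
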